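/- All knots and surfaces are smooth and are considered up to smooth isotopy. Let $K\subset S^3$ be a knot. *Tangle and spin.* A two-ended tangle $T_K\subset B^3$ of $K$ is what remains of $K$ when one removes from $S^3$ an open ball that meets $K$ in a trivial (unknotted) arc. The spin of $K$ is the knotted 2-sphere $\partial(T_K\times D^2)\subset\partial(B^3\times D^2)=S^4$ (corners rounded). *Even symmetric unions.* The double $\partial(T_K\times I)\subset\partial(B^3\times I)=S^3$ is the knot $K\#\overline K$, and it bounds the canonical ribbon disc $T_K\times I$. Choose a diagram of $T_K$ in $D^2$ (a generic immersed arc with endpoints on $\partial D^2$ and with over/under information). It determines an immersed picture in $S^3$ of the ribbon disc, as the union of the segments joining each point of $T_K$ to its mirror image, and a decomposition of this disc into a 0-handle for each over crossing of the diagram and a band (1-handle) for each arc of the diagram connecting two successive over crossings. An even symmetric union of $K$ is a knot in $S^3$ obtained from $K\#\overline K$, for some choice of $T_K$ and of its diagram, by adding to each band an even number (positive, negative or zero, and depending on the band) of half twists. *Slices.* A knot $J\subset S^3$ is a slice of a knotted 2-sphere $F\subset S^4$ if, after an isotopy of $F$ in $S^4$, the surface $F$ meets the equatorial $S^3\subset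 S^4$ transversely and $F\cap S^3$ is isotopic to $J$ in $S^3$. **Proposition.** For every knot $K\subset S^3$, every even symmetric union of $K$ is a slice of the spin of $K$. -/

import Mathlib

open scoped Manifold ContDiff Topology

noncomputable section

/-- The standard unit sphere `S^n` in `ℝ^(n+1)`. -/
abbrev Sph (n : ℕ) : Type := Metric.sphere (0 : EuclideanSpace ℝ (Fin (n + 1))) 1

/-- Smooth embeddings `S^m → S^n`: smooth topological embeddings whose derivative is injective
at every point. -/
structure IsSmoothSphereEmbedding {m n : ℕ} (f : Sph m → Sph n) : Prop where
  smooth : ContMDiff (𝓡 m) (𝓡 n) ∞ f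
  embedding : Topology.IsEmbedding f
  immersion : ∀ x, Function.Injective (mfderiv (𝓡 m) (𝓡 n) f x)

/-- A knot in `S^3`: a smoothly embedded circle, as a subset. -/
def IsKnot (K : Set (Sph 3)) : Prop :=
  ∃ f : Sph 1 → Sph 3, IsSmoothSphereEmbedding f ∧ Set.range f = K

/-- The subsets `A` and `B` of `S^n` are smoothly isotopic embedded `m`-spheres: there is a smooth
one-parameter family of smooth embeddings `S^m → S^n` that starts at an embedding with image `A`
and ends at one with image `B`. -/
def SmoothlyIsotopic (m : ℕ) {n : ℕ} (A B : Set (Sph n)) : Prop :=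
  ∃ H : ℝ × Sph m → Sph n,
    ContMDiff (𝓘(ℝ, ℝ).prod (𝓡 m)) (𝓡 n) ∞ H ∧
    (∀ t ∈ Set.Icc (0 : ℝ) 1, IsSmoothSphereEmbedding fun x => H (t, x)) ∧
    Set.range (fun x => H (0, x)) = A ∧
    Set.range (fun x => H (1, x)) = B

/-- The knot `J ⊂ S^3` is a slice of the knotted 2-sphere `F ⊂ S^4`: in its isotopy class, `F` can
be realized as the image of a smooth embedding `f` which meets the equatorial 3-sphere
`{x ∈ S^4 | x 0 = 0}` transversely (`0` is a regular value of the coordinate `x 0` on the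
surface), and whose intersection with this 3-sphere is `J`, up to isotopy in `S^3`. -/
def IsSlice (F : Set (Sph 4)) (J : Set (Sph 3)) : Prop :=
  ∃ f : Sph 2 → Sph 4, IsSmoothSphereEmbedding f ∧
    SmoothlyIsotopic 2 F (Set.range f) ∧
    (∀ x, (f x).1 0 = 0 → mfderiv (𝓡 2) 𝓘(ℝ, ℝ) (fun x' => (f x').1 0) x ≠ 0) ∧
    SmoothlyIsotopic 1 J
      {p : Sph 3 | ∃ x, (f x).1 0 = 0 ∧ ∀ i : Fin 4, (f x).1 i.succ = p.1 i}

theorem invStereo_mem {n : ℕ} (v : EuclideanSpace ℝ (Fin n)) :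
    (WithLp.toLp 2 (Fin.snoc (α := fun _ => ℝ) (fun i => 2 * v i / (‖v‖ ^ 2 + 1))
      ((‖v‖ ^ 2 - 1) / (‖v‖ ^ 2 + 1))) : EuclideanSpace ℝ (Fin (n + 1))) ∈
      Metric.sphere (0 : EuclideanSpace ℝ (Fin (n + 1))) 1 := by
  have h : (0 : ℝ) < ‖v‖ ^ 2 + 1 := by positivity
  rw [mem_sphere_zero_iff_norm, EuclideanSpace.norm_eq, Real.sqrt_eq_one, Fin.sum_univ_castSucc]
  simp only [Fin.snoc_castSucc, Fin.snoc_last, Real.norm_eq_abs, sq_abs, div_pow, mul_pow]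
  rw [← Finset.sum_div, ← Finset.mul_sum]
  have h2 : ∑ i, v i ^ 2 = ‖v‖ ^ 2 := by
    rw [EuclideanSpace.norm_sq_eq]
    simp
  rw [h2]
  field_simp
  ring

/-- Inverse stereographic projection `v ↦ (2 v, ‖v‖² - 1) / (‖v‖² + 1)`, which identifies `ℝ^n`
with `S^n` minus the north pole. -/
def invStereo {n : ℕ} (v : EuclideanSpace ℝ (Fin n)) : Sph n :=
  ⟨WithLp.toLp 2 (Fin.snoc (α := fun _ => ℝ) (fun i => 2 * v i / (‖v‖ ^ 2 + 1))
    ((‖v‖ ^ 2 - 1) / (‖v‖ ^ 2 + 1))), invStereo_mem v⟩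

/-- A two-ended tangle together with its closure by a trivial arc. The closed smooth curve
`s ↦ (h s, y s, z s)` in `ℝ^3 ⊂ S^3` has period `2`. The tangle is its part `s ∈ [0, 1]`, properly
embedded in the ball `{h ≥ 0} ∪ {∞}`. What is removed is the ball `{h ≤ 0} ∪ {∞}`, which contains
the rest of the curve, an unknotted arc: a part of the round circle
`y² + (h + 1)² = 2` in the plane `z = 0`. -/
structure ClosedTangle where
  h : ℝ → ℝ
  y : ℝ → ℝ
  z : ℝ → ℝ
  smooth_h : ContDiff ℝ ∞ h
  smooth_y : ContDiff ℝ ∞ y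
  smooth_z : ContDiff ℝ ∞ z
  periodic_h : Function.Periodic h 2
  periodic_y : Function.Periodic y 2
  periodic_z : Function.Periodic z 2
  injective : ∀ s ∈ Set.Ico (0 : ℝ) 2, ∀ t ∈ Set.Ico (0 : ℝ) 2,
    h s = h t → y s = y t → z s = z t → s = t
  immersion : ∀ s, deriv h s ≠ 0 ∨ deriv y s ≠ 0 ∨ deriv z s ≠ 0
  tangle_pos : ∀ s ∈ Set.Ioo (0 : ℝ) 1, 0 < h s
  arc_neg : ∀ s ∈ Set.Ioo (1 : ℝ) 2, h s < 0
  arc_circle : ∀ s ∈ Set.Icc (1 : ℝ) 2, z s = 0 ∧ y s ^ 2 + (h s + 1) ^ 2 = 2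
  h_zero : h 0 = 0
  h_one : h 1 = 0

namespace ClosedTangle

/-- The closure of the tangle, a knot in `S^3`. -/
def closure (T : ClosedTangle) : Set (Sph 3) :=
  {p | ∃ s, p = invStereo !₂[T.h s, T.y s, T.z s]}

/-- `T` is a tangle `T_K` of the knot `K`: removing from `S^3` a ball that contains a trivial arc
of `K` leaves, up to isotopy, the tangle `T`. -/
def IsTangleOf (T : ClosedTangle) (K : Set (Sph 3)) : Prop :=
  SmoothlyIsotopic 1 T.closure K

/-- The spin `∂(T × D²) ⊂ ∂(B³ × D²) = S^4` of the tangle `T ⊂ B³ = {h ≥ 0} ∪ {∞}`. The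
identification of `∂(B³ × D²) = B³ × S¹ ∪ ∂B³ × D²` with `S^4 = ℝ^4 ∪ {∞}` sends
`((h, y, z), θ) ∈ B³ × S¹` to `(√h cos θ, √h sin θ, y, z)`. Using `√h` for the distance from the axis
plane rounds the corner, so that the spin is a smooth 2-sphere. -/
def spin (T : ClosedTangle) : Set (Sph 4) :=
  {p | ∃ s ∈ Set.Icc (0 : ℝ) 1, ∃ u v : ℝ, u ^ 2 + v ^ 2 = T.h s ∧
    p = invStereo !₂[u, v, T.y s, T.z s]}

/-- The projection `(h, y, z) ↦ (y, z)` takes the tangle to a tangle diagram in the unit disc: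
a generic immersed arc with endpoints on the unit circle, whose only self-intersections are
transverse double points. -/
structure IsDiagram (T : ClosedTangle) : Prop where
  disc : ∀ s ∈ Set.Ioo (0 : ℝ) 1, T.y s ^ 2 + T.z s ^ 2 < 1
  immersion : ∀ s ∈ Set.Icc (0 : ℝ) 1, deriv T.y s ≠ 0 ∨ deriv T.z s ≠ 0
  transverse : ∀ s ∈ Set.Icc (0 : ℝ) 1, ∀ t ∈ Set.Icc (0 : ℝ) 1, s ≠ t →
    T.y s = T.y t → T.z s = T.z t → deriv T.y s * deriv T.z t - deriv T.z s * deriv T.y t ≠ 0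
  double : ∀ r ∈ Set.Icc (0 : ℝ) 1, ∀ s ∈ Set.Icc (0 : ℝ) 1, ∀ t ∈ Set.Icc (0 : ℝ) 1,
    T.y r = T.y s → T.z r = T.z s → T.y s = T.y t → T.z s = T.z t → r = s ∨ s = t ∨ r = t

/-- `s` is the parameter of an over crossing of the diagram; `h` is the height. -/
def IsOver (T : ClosedTangle) (s : ℝ) : Prop :=
  s ∈ Set.Icc (0 : ℝ) 1 ∧
    ∃ t ∈ Set.Icc (0 : ℝ) 1, T.y t = T.y s ∧ T.z t = T.z s ∧ T.h t < T.h s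

/-- `s` is the parameter of a point of a band, that is, it lies on an open arc of the diagram that
connects two successive over crossings. -/
def InBand (T : ClosedTangle) (s : ℝ) : Prop :=
  ¬ T.IsOver s ∧ (∃ o, T.IsOver o ∧ o < s) ∧ (∃ o, T.IsOver o ∧ s < o)

/-- A choice of an even number of half twists for every band, given by a twisting angle `φ`. Off
the bands the angle is locally constant with values in `2πℤ`. Along a band from the over crossing
`o` to the over crossing `o'` it changes by `φ o' - φ o = 2πk`, where `2 * k` is the (signed) number
of half twists added to this band. -/
structure IsEvenTwisting (T : ClosedTangle) (φ : ℝ → ℝ) : Prop where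
  smooth : ContDiff ℝ ∞ φ
  locally_const : ∀ s ∈ Set.Icc (0 : ℝ) 1, ¬ T.InBand s →
    ∃ k : ℤ, ∀ᶠ t in 𝓝 s, φ t = 2 * Real.pi * k

/-- The double `∂(T × I) ⊂ ∂(B³ × I) = S^3` of the tangle, with its canonical ribbon disc twisted
according to `φ`. With the coordinate `x = ±√h` on `ℝ^3 ⊂ S^3`, so that `x ↦ -x` is the reflection,
the double for `φ = 0` is `{(x, y s, z s) | x² = h s}`, which is `K # K̄`; its ribbon disc is the
union of the segments `[-√h, √h] × {(y s, z s)}`. The segment over `s` is rotated by the angle `φ s`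
about its midpoint in the plane normal to the core `s ↦ (0, y s, z s)`, and is shrunk by the factor
`δ |(y', z')|` in the second direction `(0, -z' s, y' s)` of this plane, so that for all small
`δ > 0` the twisted bands have thin twist regions, which do not meet anything else. -/
def twistedDouble (T : ClosedTangle) (φ : ℝ → ℝ) (δ : ℝ) : Set (Sph 3) :=
  {p | ∃ s ∈ Set.Icc (0 : ℝ) 1, ∃ x : ℝ, x ^ 2 = T.h s ∧
    p = invStereo !₂[x * Real.cos (φ s),
      T.y s - δ * (x * Real.sin (φ s)) * deriv T.z s,
      T.z s + δ * (x * Real.sin (φ s)) * deriv T.y s]}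

end ClosedTangle

/-- `F ⊂ S^4` is the spin of the knot `K` (up to isotopy). -/
def IsSpunKnot (K : Set (Sph 3)) (F : Set (Sph 4)) : Prop :=
  ∃ T : ClosedTangle, T.IsTangleOf K ∧ SmoothlyIsotopic 2 T.spin F

/-- `J ⊂ S^3` is an even symmetric union of the knot `K`: it is obtained, up to isotopy, from
`K # K̄` and a tangle diagram of a tangle `T_K` by adding an even number of half twists to each band
of the canonical ribbon disc. -/
def IsEvenSymmetricUnion (K J : Set (Sph 3)) : Prop :=
  ∃ T : ClosedTangle, T.IsTangleOf K ∧ T.IsDiagram ∧ ∃ φ : ℝ → ℝ, T.IsEvenTwisting φ ∧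
    ∀ᶠ δ in 𝓝[>] (0 : ℝ), SmoothlyIsotopic 1 (T.twistedDouble φ δ) J

end

noncomputable section

/-! ### Maps between spheres given by ambient formulas -/

/-! In `ℝ^4`, viewed as two spin directions plus the plane of the diagram, the spin consists of a
circle of radius `√h` over each point of the tangle diagram, in the two spin directions. The normal
to the diagram supplies a third direction, used at a small scale `δ`. Rotate the circle over `s` in
this 3-space by the angle `φ s`, about an axis that swings with time. At time 0 the axis is the
normal: every circle turns within its own plane and the surface is still the spin. At time 1 the
axis is the spin direction that is orthogonal to the equator: the circle's two points on the equator
then turn in the plane of the other spin direction and the normal, and they trace out exactly the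
twisted double (`twistMap`, `IsDiagram.eventually_isSlice`).

Evenness makes this an isotopy. A rotation through `2πk` is the identity for every axis, so near an
over crossing nothing moves at any time. For small `δ`, distinct pieces of the normal strip of the
diagram overlap only near crossings (`IsDiagram.eventually_strip_inj`). There the over circle is
flat, and its radius exceeds the distance from the diagram plane of every point of the rotated under
circle. Hence the surface stays embedded.

It remains to see that the spin depends only on the knot, since the given spun knot may come from
another tangle `T'`. For this the spin is generalized to `ballSpin`, the spin of the part of a curve
in `S^3` outside an arbitrary round ball. The spin of `T` is isotopic to the spin outside a
hemisphere. That ball is then shrunk, along the round trivial arc, to a small ball about the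
midpoint `arcPoint` of the arc, which is the same point for all closed tangles. A given isotopy of
closures drags the small ball along, centered on a moving point of the curve; by compactness a
sufficiently small ball meets the moving curve in one short arc throughout. Concatenating these
isotopies gives `ClosedTangle.spin_isotopic`.

All these surfaces are surfaces of revolution over an interval, composed with an ambient map. A
profile with simple zeros at both ends has the form `(1 - c²) g` with `g > 0`, so the surface has a
smooth parametrization by `S²`. Maps to spheres are written as radial projections of ambient
formulas, so that embedding conditions become statements about vectors up to positive multiples. -/

theorem fact_finrank_euclideanSpace (n : ℕ) :
    Fact (Module.finrank ℝ (EuclideanSpace ℝ (Fin (n + 1))) = n + 1) :=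
  ⟨finrank_euclideanSpace_fin⟩

theorem single_zero_mem_sphere (n : ℕ) :
    (EuclideanSpace.single 0 1 : EuclideanSpace ℝ (Fin (n + 1))) ∈
      Metric.sphere (0 : EuclideanSpace ℝ (Fin (n + 1))) 1 := by
  simp

/-- The radial projection of a nonzero vector to the unit sphere. -/
def dirSphere {n : ℕ} (v : EuclideanSpace ℝ (Fin (n + 1))) : Sph n :=
  if h : v = 0 then ⟨EuclideanSpace.single 0 1, single_zero_mem_sphere n⟩
  else ⟨‖v‖⁻¹ • v, by
    rw [mem_sphere_zero_iff_norm, norm_smul, norm_inv, norm_norm,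
      inv_mul_cancel₀ (norm_ne_zero_iff.2 h)]⟩

theorem dirSphere_coe {n : ℕ} {v : EuclideanSpace ℝ (Fin (n + 1))} (h : v ≠ 0) :
    (dirSphere v).1 = ‖v‖⁻¹ • v := by
  simp [dirSphere, h]

theorem dirSphere_smul {n : ℕ} {v : EuclideanSpace ℝ (Fin (n + 1))} (h : v ≠ 0) {r : ℝ}
    (hr : 0 < r) : dirSphere (r • v) = dirSphere v := by
  apply Subtype.ext
  rw [dirSphere_coe (smul_ne_zero hr.ne' h), dirSphere_coe h, norm_smul, Real.norm_eq_abs,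
    abs_of_pos hr, smul_smul]
  congr 1
  have := norm_ne_zero_iff.2 h
  field_simp

theorem dirSphere_eq_iff {n : ℕ} {v w : EuclideanSpace ℝ (Fin (n + 1))} (hv : v ≠ 0)
    (hw : w ≠ 0) : dirSphere v = dirSphere w ↔ ∃ r : ℝ, 0 < r ∧ v = r • w := by
  constructor
  · intro h
    have h1 := congrArg Subtype.val h
    rw [dirSphere_coe hv, dirSphere_coe hw] at h1
    have hv' := norm_pos_iff.2 hv
    have hw' := norm_pos_iff.2 hw
    refine ⟨‖v‖ * ‖w‖⁻¹, by positivity, ?_⟩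
    rw [mul_smul, ← h1, smul_smul, mul_inv_cancel₀ hv'.ne', one_smul]
  · rintro ⟨r, hr, rfl⟩
    exact dirSphere_smul hw hr

theorem dirSphere_coe_self {n : ℕ} (x : Sph n) : dirSphere x.1 = x := by
  have h : ‖x.1‖ = 1 := mem_sphere_zero_iff_norm.1 x.2
  have h0 : x.1 ≠ 0 := by rw [← norm_ne_zero_iff, h]; exact one_ne_zero
  apply Subtype.ext
  rw [dirSphere_coe h0, h, inv_one, one_smul]

theorem contMDiff_dirSphere {n : ℕ} {E H M : Type*} [NormedAddCommGroup E] [NormedSpace ℝ E]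
    [TopologicalSpace H] {I : ModelWithCorners ℝ E H} [TopologicalSpace M] [ChartedSpace H M]
    [IsManifold I ∞ M] {f : M → EuclideanSpace ℝ (Fin (n + 1))}
    (hf : ContMDiff I 𝓘(ℝ, EuclideanSpace ℝ (Fin (n + 1))) ∞ f) (h0 : ∀ x, f x ≠ 0) :
    ContMDiff I (𝓡 n) ∞ (fun x => dirSphere (f x)) := by
  have h1 : ContMDiff I 𝓘(ℝ, EuclideanSpace ℝ (Fin (n + 1))) ∞ (fun x => ‖f x‖⁻¹ • f x) := by
    intro x
    have : ContDiffAt ℝ ∞ (fun v : EuclideanSpace ℝ (Fin (n + 1)) => ‖v‖⁻¹ • v) (f x) :=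
      ((contDiffAt_norm ℝ (h0 x)).inv (norm_ne_zero_iff.2 (h0 x))).smul contDiffAt_id
    exact this.contMDiffAt.comp x (hf x)
  have h2 : ∀ x, ‖f x‖⁻¹ • f x ∈ Metric.sphere (0 : EuclideanSpace ℝ (Fin (n + 1))) 1 := by
    intro x
    rw [← dirSphere_coe (h0 x)]
    exact (dirSphere (f x)).2
  have := fact_finrank_euclideanSpace n
  have h3 := h1.codRestrict_sphere (n := n) h2
  have h4 : (fun x => dirSphere (f x)) = Set.codRestrict (fun x => ‖f x‖⁻¹ • f x) _ h2 := by
    ext1 x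
    apply Subtype.ext
    rw [dirSphere_coe (h0 x)]
    rfl
  rw [h4]
  exact h3

theorem contMDiff_coe_sph {n : ℕ} : ContMDiff (𝓡 n) 𝓘(ℝ, EuclideanSpace ℝ (Fin (n + 1))) ∞
    ((↑) : Sph n → EuclideanSpace ℝ (Fin (n + 1))) := by
  have := fact_finrank_euclideanSpace n
  exact contMDiff_coe_sphere

theorem mdifferentiableAt_coe_sph {n : ℕ} (x : Sph n) :
    MDifferentiableAt (𝓡 n) 𝓘(ℝ, EuclideanSpace ℝ (Fin (n + 1)))
      ((↑) : Sph n → EuclideanSpace ℝ (Fin (n + 1))) x :=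
  (contMDiff_coe_sph x).mdifferentiableAt (by simp)

theorem mfderiv_coe_sph_injective {n : ℕ} (x : Sph n) :
    Function.Injective (mfderiv (𝓡 n) 𝓘(ℝ, EuclideanSpace ℝ (Fin (n + 1)))
      ((↑) : Sph n → EuclideanSpace ℝ (Fin (n + 1))) x) := by
  have := fact_finrank_euclideanSpace n
  exact injective_mvfderiv_subtypeVal_sphere x

theorem mfderiv_coe_sph_range {n : ℕ} (x : Sph n) (ξ : EuclideanSpace ℝ (Fin (n + 1))) :
    (∃ v, mfderiv (𝓡 n) 𝓘(ℝ, EuclideanSpace ℝ (Fin (n + 1)))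
      ((↑) : Sph n → EuclideanSpace ℝ (Fin (n + 1))) x v = ξ) ↔ inner ℝ x.1 ξ = 0 := by
  have := fact_finrank_euclideanSpace n
  have h := range_mvfderiv_subtypeVal (n := n) x
  rw [← Submodule.mem_orthogonal_singleton_iff_inner_right, ← h]
  rfl

theorem mfderiv_comp_coe_sph {n : ℕ} {F : Type*} [NormedAddCommGroup F] [NormedSpace ℝ F]
    {f : EuclideanSpace ℝ (Fin (n + 1)) → F} (x : Sph n) (hf : DifferentiableAt ℝ f x.1)
    (v : TangentSpace (𝓡 n) x) :
    mfderiv (𝓡 n) 𝓘(ℝ, F) (fun y : Sph n => f y.1) x v =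
      fderiv ℝ f x.1 (mfderiv (𝓡 n) 𝓘(ℝ, EuclideanSpace ℝ (Fin (n + 1)))
      ((↑) : Sph n → EuclideanSpace ℝ (Fin (n + 1))) x v) := by
  have := mfderiv_comp (I := 𝓡 n) (I' := 𝓘(ℝ, EuclideanSpace ℝ (Fin (n + 1)))) (I'' := 𝓘(ℝ, F))
    x (g := f) (f := ((↑) : Sph n → EuclideanSpace ℝ (Fin (n + 1))))
    hf.mdifferentiableAt (mdifferentiableAt_coe_sph x)
  rw [mfderiv_eq_fderiv] at this
  exact congrArg (fun L => L v) this

theorem mfderiv_coe_comp {m n : ℕ} {f : Sph m → Sph n} (hf : ContMDiff (𝓡 m) (𝓡 n) ∞ f)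
    (x : Sph m) (v : TangentSpace (𝓡 m) x) :
    mfderiv (𝓡 m) 𝓘(ℝ, EuclideanSpace ℝ (Fin (n + 1))) (fun y => (f y).1) x v =
      mfderiv (𝓡 n) 𝓘(ℝ, EuclideanSpace ℝ (Fin (n + 1)))
        ((↑) : Sph n → EuclideanSpace ℝ (Fin (n + 1))) (f x) (mfderiv (𝓡 m) (𝓡 n) f x v) := by
  have := mfderiv_comp (I := 𝓡 m) (I' := 𝓡 n) (I'' := 𝓘(ℝ, EuclideanSpace ℝ (Fin (n + 1))))
    x (g := ((↑) : Sph n → EuclideanSpace ℝ (Fin (n + 1)))) (f := f)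
    (mdifferentiableAt_coe_sph (f x)) ((hf x).mdifferentiableAt (by simp))
  exact congrArg (fun L => L v) this

theorem isEmbedding_of_injective {m n : ℕ} {f : Sph m → Sph n} (hf : Continuous f)
    (hi : Function.Injective f) : Topology.IsEmbedding f :=
  (hf.isClosedEmbedding hi).isEmbedding

/-- The derivative of the radial projection kills exactly the radial direction. -/
theorem exists_smul_of_fderiv_dir {n : ℕ} {E : Type*} [NormedAddCommGroup E] [NormedSpace ℝ E]
    {Φ : E → EuclideanSpace ℝ (Fin (n + 1))} {x ξ : E} (hΦ : DifferentiableAt ℝ Φ x)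
    (h0 : Φ x ≠ 0) (h : fderiv ℝ (fun y => ‖Φ y‖⁻¹ • Φ y) x ξ = 0) :
    ∃ μ : ℝ, HasDerivAt (fun r : ℝ => Φ (x + r • ξ)) (μ • Φ x) 0 := by
  have hline : HasDerivAt (fun r : ℝ => x + r • ξ) ξ 0 := by
    simpa using ((hasDerivAt_id (0 : ℝ)).smul_const ξ).const_add x
  have hx : x + (0 : ℝ) • ξ = x := by simp
  have h1 : HasDerivAt (fun r : ℝ => Φ (x + r • ξ)) (fderiv ℝ Φ x ξ) 0 := by
    apply HasFDerivAt.comp_hasDerivAt (0 : ℝ) _ hline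
    rw [hx]; exact hΦ.hasFDerivAt
  have hN : DifferentiableAt ℝ (fun y => ‖Φ y‖) x := hΦ.norm ℝ h0
  have hN0 : ‖Φ x‖ ≠ 0 := norm_ne_zero_iff.2 h0
  have h2 : HasFDerivAt (fun y => ‖Φ y‖⁻¹) (-(‖Φ x‖ ^ 2)⁻¹ • fderiv ℝ (fun y => ‖Φ y‖) x) x :=
    (hasDerivAt_inv hN0).comp_hasFDerivAt x hN.hasFDerivAt
  have h3 := (h2.fun_smul hΦ.hasFDerivAt).fderiv
  have h4 : fderiv ℝ (fun y => ‖Φ y‖⁻¹ • Φ y) x ξ =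
      ‖Φ x‖⁻¹ • fderiv ℝ Φ x ξ + (-(‖Φ x‖ ^ 2)⁻¹ * fderiv ℝ (fun y => ‖Φ y‖) x ξ) • Φ x := by
    have h5 := congrArg (fun L => L ξ) h3
    simpa using h5
  rw [h] at h4
  refine ⟨‖Φ x‖ * ((‖Φ x‖ ^ 2)⁻¹ * fderiv ℝ (fun y => ‖Φ y‖) x ξ), ?_⟩
  convert h1 using 1
  have h6 : ‖Φ x‖⁻¹ • fderiv ℝ Φ x ξ = ((‖Φ x‖ ^ 2)⁻¹ * fderiv ℝ (fun y => ‖Φ y‖) x ξ) • Φ x := by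
    rw [neg_mul, neg_smul] at h4
    exact (add_neg_eq_zero.1 h4.symm)
  rw [mul_smul, ← h6, smul_smul, mul_inv_cancel₀ hN0, one_smul]

/-- A map of the ambient spaces induces a smooth embedding of spheres by radial projection if it
separates points and tangent directions of the sphere up to positive multiples. -/
theorem isSmoothSphereEmbedding_dirSphere {m n : ℕ}
    {Φ : EuclideanSpace ℝ (Fin (m + 1)) → EuclideanSpace ℝ (Fin (n + 1))}
    (hs : ∀ x, ‖x‖ = 1 → ContDiffAt ℝ ∞ Φ x) (h0 : ∀ x, ‖x‖ = 1 → Φ x ≠ 0)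
    (hinj : ∀ x y, ‖x‖ = 1 → ‖y‖ = 1 → ∀ r : ℝ, 0 < r → Φ x = r • Φ y → x = y)
    (himm : ∀ x ξ, ‖x‖ = 1 → inner ℝ x ξ = 0 → ∀ μ : ℝ,
      HasDerivAt (fun r : ℝ => Φ (x + r • ξ)) (μ • Φ x) 0 → ξ = 0) :
    IsSmoothSphereEmbedding (fun x : Sph m => dirSphere (Φ x.1)) := by
  have hn : ∀ x : Sph m, ‖x.1‖ = 1 := fun x => mem_sphere_zero_iff_norm.1 x.2
  have hsm : ContMDiff (𝓡 m) (𝓡 n) ∞ (fun x : Sph m => dirSphere (Φ x.1)) := by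
    apply contMDiff_dirSphere
    · intro x
      exact (hs x.1 (hn x)).contMDiffAt.comp x (contMDiff_coe_sph x)
    · exact fun x => h0 x.1 (hn x)
  refine ⟨hsm, isEmbedding_of_injective hsm.continuous ?_, ?_⟩
  · intro x y hxy
    obtain ⟨r, hr, h⟩ := (dirSphere_eq_iff (h0 _ (hn x)) (h0 _ (hn y))).1 hxy
    exact Subtype.ext (hinj _ _ (hn x) (hn y) r hr h)
  · intro x
    rw [injective_iff_map_eq_zero]
    intro v hv
    have h1 := mfderiv_coe_comp hsm x v
    rw [hv, map_zero] at h1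
    have hd : DifferentiableAt ℝ Φ x.1 := (hs _ (hn x)).differentiableAt (by simp)
    have h2 : (fun y : Sph m => (dirSphere (Φ y.1)).1) =
        fun y : Sph m => (fun z => ‖Φ z‖⁻¹ • Φ z) y.1 := by
      ext1 y
      exact dirSphere_coe (h0 _ (hn y))
    have hd' : DifferentiableAt ℝ (fun z => ‖Φ z‖⁻¹ • Φ z) x.1 :=
      ((hd.norm ℝ (h0 _ (hn x))).inv (norm_ne_zero_iff.2 (h0 _ (hn x)))).smul hd
    have h1 := (congrArg (fun g => mfderiv (𝓡 m) 𝓘(ℝ, EuclideanSpace ℝ (Fin (n + 1))) g x v)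
      h2).symm.trans h1
    have h1 := (mfderiv_comp_coe_sph x hd' v).symm.trans h1
    · obtain ⟨μ, hμ⟩ := exists_smul_of_fderiv_dir hd (h0 _ (hn x)) h1
      have h3 := himm x.1 _ (hn x) ((mfderiv_coe_sph_range x _).1 ⟨v, rfl⟩) μ hμ
      exact (injective_iff_map_eq_zero _).1 (mfderiv_coe_sph_injective x) v h3

/-- A smooth family of ambient maps as in `isSmoothSphereEmbedding_dirSphere` is an isotopy. -/
theorem smoothlyIsotopic_dirSphere {m n : ℕ}
    {Φ : ℝ × EuclideanSpace ℝ (Fin (m + 1)) → EuclideanSpace ℝ (Fin (n + 1))}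
    (hs : ∀ t x, ‖x‖ = 1 → ContDiffAt ℝ ∞ Φ (t, x)) (h0 : ∀ t x, ‖x‖ = 1 → Φ (t, x) ≠ 0)
    (hinj : ∀ t ∈ Set.Icc (0 : ℝ) 1, ∀ x y, ‖x‖ = 1 → ‖y‖ = 1 → ∀ r : ℝ, 0 < r →
      Φ (t, x) = r • Φ (t, y) → x = y)
    (himm : ∀ t ∈ Set.Icc (0 : ℝ) 1, ∀ x ξ, ‖x‖ = 1 → inner ℝ x ξ = 0 → ∀ μ : ℝ,
      HasDerivAt (fun r : ℝ => Φ (t, x + r • ξ)) (μ • Φ (t, x)) 0 → ξ = 0) :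
    (∀ t ∈ Set.Icc (0 : ℝ) 1,
      IsSmoothSphereEmbedding (fun x : Sph m => dirSphere (Φ (t, x.1)))) ∧
    SmoothlyIsotopic m (Set.range fun x : Sph m => dirSphere (Φ (0, x.1)))
      (Set.range fun x : Sph m => dirSphere (Φ (1, x.1))) := by
  have hE : ∀ t ∈ Set.Icc (0 : ℝ) 1,
      IsSmoothSphereEmbedding (fun x : Sph m => dirSphere (Φ (t, x.1))) := by
    intro t ht
    apply isSmoothSphereEmbedding_dirSphere (Φ := fun x => Φ (t, x)) _ (h0 t) (hinj t ht)
      (himm t ht)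
    intro x hx
    exact (hs t x hx).comp x (contDiffAt_const.prodMk contDiffAt_id)
  refine ⟨hE, fun p => dirSphere (Φ (p.1, p.2.1)), ?_, hE, rfl, rfl⟩
  have hn : ∀ x : Sph m, ‖x.1‖ = 1 := fun x => mem_sphere_zero_iff_norm.1 x.2
  apply contMDiff_dirSphere (f := fun p : ℝ × Sph m => Φ (p.1, p.2.1))
  · intro p
    apply (hs p.1 p.2.1 (hn _)).contMDiffAt.comp p
    have h1 : ContMDiffAt (𝓘(ℝ, ℝ).prod (𝓡 m)) (𝓘(ℝ, EuclideanSpace ℝ (Fin (m + 1)))) ∞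
      (fun p : ℝ × Sph m => p.2.1) p := (contMDiff_coe_sph p.2).comp p contMDiffAt_snd
    exact contMDiffAt_fst.prodMk_space h1
  · exact fun p => h0 _ _ (hn _)

theorem SmoothlyIsotopic.symm {m n : ℕ} {A B : Set (Sph n)} (h : SmoothlyIsotopic m A B) :
    SmoothlyIsotopic m B A := by
  obtain ⟨H, h1, h2, h3, h4⟩ := h
  refine ⟨fun p => H (1 - p.1, p.2), ?_, ?_, ?_, ?_⟩
  · apply h1.comp
    apply ContMDiff.prodMk _ contMDiff_snd
    exact (contDiff_const.sub contDiff_id).contMDiff.comp contMDiff_fst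
  · intro t ht
    exact h2 (1 - t) ⟨by linarith [ht.2], by linarith [ht.1]⟩
  · simpa using h4
  · simpa using h3

/-! ### Reparametrization and concatenation of isotopies -/

namespace IsSmoothSphereEmbedding

theorem continuous_lift {m n : ℕ} {f g : Sph m → Sph n} (hf : IsSmoothSphereEmbedding f)
    (hg : IsSmoothSphereEmbedding g) {ψ : Sph m → Sph m} (hψ : ∀ x, g (ψ x) = f x) :
    Continuous ψ := by
  rw [hg.embedding.continuous_iff]
  have : g ∘ ψ = f := funext hψ
  rw [this]
  exact hf.smooth.continuous

/-- An immersion has a smooth local left inverse: compose with a linear left inverse of its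
derivative and apply the inverse function theorem. Locally `ψ` is this left inverse applied to `f`.
This compares two parametrizations of the same embedded sphere. -/
theorem contMDiff_lift {m n : ℕ} {f g : Sph m → Sph n} (hf : IsSmoothSphereEmbedding f)
    (hg : IsSmoothSphereEmbedding g) {ψ : Sph m → Sph m} (hψ : ∀ x, g (ψ x) = f x) :
    ContMDiff (𝓡 m) (𝓡 m) ∞ ψ := by
  have hc := hf.continuous_lift hg hψ
  intro x₀
  rw [contMDiffAt_iff_target]
  refine ⟨hc.continuousAt, ?_⟩
  set y₀ := ψ x₀ with hy₀
  set φ := extChartAt (𝓡 m) y₀ with hφ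
  set F : Sph m → EuclideanSpace ℝ (Fin (n + 1)) := fun y => (g y).1 with hF
  have hFs : ContMDiff (𝓡 m) 𝓘(ℝ, EuclideanSpace ℝ (Fin (n + 1))) ∞ F :=
    contMDiff_coe_sph.comp hg.smooth
  have hsm : ContDiffAt ℝ ∞ (F ∘ φ.symm) (φ y₀) := by
    have h1 : ContMDiffAt 𝓘(ℝ, EuclideanSpace ℝ (Fin m)) (𝓡 m) ∞ φ.symm (φ y₀) :=
      (contMDiffOn_extChartAt_symm y₀).contMDiffAt (extChartAt_target_mem_nhds y₀)
    exact (hFs.contMDiffAt.comp _ h1).contDiffAt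
  have hinj : Function.Injective (fderiv ℝ (F ∘ φ.symm) (φ y₀)) := by
    have h1 : Function.Injective
        (mfderiv (𝓡 m) 𝓘(ℝ, EuclideanSpace ℝ (Fin (n + 1))) F y₀) := by
      rw [injective_iff_map_eq_zero]
      intro v hv
      have h2 := (mfderiv_coe_comp hg.smooth y₀ v).symm.trans hv
      have h3 := (injective_iff_map_eq_zero _).1 (mfderiv_coe_sph_injective (g y₀)) _ h2
      exact (injective_iff_map_eq_zero _).1 (hg.immersion y₀) v h3
    have h2 : MDifferentiableAt (𝓡 m) 𝓘(ℝ, EuclideanSpace ℝ (Fin (n + 1))) F y₀ :=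
      (hFs y₀).mdifferentiableAt (by simp)
    rw [h2.mfderiv] at h1
    rw [ModelWithCorners.Boundaryless.range_eq_univ, fderivWithin_univ] at h1
    exact h1
  obtain ⟨P, hP⟩ := LinearMap.exists_leftInverse_of_injective
    (fderiv ℝ (F ∘ φ.symm) (φ y₀)).toLinearMap (LinearMap.ker_eq_bot.2 hinj)
  set Q : EuclideanSpace ℝ (Fin (n + 1)) →L[ℝ] EuclideanSpace ℝ (Fin m) :=
    LinearMap.toContinuousLinearMap P with hQ
  -- In the chart, `Q` makes the derivative of `g` the identity at the base point, so `R` is locally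
  -- invertible and `φ ∘ ψ = R⁻¹ ∘ Q ∘ f` nearby.
  set R : EuclideanSpace ℝ (Fin m) → EuclideanSpace ℝ (Fin m) := fun v => Q (F (φ.symm v)) with hR
  have hRs : ContDiffAt ℝ ∞ R (φ y₀) := Q.contDiff.contDiffAt.comp _ hsm
  have hR' : HasFDerivAt R
      ((ContinuousLinearEquiv.refl ℝ (EuclideanSpace ℝ (Fin m)) :
        EuclideanSpace ℝ (Fin m) →L[ℝ] EuclideanSpace ℝ (Fin m))) (φ y₀) := by
    have h1 := Q.hasFDerivAt.comp (φ y₀) (hsm.differentiableAt (by simp)).hasFDerivAt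
    refine h1.congr_fderiv ?_
    ext1 v
    exact congrArg (fun L => L v) hP
  have hloc : ContDiffAt ℝ ∞ (hRs.localInverse hR' (by simp)) (R (φ y₀)) :=
    hRs.to_localInverse hR' (by simp)
  have hstrict := hRs.hasStrictFDerivAt' hR' (by simp)
  have hleft := hstrict.eventually_left_inverse
  have hcφ : ContinuousAt (fun x => φ (ψ x)) x₀ :=
    (continuousAt_extChartAt (I := 𝓡 m) y₀).comp (f := ψ) hc.continuousAt
  have hsrc : ∀ᶠ x in 𝓝 x₀, ψ x ∈ φ.source :=
    hc.continuousAt (extChartAt_source_mem_nhds (I := 𝓡 m) y₀)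
  have hev : (φ ∘ ψ) =ᶠ[𝓝 x₀]
      fun x => hRs.localInverse hR' (by simp) (Q (f x).1) := by
    filter_upwards [hcφ.eventually hleft, hsrc] with x h1 h2
    change φ (ψ x) = _
    have h3 : R (φ (ψ x)) = Q (f x).1 := by
      simp only [hR, hF]
      rw [φ.left_inv h2, hψ]
    rw [← h3]
    exact h1.symm
  have hmain : ContMDiffAt (𝓡 m) 𝓘(ℝ, EuclideanSpace ℝ (Fin m)) ∞
      (fun x => hRs.localInverse hR' (by simp) (Q (f x).1)) x₀ := by
    have h1 : ContMDiffAt (𝓡 m) 𝓘(ℝ, EuclideanSpace ℝ (Fin m)) ∞ (fun x => Q (f x).1) x₀ :=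
      Q.contDiff.contMDiff.contMDiffAt.comp x₀ ((contMDiff_coe_sph.comp hf.smooth) x₀)
    have h2 : Q (f x₀).1 = R (φ y₀) := by
      simp only [hR, hF]
      rw [φ.left_inv (mem_extChartAt_source y₀), hy₀, hψ]
    refine ContMDiffAt.comp x₀ (g := hRs.localInverse hR' (by simp)) ?_ h1
    rw [h2]
    exact hloc.contMDiffAt
  exact hmain.congr_of_eventuallyEq hev

/-- Since `g ∘ ψ = f` is an immersion, the chain rule forces the derivative of `ψ` to be injective,
so precomposition with `ψ` preserves embeddings. It is applied to every stage of the second isotopy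
in a concatenation. -/
theorem comp_lift {m n : ℕ} {f g k : Sph m → Sph n} (hf : IsSmoothSphereEmbedding f)
    (hg : IsSmoothSphereEmbedding g) (hk : IsSmoothSphereEmbedding k) {ψ : Sph m → Sph m}
    (hψ : ∀ x, g (ψ x) = f x) : IsSmoothSphereEmbedding fun x => k (ψ x) := by
  have hs := hf.contMDiff_lift hg hψ
  have hsm : ContMDiff (𝓡 m) (𝓡 n) ∞ fun x => k (ψ x) := hk.smooth.comp hs
  have hgψ : g ∘ ψ = f := funext hψ
  refine ⟨hsm, isEmbedding_of_injective hsm.continuous ?_, ?_⟩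
  · intro x y h
    have h1 := hk.embedding.injective h
    apply hf.embedding.injective
    rw [← hψ, ← hψ, h1]
  · intro x
    have h1 := mfderiv_comp x ((hk.smooth (ψ x)).mdifferentiableAt (by simp))
      ((hs x).mdifferentiableAt (by simp))
    have h2 := mfderiv_comp x ((hg.smooth (ψ x)).mdifferentiableAt (by simp))
      ((hs x).mdifferentiableAt (by simp))
    rw [hgψ] at h2
    have h3 := hf.immersion x
    rw [h2] at h3
    have h4 : Function.Injective (mfderiv (𝓡 m) (𝓡 m) ψ x) :=
      Function.Injective.of_comp (f := mfderiv (𝓡 m) (𝓡 n) g (ψ x)) h3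
    have h5 : Function.Injective (mfderiv (𝓡 m) (𝓡 n) (k ∘ ψ) x) := by
      rw [h1]
      exact (hk.immersion (ψ x)).comp h4
    exact h5

end IsSmoothSphereEmbedding

theorem smoothTransition_mem_Icc (x : ℝ) : Real.smoothTransition x ∈ Set.Icc (0 : ℝ) 1 :=
  ⟨Real.smoothTransition.nonneg x, Real.smoothTransition.le_one x⟩

/-- The two isotopies share only the image `B`, not its parametrization. The second one is
reparametrized by the transition map `ψ`, and both are slowed down so as to be stationary around the
gluing time. -/
theorem SmoothlyIsotopic.trans {m n : ℕ} {A B D : Set (Sph n)} (h : SmoothlyIsotopic m A B)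
    (h' : SmoothlyIsotopic m B D) : SmoothlyIsotopic m A D := by
  obtain ⟨H, hs, he, h0, h1⟩ := h
  obtain ⟨H', hs', he', h0', h1'⟩ := h'
  have hf := he 1 (by simp)
  have hg := he' 0 (by simp)
  have hex : ∀ x, ∃ y, H' (0, y) = H (1, x) := by
    intro x
    have : H (1, x) ∈ Set.range fun y => H' (0, y) := by rw [h0', ← h1]; exact ⟨x, rfl⟩
    exact this
  choose ψ hψ using hex
  have hψs := hf.contMDiff_lift hg hψ
  have hψsurj : Function.Surjective ψ := by
    intro y
    have : H' (0, y) ∈ Set.range fun x => H (1, x) := by rw [h1, ← h0']; exact ⟨y, rfl⟩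
    obtain ⟨x, hx⟩ := this
    refine ⟨x, hg.embedding.injective ?_⟩
    rw [hψ]; exact hx
  -- The first clock has stopped from time `1/3` on and the second starts only after `2/3`. On the
  -- overlap both families are constant and equal, which makes the piecewise family smooth.
  let a : ℝ → ℝ := fun t => Real.smoothTransition (3 * t)
  let b : ℝ → ℝ := fun t => Real.smoothTransition (3 * t - 2)
  have ha : ContDiff ℝ ∞ a := Real.smoothTransition.contDiff.comp (contDiff_const.mul contDiff_id)
  have hb : ContDiff ℝ ∞ b :=
    Real.smoothTransition.contDiff.comp ((contDiff_const.mul contDiff_id).sub contDiff_const)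
  let U : ℝ × Sph m → Sph n := fun p => H (a p.1, p.2)
  let V : ℝ × Sph m → Sph n := fun p => H' (b p.1, ψ p.2)
  have hU : ContMDiff (𝓘(ℝ, ℝ).prod (𝓡 m)) (𝓡 n) ∞ U :=
    hs.comp ((ha.contMDiff.comp contMDiff_fst).prodMk contMDiff_snd)
  have hV : ContMDiff (𝓘(ℝ, ℝ).prod (𝓡 m)) (𝓡 n) ∞ V :=
    hs'.comp ((hb.contMDiff.comp contMDiff_fst).prodMk (hψs.comp contMDiff_snd))
  have ha1 : ∀ t, 1 / 3 ≤ t → a t = 1 := fun t ht =>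
    Real.smoothTransition.one_of_one_le (by linarith)
  have hb0 : ∀ t, t ≤ 2 / 3 → b t = 0 := fun t ht =>
    Real.smoothTransition.zero_of_nonpos (by linarith)
  have hUV : ∀ p : ℝ × Sph m, 1 / 3 ≤ p.1 → p.1 ≤ 2 / 3 → U p = V p := by
    intro p h1 h2
    simp only [U, V, ha1 _ h1, hb0 _ h2, hψ]
  refine ⟨fun p => if p.1 ≤ 1 / 2 then U p else V p, ?_, ?_, ?_, ?_⟩
  · intro p
    by_cases hp : p.1 < 2 / 3
    · apply (hU p).congr_of_eventuallyEq
      filter_upwards [(isOpen_Iio.preimage continuous_fst).mem_nhds hp] with q hq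
      by_cases hq' : q.1 ≤ 1 / 2
      · rw [if_pos hq']
      · rw [if_neg hq', hUV q (by linarith) (le_of_lt hq)]
    · apply (hV p).congr_of_eventuallyEq
      have hp' : 1 / 3 < p.1 := by linarith
      filter_upwards [(isOpen_Ioi.preimage continuous_fst).mem_nhds hp'] with q hq
      by_cases hq' : q.1 ≤ 1 / 2
      · rw [if_pos hq', hUV q (le_of_lt hq) (by linarith)]
      · rw [if_neg hq']
  · intro t ht
    by_cases h : t ≤ 1 / 2
    · simp only [h, if_true, U]
      exact he _ (smoothTransition_mem_Icc _)
    · simp only [h, if_false, V]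
      exact hf.comp_lift hg (he' _ (smoothTransition_mem_Icc _)) hψ
  · have : a 0 = 0 := Real.smoothTransition.zero_of_nonpos (by simp)
    simp [U, this, h0]
  · have : b 1 = 1 := Real.smoothTransition.one_of_one_le (by norm_num)
    have h2 : ¬ (1 : ℝ) ≤ 1 / 2 := by norm_num
    simp only [h2, if_false, V, this]
    rw [← h1']
    exact hψsurj.range_comp (fun y => H' (1, y))

/-! ### Smooth division -/

theorem hasFDerivAt_intervalIntegral_of_contDiff {E G : Type*} [NormedAddCommGroup E]
    [NormedSpace ℝ E] [ProperSpace E] [NormedAddCommGroup G] [NormedSpace ℝ G]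
    {f : E × ℝ → G} (hf : ContDiff ℝ 1 f) (x₀ : E) :
    HasFDerivAt (fun x => ∫ σ in (0 : ℝ)..1, f (x, σ))
      (∫ σ in (0 : ℝ)..1, (fderiv ℝ f (x₀, σ)).comp (ContinuousLinearMap.inl ℝ E ℝ)) x₀ := by
  have hc : Continuous fun p : E × ℝ => (fderiv ℝ f p).comp (ContinuousLinearMap.inl ℝ E ℝ) :=
    (hf.continuous_fderiv one_ne_zero).clm_comp continuous_const
  obtain ⟨C, hC⟩ := ((isCompact_closedBall x₀ 1).prod (isCompact_Icc (a := (0 : ℝ)) (b := 1))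
    ).exists_bound_of_continuousOn hc.continuousOn
  refine intervalIntegral.hasFDerivAt_integral_of_dominated_of_fderiv_le (bound := fun _ => C)
    (F' := fun x σ => (fderiv ℝ f (x, σ)).comp (ContinuousLinearMap.inl ℝ E ℝ))
    (Metric.ball_mem_nhds x₀ one_pos) ?_ ?_ ?_ ?_ ?_ ?_
  · exact Filter.Eventually.of_forall fun x =>
      (hf.continuous.comp (by fun_prop : Continuous fun σ : ℝ => (x, σ))).aestronglyMeasurable
  · exact (hf.continuous.comp
      (by fun_prop : Continuous fun σ : ℝ => (x₀, σ))).intervalIntegrable _ _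
  · exact (hc.comp (by fun_prop : Continuous fun σ : ℝ => (x₀, σ))).aestronglyMeasurable
  · refine Filter.Eventually.of_forall fun σ hσ x hx => hC (x, σ) ⟨Metric.ball_subset_closedBall hx, ?_⟩
    rw [Set.uIoc_of_le zero_le_one] at hσ
    exact ⟨hσ.1.le, hσ.2⟩
  · exact intervalIntegrable_const
  · refine Filter.Eventually.of_forall fun σ _ x _ => ?_
    exact (hf.differentiable one_ne_zero (x, σ)).hasFDerivAt.comp x (hasFDerivAt_prodMk_left x σ)

/-- Differentiation under the integral sign, iterated. The target `G` is quantified inside the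
induction because the derivative of the integrand takes values in a space of linear maps. -/
theorem contDiff_intervalIntegral_nat {E : Type} [NormedAddCommGroup E]
    [NormedSpace ℝ E] [ProperSpace E] (n : ℕ) :
    ∀ {G : Type} [NormedAddCommGroup G] [NormedSpace ℝ G] {f : E × ℝ → G}, ContDiff ℝ ∞ f →
    ContDiff ℝ n (fun x => ∫ σ in (0 : ℝ)..1, f (x, σ)) := by
  induction n with
  | zero =>
    intro G _ _ f hf
    rw [Nat.cast_zero, contDiff_zero]
    exact continuous_iff_continuousAt.2 fun x =>
      (hasFDerivAt_intervalIntegral_of_contDiff (hf.of_le (by simp)) x).continuousAt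
  | succ n ih =>
    intro G _ _ f hf
    rw [Nat.cast_succ, contDiff_succ_iff_hasFDerivAt]
    refine ⟨_, ?_, hasFDerivAt_intervalIntegral_of_contDiff (hf.of_le (by simp))⟩
    apply ih (f := fun p => (fderiv ℝ f p).comp (ContinuousLinearMap.inl ℝ E ℝ))
    exact (hf.fderiv_right (by simp)).clm_comp contDiff_const

theorem contDiff_intervalIntegral {E : Type} [NormedAddCommGroup E]
    [NormedSpace ℝ E] [ProperSpace E] {G : Type} [NormedAddCommGroup G] [NormedSpace ℝ G]
    {f : E × ℝ → G} (hf : ContDiff ℝ ∞ f) :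
    ContDiff ℝ ∞ (fun x => ∫ σ in (0 : ℝ)..1, f (x, σ)) :=
  contDiff_infty.2 fun n => contDiff_intervalIntegral_nat n hf

/-- Hadamard's lemma with a parameter. -/
theorem exists_contDiff_eq_sub_mul {f : ℝ × ℝ → ℝ} (hf : ContDiff ℝ ∞ f) {a : ℝ}
    (h0 : ∀ t, f (t, a) = 0) :
    ∃ g : ℝ × ℝ → ℝ, ContDiff ℝ ∞ g ∧ ∀ t c, f (t, c) = (c - a) * g (t, c) := by
  refine ⟨fun p => ∫ σ in (0 : ℝ)..1, fderiv ℝ f (p.1, a + σ * (p.2 - a)) (0, 1), ?_, ?_⟩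
  · apply contDiff_intervalIntegral
      (f := fun q : (ℝ × ℝ) × ℝ => fderiv ℝ f (q.1.1, a + q.2 * (q.1.2 - a)) (0, 1))
    apply ContDiff.clm_apply _ contDiff_const
    apply (hf.fderiv_right (m := ∞) (by simp)).comp
    fun_prop
  · intro t c
    have hd : ∀ σ : ℝ, HasDerivAt (fun σ => f (t, a + σ * (c - a)))
        ((c - a) * fderiv ℝ f (t, a + σ * (c - a)) (0, 1)) σ := by
      intro σ
      have h1 : HasDerivAt (fun σ : ℝ => (t, a + σ * (c - a))) ((0 : ℝ), c - a) σ := by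
        apply (hasDerivAt_const σ t).prodMk
        simpa using ((hasDerivAt_id σ).mul_const (c - a)).const_add a
      have h2 := (hf.differentiable (by simp) (t, a + σ * (c - a))).hasFDerivAt.comp_hasDerivAt σ h1
      have h3 : ((0 : ℝ), c - a) = (c - a) • ((0 : ℝ), (1 : ℝ)) := by simp
      rw [h3, map_smul, smul_eq_mul] at h2
      exact h2
    have hcont : Continuous fun σ : ℝ => (c - a) * fderiv ℝ f (t, a + σ * (c - a)) (0, 1) := by
      have h1 : Continuous fun p => fderiv ℝ f p (0, 1) :=
        ((hf.continuous_fderiv (by simp)).clm_apply continuous_const)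
      exact continuous_const.mul (h1.comp (by fun_prop))
    have h := intervalIntegral.integral_eq_sub_of_hasDerivAt (a := 0) (b := 1)
      (fun σ _ => hd σ) (hcont.intervalIntegrable _ _)
    rw [intervalIntegral.integral_const_mul] at h
    simp only [one_mul, zero_mul, add_zero, h0, sub_zero] at h
    rw [h]
    congr 2
    ring

theorem exists_contDiff_eq_one_sub_sq_mul {f : ℝ × ℝ → ℝ} (hf : ContDiff ℝ ∞ f)
    (h1 : ∀ t, f (t, 1) = 0) (h2 : ∀ t, f (t, -1) = 0) :
    ∃ g : ℝ × ℝ → ℝ, ContDiff ℝ ∞ g ∧ ∀ t c, f (t, c) = (1 - c ^ 2) * g (t, c) := by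
  obtain ⟨g, hg, hfg⟩ := exists_contDiff_eq_sub_mul hf h1
  have h3 : ∀ t, g (t, -1) = 0 := by
    intro t
    have := hfg t (-1)
    rw [h2] at this
    linarith
  obtain ⟨k, hk, hgk⟩ := exists_contDiff_eq_sub_mul hg h3
  refine ⟨fun p => -k p, hk.neg, fun t c => ?_⟩
  rw [hfg, hgk]
  ring

/-! ### Isotopies of surfaces of revolution -/

/-- A family of profiles `ℓ_t` on `[-1, 1]`, whose surfaces of revolution
`{(c, u, v) | u ^ 2 + v ^ 2 = ℓ_t c}` are smooth spheres. -/
structure IsProfile (ℓ : ℝ × ℝ → ℝ) : Prop where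
  smooth : ContDiff ℝ ∞ ℓ
  right : ∀ t, ℓ (t, 1) = 0
  left : ∀ t, ℓ (t, -1) = 0
  pos : ∀ t, ∀ c ∈ Set.Ioo (-1 : ℝ) 1, 0 < ℓ (t, c)
  deriv_right : ∀ t, deriv (fun c => ℓ (t, c)) 1 ≠ 0
  deriv_left : ∀ t, deriv (fun c => ℓ (t, c)) (-1) ≠ 0

/-- The image in `S^n` of the surface of revolution with profile `ℓ_t` under the map `Ψ_t`. -/
def revolutionImage {n : ℕ} (ℓ : ℝ × ℝ → ℝ)
    (Ψ : ℝ × ℝ × ℝ × ℝ → EuclideanSpace ℝ (Fin (n + 1))) (t : ℝ) : Set (Sph n) :=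
  {p | ∃ c ∈ Set.Icc (-1 : ℝ) 1, ∃ u v : ℝ, u ^ 2 + v ^ 2 = ℓ (t, c) ∧
    p = dirSphere (Ψ (t, c, u, v))}

/-- `Ψ_t` separates, up to positive multiples, points and tangent directions of the surface of
revolution with profile `ℓ_t`. -/
structure IsRevolutionEmbedding {n : ℕ} (ℓ : ℝ × ℝ → ℝ)
    (Ψ : ℝ × ℝ × ℝ × ℝ → EuclideanSpace ℝ (Fin (n + 1))) : Prop where
  smooth : ContDiff ℝ ∞ Ψ
  ne_zero : ∀ t, ∀ c ∈ Set.Icc (-1 : ℝ) 1, ∀ u v : ℝ, u ^ 2 + v ^ 2 = ℓ (t, c) →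
    Ψ (t, c, u, v) ≠ 0
  inj : ∀ t ∈ Set.Icc (0 : ℝ) 1, ∀ c ∈ Set.Icc (-1 : ℝ) 1, ∀ u v : ℝ, u ^ 2 + v ^ 2 = ℓ (t, c) →
    ∀ c' ∈ Set.Icc (-1 : ℝ) 1, ∀ u' v' : ℝ, u' ^ 2 + v' ^ 2 = ℓ (t, c') → ∀ r : ℝ, 0 < r →
    Ψ (t, c, u, v) = r • Ψ (t, c', u', v') → c = c' ∧ u = u' ∧ v = v'
  imm : ∀ t ∈ Set.Icc (0 : ℝ) 1, ∀ c ∈ Set.Icc (-1 : ℝ) 1, ∀ u v : ℝ, u ^ 2 + v ^ 2 = ℓ (t, c) →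
    ∀ c' u' v' μ : ℝ, 2 * (u * u' + v * v') = deriv (fun x => ℓ (t, x)) c * c' →
    HasDerivAt (fun r : ℝ => Ψ (t, c + r * c', u + r * u', v + r * v')) (μ • Ψ (t, c, u, v)) 0 →
    c' = 0 ∧ u' = 0 ∧ v' = 0

/-- Hadamard division removes the two zeros of the profile, and their simplicity keeps the quotient
positive at the ends as well. Hence `√g` is smooth along the unit sphere, which gives a
parametrization that is smooth at the poles. -/
theorem IsProfile.exists_factor {ℓ : ℝ × ℝ → ℝ} (h : IsProfile ℓ) :
    ∃ g : ℝ × ℝ → ℝ, ContDiff ℝ ∞ g ∧ (∀ t c, ℓ (t, c) = (1 - c ^ 2) * g (t, c)) ∧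
      ∀ t, ∀ c ∈ Set.Icc (-1 : ℝ) 1, 0 < g (t, c) := by
  obtain ⟨g, hg, hℓ⟩ := exists_contDiff_eq_one_sub_sq_mul h.smooth h.right h.left
  refine ⟨g, hg, hℓ, fun t c hc => ?_⟩
  have hgt : Differentiable ℝ fun c => g (t, c) :=
    (hg.comp (contDiff_const.prodMk contDiff_id)).differentiable (by simp)
  have hin : ∀ c ∈ Set.Ioo (-1 : ℝ) 1, 0 < g (t, c) := by
    intro c hc
    have h1 := h.pos t c hc
    rw [hℓ] at h1
    have h2 : 0 < 1 - c ^ 2 := by nlinarith [hc.1, hc.2]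
    exact (pos_iff_pos_of_mul_pos h1).1 h2
  have hnn : 0 ≤ g (t, c) := by
    have h1 : c ∈ closure (Set.Ioo (-1 : ℝ) 1) := by
      rw [closure_Ioo (by norm_num)]; exact hc
    exact le_on_closure (f := fun _ => (0 : ℝ)) (g := fun c => g (t, c))
      (fun x hx => (hin x hx).le) continuousOn_const hgt.continuous.continuousOn h1
  have hder : ∀ c, deriv (fun c => ℓ (t, c)) c =
      -(2 * c) * g (t, c) + (1 - c ^ 2) * deriv (fun c => g (t, c)) c := by
    intro c
    have h1 : (fun c => ℓ (t, c)) = fun c => (1 - c ^ 2) * g (t, c) := funext (hℓ t)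
    rw [h1]
    have h2 : HasDerivAt (fun c : ℝ => 1 - c ^ 2) (-(2 * c)) c := by
      simpa using ((hasDerivAt_id c).pow 2).const_sub 1
    exact (h2.mul (hgt c).hasDerivAt).deriv
  rcases eq_or_lt_of_le hc.2 with h1 | h1
  · subst h1
    refine lt_of_le_of_ne hnn fun h0 => h.deriv_right t ?_
    rw [hder, ← h0]; ring
  · rcases eq_or_lt_of_le hc.1 with h2 | h2
    · subst h2
      refine lt_of_le_of_ne hnn fun h0 => h.deriv_left t ?_
      rw [hder, ← h0]; ring
    · exact hin c ⟨h2, h1⟩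

/-- The parametrization of the image of a surface of revolution by the unit sphere. -/
def revolutionMap {n : ℕ} (g : ℝ × ℝ → ℝ) (Ψ : ℝ × ℝ × ℝ × ℝ → EuclideanSpace ℝ (Fin (n + 1)))
    (p : ℝ × EuclideanSpace ℝ (Fin 3)) : EuclideanSpace ℝ (Fin (n + 1)) :=
  Ψ (p.1, p.2 2, √(g (p.1, p.2 2)) * p.2 0, √(g (p.1, p.2 2)) * p.2 1)

theorem sum_sq_of_norm_eq_one {x : EuclideanSpace ℝ (Fin 3)} (hx : ‖x‖ = 1) :
    x 0 ^ 2 + x 1 ^ 2 = 1 - x 2 ^ 2 := by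
  have h := EuclideanSpace.norm_sq_eq x
  rw [hx, Fin.sum_univ_three] at h
  simp only [Real.norm_eq_abs, sq_abs] at h
  linarith

theorem mem_Icc_of_norm_eq_one {x : EuclideanSpace ℝ (Fin 3)} (hx : ‖x‖ = 1) :
    x 2 ∈ Set.Icc (-1 : ℝ) 1 := by
  have := sum_sq_of_norm_eq_one hx
  constructor <;> nlinarith [sq_nonneg (x 0), sq_nonneg (x 1)]

section

variable {n : ℕ} {ℓ g : ℝ × ℝ → ℝ} {Ψ : ℝ × ℝ × ℝ × ℝ → EuclideanSpace ℝ (Fin (n + 1))}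

theorem contDiffAt_sqrt_factor (hg : ContDiff ℝ ∞ g)
    (hpos : ∀ t, ∀ c ∈ Set.Icc (-1 : ℝ) 1, 0 < g (t, c)) (t : ℝ)
    {x : EuclideanSpace ℝ (Fin 3)} (hx : ‖x‖ = 1) :
    ContDiffAt ℝ ∞ (fun p : ℝ × EuclideanSpace ℝ (Fin 3) => √(g (p.1, p.2 2))) (t, x) := by
  apply ContDiffAt.sqrt
  · exact (hg.comp (by fun_prop)).contDiffAt
  · exact (hpos t _ (mem_Icc_of_norm_eq_one hx)).ne'

theorem sq_add_sq_revolution (hℓ : ∀ t c, ℓ (t, c) = (1 - c ^ 2) * g (t, c))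
    (hpos : ∀ t, ∀ c ∈ Set.Icc (-1 : ℝ) 1, 0 < g (t, c)) (t : ℝ)
    {x : EuclideanSpace ℝ (Fin 3)} (hx : ‖x‖ = 1) :
    (√(g (t, x 2)) * x 0) ^ 2 + (√(g (t, x 2)) * x 1) ^ 2 = ℓ (t, x 2) := by
  rw [mul_pow, mul_pow, ← mul_add, sum_sq_of_norm_eq_one hx,
    Real.sq_sqrt (hpos t _ (mem_Icc_of_norm_eq_one hx)).le, hℓ]
  ring

theorem range_revolutionMap (hℓ : ∀ t c, ℓ (t, c) = (1 - c ^ 2) * g (t, c))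
    (hpos : ∀ t, ∀ c ∈ Set.Icc (-1 : ℝ) 1, 0 < g (t, c)) (t : ℝ) :
    (Set.range fun x : Sph 2 => dirSphere (revolutionMap g Ψ (t, x.1))) =
      revolutionImage ℓ Ψ t := by
  have hn : ∀ x : Sph 2, ‖x.1‖ = 1 := fun x => mem_sphere_zero_iff_norm.1 x.2
  ext p
  constructor
  · rintro ⟨x, rfl⟩
    exact ⟨x.1 2, mem_Icc_of_norm_eq_one (hn x), _, _, sq_add_sq_revolution hℓ hpos t (hn x), rfl⟩
  · rintro ⟨c, hc, u, v, h, rfl⟩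
    have hg := hpos t c hc
    have hs := Real.sqrt_pos.2 hg
    have hs2 := Real.sq_sqrt hg.le
    have h1 : ‖(!₂[u / √(g (t, c)), v / √(g (t, c)), c] : EuclideanSpace ℝ (Fin 3))‖ = 1 := by
      rw [EuclideanSpace.norm_eq, Real.sqrt_eq_one, Fin.sum_univ_three]
      simp only [Real.norm_eq_abs, sq_abs]
      simp only [Matrix.cons_val_zero, Matrix.cons_val_one, Matrix.cons_val]
      rw [div_pow, div_pow, hs2, ← add_div, h, hℓ]
      field_simp
      ring
    refine ⟨⟨_, mem_sphere_zero_iff_norm.2 h1⟩, ?_⟩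
    simp only [revolutionMap, Matrix.cons_val_zero, Matrix.cons_val_one,
      Matrix.cons_val]
    rw [mul_div_cancel₀ _ hs.ne', mul_div_cancel₀ _ hs.ne']

/-- The map `x ↦ (x 2, √g x 0, √g x 1)` carries the unit sphere to the surface of revolution, points
to points and tangent vectors to tangent vectors. The conditions on `Ψ` then become those of
`smoothlyIsotopic_dirSphere`. -/
theorem IsRevolutionEmbedding.isotopy (hΨ : IsRevolutionEmbedding ℓ Ψ) (hg : ContDiff ℝ ∞ g)
    (hℓ : ∀ t c, ℓ (t, c) = (1 - c ^ 2) * g (t, c))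
    (hpos : ∀ t, ∀ c ∈ Set.Icc (-1 : ℝ) 1, 0 < g (t, c)) :
    (∀ t ∈ Set.Icc (0 : ℝ) 1,
      IsSmoothSphereEmbedding (fun x : Sph 2 => dirSphere (revolutionMap g Ψ (t, x.1)))) ∧
    SmoothlyIsotopic 2 (Set.range fun x : Sph 2 => dirSphere (revolutionMap g Ψ (0, x.1)))
      (Set.range fun x : Sph 2 => dirSphere (revolutionMap g Ψ (1, x.1))) := by
  apply smoothlyIsotopic_dirSphere
  · intro t x hx
    have h1 := contDiffAt_sqrt_factor hg hpos t hx
    apply hΨ.smooth.contDiffAt.comp (t, x)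
    apply ContDiffAt.prodMk (by fun_prop)
    apply ContDiffAt.prodMk (by fun_prop)
    exact (h1.mul (by fun_prop)).prodMk (h1.mul (by fun_prop))
  · intro t x hx
    exact hΨ.ne_zero t _ (mem_Icc_of_norm_eq_one hx) _ _ (sq_add_sq_revolution hℓ hpos t hx)
  · intro t ht x y hx hy r hr h
    obtain ⟨h1, h2, h3⟩ := hΨ.inj t ht _ (mem_Icc_of_norm_eq_one hx) _ _
      (sq_add_sq_revolution hℓ hpos t hx) _ (mem_Icc_of_norm_eq_one hy) _ _
      (sq_add_sq_revolution hℓ hpos t hy) r hr h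
    simp only at h1 h2 h3
    rw [h1] at h2 h3
    have hs := (Real.sqrt_pos.2 (hpos t _ (mem_Icc_of_norm_eq_one hy))).ne'
    ext i
    fin_cases i
    · exact mul_left_cancel₀ hs h2
    · exact mul_left_cancel₀ hs h3
    · exact h1
  · intro t ht x ξ hx hξ μ hμ
    have hcI := mem_Icc_of_norm_eq_one hx
    have hgp := hpos t _ hcI
    have hs := Real.sqrt_pos.2 hgp
    have hs2 := Real.sq_sqrt hgp.le
    set s := √(g (t, x 2)) with hs_def
    have hgt : HasDerivAt (fun c => g (t, c)) (deriv (fun c => g (t, c)) (x 2)) (x 2) :=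
      ((hg.comp (contDiff_const.prodMk contDiff_id)).differentiable (by simp) _).hasDerivAt
    set g' := deriv (fun c => g (t, c)) (x 2) with hg'_def
    have hℓ' : deriv (fun c => ℓ (t, c)) (x 2) = -(2 * x 2) * g (t, x 2) + (1 - x 2 ^ 2) * g' := by
      have h1 : (fun c => ℓ (t, c)) = fun c => (1 - c ^ 2) * g (t, c) := funext (hℓ t)
      rw [h1]
      have h2 : HasDerivAt (fun c : ℝ => 1 - c ^ 2) (-(2 * x 2)) (x 2) := by
        simpa using ((hasDerivAt_id (x 2)).pow 2).const_sub 1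
      exact (h2.mul hgt).deriv
    have hline : ∀ i, HasDerivAt (fun r : ℝ => x i + r * ξ i) (ξ i) 0 := by
      intro i
      simpa using ((hasDerivAt_id (0 : ℝ)).mul_const (ξ i)).const_add (x i)
    have hsq : HasDerivAt (fun r : ℝ => √(g (t, x 2 + r * ξ 2))) (g' * ξ 2 / (2 * s)) 0 := by
      have h1 : HasDerivAt (fun r : ℝ => g (t, x 2 + r * ξ 2)) (g' * ξ 2) 0 := by
        refine HasDerivAt.comp (h₂ := fun c => g (t, c)) (0 : ℝ) ?_ (hline 2)
        simpa using hgt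
      have h2 := h1.sqrt (by simpa using hgp.ne')
      simpa using h2
    have hw : ∀ i, HasDerivAt (fun r : ℝ => √(g (t, x 2 + r * ξ 2)) * (x i + r * ξ i))
        (g' * ξ 2 / (2 * s) * x i + s * ξ i) 0 := by
      intro i
      simpa [hs_def] using hsq.fun_mul (hline i)
    set u' := g' * ξ 2 / (2 * s) * x 0 + s * ξ 0 with hu'
    set v' := g' * ξ 2 / (2 * s) * x 1 + s * ξ 1 with hv'
    have hΨd : HasFDerivAt Ψ (fderiv ℝ Ψ (t, x 2, s * x 0, s * x 1)) (t, x 2, s * x 0, s * x 1) :=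
      (hΨ.smooth.differentiable (by simp) _).hasFDerivAt
    have hc1 : HasDerivAt (fun r : ℝ => revolutionMap g Ψ (t, x + r • ξ))
        (fderiv ℝ Ψ (t, x 2, s * x 0, s * x 1) (0, ξ 2, u', v')) 0 := by
      have h1 : HasDerivAt (fun r : ℝ => (t, x 2 + r * ξ 2,
          √(g (t, x 2 + r * ξ 2)) * (x 0 + r * ξ 0), √(g (t, x 2 + r * ξ 2)) * (x 1 + r * ξ 1)))
          (0, ξ 2, u', v') 0 :=
        (hasDerivAt_const _ _).prodMk ((hline 2).prodMk ((hw 0).prodMk (hw 1)))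
      refine HasFDerivAt.comp_hasDerivAt (0 : ℝ) ?_ h1
      simpa using hΨd
    -- The curve on the surface of revolution is replaced by the straight line with the same
    -- velocity `(ξ 2, u', v')`. `Ψ` has the same derivative along both, and the immersion condition
    -- is phrased for lines.
    have hc2 : HasDerivAt (fun r : ℝ =>
        Ψ (t, x 2 + r * ξ 2, s * x 0 + r * u', s * x 1 + r * v'))
        (fderiv ℝ Ψ (t, x 2, s * x 0, s * x 1) (0, ξ 2, u', v')) 0 := by
      have hl : ∀ a b : ℝ, HasDerivAt (fun r : ℝ => a + r * b) b 0 := by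
        intro a b
        simpa using ((hasDerivAt_id (0 : ℝ)).mul_const b).const_add a
      have h1 : HasDerivAt (fun r : ℝ => (t, x 2 + r * ξ 2, s * x 0 + r * u', s * x 1 + r * v'))
          (0, ξ 2, u', v') 0 :=
        (hasDerivAt_const _ _).prodMk ((hline 2).prodMk ((hl _ _).prodMk (hl _ _)))
      refine HasFDerivAt.comp_hasDerivAt (0 : ℝ) ?_ h1
      simpa using hΨd
    rw [hc1.unique hμ] at hc2
    have hin : x 0 * ξ 0 + x 1 * ξ 1 + x 2 * ξ 2 = 0 := by
      rw [PiLp.inner_apply, Fin.sum_univ_three] at hξ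
      simp only [RCLike.inner_apply, conj_trivial] at hξ
      linarith
    have hxs := sum_sq_of_norm_eq_one hx
    obtain ⟨h1, h2, h3⟩ := hΨ.imm t ht _ hcI _ _ (sq_add_sq_revolution hℓ hpos t hx) (ξ 2) u' v' μ
      (by
        rw [hℓ', ← hxs, hu', hv']
        have h4 : s * (g' * ξ 2 / (2 * s)) = g' * ξ 2 / 2 := by field_simp
        have h5 : 2 * (s * x 0 * (g' * ξ 2 / (2 * s) * x 0 + s * ξ 0) +
            s * x 1 * (g' * ξ 2 / (2 * s) * x 1 + s * ξ 1)) =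
            2 * (s * (g' * ξ 2 / (2 * s))) * (x 0 ^ 2 + x 1 ^ 2) +
              2 * s ^ 2 * (x 0 * ξ 0 + x 1 * ξ 1) := by ring
        rw [h5, h4, hs2, show x 0 * ξ 0 + x 1 * ξ 1 = -(x 2 * ξ 2) by linarith]
        ring) hc2
    rw [hu', h1] at h2
    rw [hv', h1] at h3
    have h4 : s * ξ 0 = 0 := by simpa using h2
    have h5 : s * ξ 1 = 0 := by simpa using h3
    ext i
    fin_cases i
    · exact (mul_eq_zero.1 h4).resolve_left hs.ne'
    · exact (mul_eq_zero.1 h5).resolve_left hs.ne'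
    · exact h1

theorem IsRevolutionEmbedding.smoothlyIsotopic (hΨ : IsRevolutionEmbedding ℓ Ψ)
    (h : IsProfile ℓ) : SmoothlyIsotopic 2 (revolutionImage ℓ Ψ 0) (revolutionImage ℓ Ψ 1) := by
  obtain ⟨g, hg, hℓ, hpos⟩ := h.exists_factor
  have h1 := (hΨ.isotopy hg hℓ hpos).2
  rwa [range_revolutionMap hℓ hpos, range_revolutionMap hℓ hpos] at h1

end

/-! ### Inverse stereographic projection as a radial projection -/

theorem hasDerivAt_euclidean_coord {n : ℕ} {f : ℝ → EuclideanSpace ℝ (Fin n)}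
    {f' : EuclideanSpace ℝ (Fin n)} {x : ℝ} :
    HasDerivAt f f' x ↔ ∀ i, HasDerivAt (fun r => f r i) (f' i) x := by
  rw [hasDerivAt_iff_hasFDerivAt, ← hasFDerivWithinAt_univ, hasFDerivWithinAt_euclidean]
  refine forall_congr' fun i => ?_
  rw [hasFDerivWithinAt_univ, hasDerivAt_iff_hasFDerivAt]
  have h : (EuclideanSpace.proj i).comp (ContinuousLinearMap.toSpanSingleton ℝ f') =
      ContinuousLinearMap.toSpanSingleton ℝ (f' i) := by
    ext
    simp
  rw [h]

/-- The vector `(2 v, ‖v‖² - 1)` in the direction of `invStereo v`. -/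
def stereoLift {n : ℕ} (v : EuclideanSpace ℝ (Fin n)) : EuclideanSpace ℝ (Fin (n + 1)) :=
  WithLp.toLp 2 (Fin.snoc (α := fun _ => ℝ) (fun i => 2 * v i) (‖v‖ ^ 2 - 1))

section

variable {n : ℕ} (v : EuclideanSpace ℝ (Fin n))

theorem stereoLift_castSucc (i : Fin n) : stereoLift v i.castSucc = 2 * v i := by
  simp [stereoLift]

theorem stereoLift_last : stereoLift v (Fin.last n) = ‖v‖ ^ 2 - 1 := by
  simp [stereoLift]

theorem stereoLift_eq_smul : stereoLift v = (‖v‖ ^ 2 + 1) • (invStereo v).1 := by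
  have h : ‖v‖ ^ 2 + 1 ≠ 0 := by positivity
  ext i
  refine Fin.lastCases ?_ (fun i => ?_) i
  · simp only [stereoLift, invStereo, PiLp.smul_apply, Fin.snoc_last, smul_eq_mul]
    field_simp
  · simp only [stereoLift, invStereo, PiLp.smul_apply, Fin.snoc_castSucc, smul_eq_mul]
    field_simp

theorem norm_stereoLift : ‖stereoLift v‖ = ‖v‖ ^ 2 + 1 := by
  rw [stereoLift_eq_smul, norm_smul, mem_sphere_zero_iff_norm.1 (invStereo v).2, mul_one,
    Real.norm_eq_abs, abs_of_pos (by positivity)]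

theorem stereoLift_ne_zero : stereoLift v ≠ 0 := by
  rw [← norm_ne_zero_iff, norm_stereoLift]
  positivity

theorem dirSphere_stereoLift : dirSphere (stereoLift v) = invStereo v := by
  have h0 : (invStereo v).1 ≠ 0 := by
    rw [← norm_ne_zero_iff, mem_sphere_zero_iff_norm.1 (invStereo v).2]
    exact one_ne_zero
  rw [stereoLift_eq_smul, dirSphere_smul h0 (by positivity), dirSphere_coe_self]

theorem contDiff_stereoLift : ContDiff ℝ ∞ (stereoLift (n := n)) := by
  rw [contDiff_euclidean]
  intro i
  refine Fin.lastCases ?_ (fun i => ?_) i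
  · simp only [stereoLift_last]
    exact (contDiff_norm_sq ℝ).sub contDiff_const
  · simp only [stereoLift_castSucc]
    fun_prop

variable {v}

/-- The norm `‖v‖² + 1` and the last coordinate `‖v‖² - 1` of the lift differ by the constant 2;
both scale by `r`, so `r = 1`. -/
theorem eq_of_stereoLift_eq_smul {w : EuclideanSpace ℝ (Fin n)} {r : ℝ} (hr : 0 < r)
    (h : stereoLift v = r • stereoLift w) : v = w := by
  have h1 := congrArg norm h
  rw [norm_smul, norm_stereoLift, norm_stereoLift, Real.norm_eq_abs, abs_of_pos hr] at h1
  have h2 := congrArg (fun x => x (Fin.last n)) h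
  simp only [stereoLift_last, PiLp.smul_apply, smul_eq_mul] at h2
  have h3 : r = 1 := by linarith
  ext i
  have h4 := congrArg (fun x => x i.castSucc) h
  simp only [stereoLift_castSucc, PiLp.smul_apply, smul_eq_mul, h3, one_mul] at h4
  linarith

theorem invStereo_injective : Function.Injective (invStereo (n := n)) := by
  intro v w h
  rw [← dirSphere_stereoLift, ← dirSphere_stereoLift,
    dirSphere_eq_iff (stereoLift_ne_zero v) (stereoLift_ne_zero w)] at h
  obtain ⟨r, hr, h⟩ := h
  exact eq_of_stereoLift_eq_smul hr h

/-- The first coordinates give `f' = μ f`. Differentiating the last one then gives `μ (‖f‖² + 1) =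
0`, so the radial factor vanishes. -/
theorem hasDerivAt_zero_of_stereoLift {f : ℝ → EuclideanSpace ℝ (Fin n)} {μ x : ℝ}
    (h : HasDerivAt (fun r => stereoLift (f r)) (μ • stereoLift (f x)) x) :
    HasDerivAt f 0 x := by
  rw [hasDerivAt_euclidean_coord] at h
  have h1 : HasDerivAt f (μ • f x) x := by
    rw [hasDerivAt_euclidean_coord]
    intro i
    have h2 := (h i.castSucc).const_mul (1 / 2)
    simp only [stereoLift_castSucc, PiLp.smul_apply, smul_eq_mul] at h2 ⊢
    refine (h2.congr_deriv (by ring)).congr_of_eventuallyEq (Filter.Eventually.of_forall fun r => ?_)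
    change _ = 1 / 2 * (2 * _)
    ring
  have h2 := h (Fin.last n)
  simp only [stereoLift_last, PiLp.smul_apply, smul_eq_mul] at h2
  have h3 := (h1.norm_sq.sub_const 1).unique h2
  rw [inner_smul_right, real_inner_self_eq_norm_sq] at h3
  have h4 : μ * (‖f x‖ ^ 2 + 1) = 0 := by linarith
  have h5 : μ = 0 := (mul_eq_zero.1 h4).resolve_right (by positivity)
  rwa [h5, zero_smul] at h1

end

theorem isRevolutionEmbedding_stereoLift {n : ℕ} {ℓ : ℝ × ℝ → ℝ}
    {ψ : ℝ × ℝ × ℝ × ℝ → EuclideanSpace ℝ (Fin n)} (hs : ContDiff ℝ ∞ ψ)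
    (hinj : ∀ t ∈ Set.Icc (0 : ℝ) 1, ∀ c ∈ Set.Icc (-1 : ℝ) 1, ∀ u v : ℝ,
      u ^ 2 + v ^ 2 = ℓ (t, c) → ∀ c' ∈ Set.Icc (-1 : ℝ) 1, ∀ u' v' : ℝ,
      u' ^ 2 + v' ^ 2 = ℓ (t, c') →
      ψ (t, c, u, v) = ψ (t, c', u', v') → c = c' ∧ u = u' ∧ v = v')
    (himm : ∀ t ∈ Set.Icc (0 : ℝ) 1, ∀ c ∈ Set.Icc (-1 : ℝ) 1, ∀ u v : ℝ,
      u ^ 2 + v ^ 2 = ℓ (t, c) →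
      ∀ c' u' v' : ℝ, 2 * (u * u' + v * v') = deriv (fun x => ℓ (t, x)) c * c' →
      HasDerivAt (fun r : ℝ => ψ (t, c + r * c', u + r * u', v + r * v')) 0 0 →
      c' = 0 ∧ u' = 0 ∧ v' = 0) :
    IsRevolutionEmbedding ℓ (fun p => stereoLift (ψ p)) where
  smooth := contDiff_stereoLift.comp hs
  ne_zero _ _ _ _ _ _ := stereoLift_ne_zero _
  inj t ht c hc u v h c' hc' u' v' h' r hr he :=
    hinj t ht c hc u v h c' hc' u' v' h' (eq_of_stereoLift_eq_smul hr he)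
  imm t ht c hc u v h c' u' v' μ hℓ hd := by
    refine himm t ht c hc u v h c' u' v' hℓ (hasDerivAt_zero_of_stereoLift (μ := μ) ?_)
    simpa using hd

theorem norm_sq_vec3 (a b c : ℝ) :
    ‖(!₂[a, b, c] : EuclideanSpace ℝ (Fin 3))‖ ^ 2 = a ^ 2 + b ^ 2 + c ^ 2 := by
  rw [EuclideanSpace.norm_sq_eq, Fin.sum_univ_three]
  simp

theorem norm_sq_vec4 (a b c d : ℝ) :
    ‖(!₂[a, b, c, d] : EuclideanSpace ℝ (Fin 4))‖ ^ 2 = a ^ 2 + b ^ 2 + c ^ 2 + d ^ 2 := by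
  rw [EuclideanSpace.norm_sq_eq, Fin.sum_univ_four]
  simp

theorem stereoLift_vec4 (a b c d : ℝ) : stereoLift (!₂[a, b, c, d] : EuclideanSpace ℝ (Fin 4)) =
    !₂[2 * a, 2 * b, 2 * c, 2 * d, a ^ 2 + b ^ 2 + c ^ 2 + d ^ 2 - 1] := by
  rw [← norm_sq_vec4]
  ext i
  fin_cases i <;> rfl

/-! ### Twisting the spin of a tangle -/

/-- In finite dimension an injective derivative is invertible, so the inverse function theorem
provides a local left inverse. Stated as a neighborhood of the diagonal point `(x, x)`, it fits the
compactness argument for strips. -/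
theorem eventually_injective_of_fderiv_injective {E : Type*} [NormedAddCommGroup E]
    [NormedSpace ℝ E] [FiniteDimensional ℝ E] {f : E → E} {x : E} (hf : ContDiffAt ℝ 1 f x)
    (hinj : Function.Injective (fderiv ℝ f x)) :
    ∀ᶠ p : E × E in 𝓝 (x, x), f p.1 = f p.2 → p.1 = p.2 := by
  have : CompleteSpace E := FiniteDimensional.complete ℝ E
  let e : E ≃L[ℝ] E :=
    (LinearEquiv.ofInjectiveEndo (fderiv ℝ f x).toLinearMap hinj).toContinuousLinearEquiv
  have he : HasStrictFDerivAt f (e : E →L[ℝ] E) x := by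
    refine (hf.hasStrictFDerivAt one_ne_zero).congr_fderiv ?_
    ext v
    rfl
  have hl := he.eventually_left_inverse
  rw [nhds_prod_eq]
  filter_upwards [hl.prod_mk hl] with p hp h
  rw [← hp.1, ← hp.2, h]

theorem hasDerivAt_line (a b : ℝ) : HasDerivAt (fun r : ℝ => a + r * b) b 0 := by
  simpa using ((hasDerivAt_id (0 : ℝ)).mul_const b).const_add a

theorem hasDerivAt_comp_line {f : ℝ → ℝ} (hf : Differentiable ℝ f) (a b : ℝ) :
    HasDerivAt (fun r : ℝ => f (a + r * b)) (deriv f a * b) 0 := by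
  refine HasDerivAt.comp (h₂ := f) (0 : ℝ) ?_ (hasDerivAt_line a b)
  simpa using (hf a).hasDerivAt

/-! ### Closed tangles: behavior at the ends and the normal strip of the diagram -/

namespace ClosedTangle

variable (T : ClosedTangle)

theorem differentiable_h : Differentiable ℝ T.h := T.smooth_h.differentiable (by simp)
theorem differentiable_y : Differentiable ℝ T.y := T.smooth_y.differentiable (by simp)
theorem differentiable_z : Differentiable ℝ T.z := T.smooth_z.differentiable (by simp)

theorem contDiff_deriv_y : ContDiff ℝ ∞ (deriv T.y) := (contDiff_infty_iff_deriv.1 T.smooth_y).2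
theorem contDiff_deriv_z : ContDiff ℝ ∞ (deriv T.z) := (contDiff_infty_iff_deriv.1 T.smooth_z).2

theorem h_nonneg {s : ℝ} (hs : s ∈ Set.Icc (0 : ℝ) 1) : 0 ≤ T.h s := by
  rcases eq_or_lt_of_le hs.1 with h | h
  · rw [← h, T.h_zero]
  · rcases eq_or_lt_of_le hs.2 with h' | h'
    · rw [h', T.h_one]
    · exact (T.tangle_pos s ⟨h, h'⟩).le

/-- The arc equations hold only on `[1, 2]`, but one-sided derivatives determine the derivative, so
the differentiated equations include the endpoints. That is where transversality to the boundary
sphere is needed. -/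
theorem deriv_arc {s : ℝ} (hs : s ∈ Set.Icc (1 : ℝ) 2) :
    deriv T.z s = 0 ∧ T.y s * deriv T.y s + (T.h s + 1) * deriv T.h s = 0 := by
  have hu : UniqueDiffWithinAt ℝ (Set.Icc (1 : ℝ) 2) s := uniqueDiffOn_Icc (by norm_num) s hs
  constructor
  · apply hu.eq_deriv _ (T.differentiable_z s).hasDerivAt.hasDerivWithinAt
    exact (hasDerivWithinAt_const s _ (0 : ℝ)).congr (fun x hx => (T.arc_circle x hx).1)
      (T.arc_circle s hs).1
  · have h1 : HasDerivAt (fun s => T.y s ^ 2 + (T.h s + 1) ^ 2)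
        (2 * (T.y s * deriv T.y s + (T.h s + 1) * deriv T.h s)) s := by
      refine (((T.differentiable_y s).hasDerivAt.fun_pow 2).add
        (((T.differentiable_h s).hasDerivAt.add_const 1).fun_pow 2)).congr_deriv ?_
      simp
      ring
    have h2 := hu.eq_deriv _ h1.hasDerivWithinAt
      ((hasDerivWithinAt_const s _ (2 : ℝ)).congr (fun x hx => (T.arc_circle x hx).2)
        (T.arc_circle s hs).2)
    linarith

/-- If `h' = 0`, the differentiated circle equation forces `y' = 0`, and `z' = 0` on the arc,
against immersion. At the ends this makes the zeros of the spin's profile simple. -/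
theorem deriv_h_ne_zero_of_arc {s : ℝ} (hs : s ∈ Set.Icc (1 : ℝ) 2) (hy : T.y s ≠ 0) :
    deriv T.h s ≠ 0 := by
  intro h0
  obtain ⟨h1, h2⟩ := T.deriv_arc hs
  rw [h0, mul_zero, add_zero] at h2
  rcases T.immersion s with h | h | h
  · exact h h0
  · exact h ((mul_eq_zero.1 h2).resolve_left hy)
  · exact h h1

theorem h_two : T.h 2 = 0 := by
  have := T.periodic_h 0
  rw [zero_add] at this
  rw [this, T.h_zero]

theorem deriv_periodic {f : ℝ → ℝ} (hf : Function.Periodic f 2) (s : ℝ) :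
    deriv f (s + 2) = deriv f s := by
  have h : (fun x => f (x + 2)) = f := funext hf
  rw [← deriv_comp_add_const, h]

theorem y_ne_zero_of_h {s : ℝ} (hs : s ∈ Set.Icc (1 : ℝ) 2) (hh : T.h s = 0) : T.y s ≠ 0 := by
  intro h
  have := (T.arc_circle s hs).2
  rw [h, hh] at this
  norm_num at this

theorem deriv_h_one : deriv T.h 1 ≠ 0 :=
  T.deriv_h_ne_zero_of_arc (by norm_num) (T.y_ne_zero_of_h (by norm_num) T.h_one)

theorem deriv_h_zero : deriv T.h 0 ≠ 0 := by
  rw [← deriv_periodic T.periodic_h, zero_add]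
  exact T.deriv_h_ne_zero_of_arc (by norm_num) (T.y_ne_zero_of_h (by norm_num) T.h_two)

/-- The profile of the spin: the height of the tangle, parametrized by `[-1, 1]`. -/
def profile (p : ℝ × ℝ) : ℝ := T.h ((1 + p.2) / 2)

theorem half_mem {c : ℝ} (hc : c ∈ Set.Icc (-1 : ℝ) 1) : (1 + c) / 2 ∈ Set.Icc (0 : ℝ) 1 :=
  ⟨by linarith [hc.1], by linarith [hc.2]⟩

theorem hasDerivAt_half (c : ℝ) : HasDerivAt (fun c : ℝ => (1 + c) / 2) (1 / 2) c :=
  ((hasDerivAt_id c).const_add 1).div_const 2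

theorem deriv_profile (t c : ℝ) :
    deriv (fun c => T.profile (t, c)) c = deriv T.h ((1 + c) / 2) * (1 / 2) :=
  (HasDerivAt.comp (h₂ := T.h) c (T.differentiable_h _).hasDerivAt (hasDerivAt_half c)).deriv

theorem isProfile : IsProfile T.profile where
  smooth := T.smooth_h.comp (by fun_prop)
  right t := by
    have : ((1 : ℝ) + 1) / 2 = 1 := by norm_num
    simp only [profile, this, T.h_one]
  left t := by
    have : ((1 : ℝ) + -1) / 2 = 0 := by norm_num
    simp only [profile, this, T.h_zero]
  pos t c hc := T.tangle_pos _ ⟨by linarith [hc.1], by linarith [hc.2]⟩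
  deriv_right t := by
    have : ((1 : ℝ) + 1) / 2 = 1 := by norm_num
    rw [deriv_profile, this]
    exact mul_ne_zero T.deriv_h_one (by norm_num)
  deriv_left t := by
    have : ((1 : ℝ) + -1) / 2 = 0 := by norm_num
    rw [deriv_profile, this]
    exact mul_ne_zero T.deriv_h_zero (by norm_num)

theorem eq_of_coords_eq {s t : ℝ} (hs : s ∈ Set.Icc (0 : ℝ) 1) (ht : t ∈ Set.Icc (0 : ℝ) 1)
    (hh : T.h s = T.h t) (hy : T.y s = T.y t) (hz : T.z s = T.z t) : s = t :=
  T.injective s ⟨hs.1, by linarith [hs.2]⟩ t ⟨ht.1, by linarith [ht.2]⟩ hh hy hz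

variable {T}

/-- A point of the diagram above another one is an over crossing, so that nearby there is no
twisting. -/
theorem IsEvenTwisting.eventually_flat {φ : ℝ → ℝ} (hφ : T.IsEvenTwisting φ) {s t : ℝ}
    (hs : s ∈ Set.Icc (0 : ℝ) 1) (ht : t ∈ Set.Icc (0 : ℝ) 1) (hy : T.y t = T.y s)
    (hz : T.z t = T.z s) (hh : T.h t < T.h s) :
    ∀ᶠ r in 𝓝 s, Real.cos (φ r) = 1 ∧ Real.sin (φ r) = 0 := by
  obtain ⟨k, hk⟩ := hφ.locally_const s hs fun h => h.1 ⟨hs, t, ht, hy, hz, hh⟩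
  filter_upwards [hk] with r hr
  have h : φ r = k * (2 * Real.pi) := by rw [hr]; ring
  constructor
  · rw [h, Real.cos_int_mul_two_pi]
  · have h2 : φ r = (2 * k : ℤ) * Real.pi := by rw [h]; push_cast; ring
    rw [h2, Real.sin_int_mul_pi]

/-- The strip `(s, n) ↦ P s + n N s` along the diagram `P = (y, z)` with normal field
`N = (-z', y')`. -/
def strip (T : ClosedTangle) (p : ℝ × ℝ) : ℝ × ℝ :=
  (T.y p.1 - p.2 * deriv T.z p.1, T.z p.1 + p.2 * deriv T.y p.1)

theorem contDiff_strip : ContDiff ℝ ∞ T.strip := by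
  have h1 := T.smooth_y
  have h2 := T.smooth_z
  have h3 := T.contDiff_deriv_y
  have h4 := T.contDiff_deriv_z
  unfold strip
  fun_prop

theorem hasDerivAt_strip_line (s σ ν : ℝ) :
    HasDerivAt (fun r : ℝ => T.strip ((s, 0) + r • (σ, ν)))
      (deriv T.y s * σ - ν * deriv T.z s, deriv T.z s * σ + ν * deriv T.y s) 0 := by
  have hy := hasDerivAt_comp_line T.differentiable_y s σ
  have hz := hasDerivAt_comp_line T.differentiable_z s σ
  have hy' := hasDerivAt_comp_line (T.contDiff_deriv_y.differentiable (by simp)) s σ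
  have hz' := hasDerivAt_comp_line (T.contDiff_deriv_z.differentiable (by simp)) s σ
  have hν := hasDerivAt_line 0 ν
  have h := (hy.sub (hν.mul hz')).prodMk (hz.add (hν.mul hy'))
  simp only [zero_mul, add_zero] at h
  exact h

theorem IsDiagram.fderiv_strip_injective (hT : T.IsDiagram) {s : ℝ}
    (hs : s ∈ Set.Icc (0 : ℝ) 1) : Function.Injective (fderiv ℝ T.strip (s, 0)) := by
  rw [injective_iff_map_eq_zero]
  rintro ⟨σ, ν⟩ h
  have hl : HasDerivAt (fun r : ℝ => ((s, 0) : ℝ × ℝ) + r • (σ, ν)) (σ, ν) 0 := by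
    simpa using ((hasDerivAt_id (0 : ℝ)).smul_const ((σ, ν) : ℝ × ℝ)).const_add ((s, 0) : ℝ × ℝ)
  have h1 : HasDerivAt (fun r : ℝ => T.strip ((s, 0) + r • (σ, ν)))
      (fderiv ℝ T.strip (s, 0) (σ, ν)) 0 := by
    refine HasFDerivAt.comp_hasDerivAt (l := T.strip) (0 : ℝ) ?_ hl
    simpa using (contDiff_strip.differentiable (by simp) ((s, 0) : ℝ × ℝ)).hasFDerivAt
  have h2 := h1.unique (hasDerivAt_strip_line s σ ν)
  rw [h] at h2
  have h3 := congrArg Prod.fst h2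
  have h4 := congrArg Prod.snd h2
  simp only [Prod.fst_zero, Prod.snd_zero] at h3 h4
  have hpos : 0 < deriv T.y s ^ 2 + deriv T.z s ^ 2 := by
    rcases hT.immersion s hs with h | h
    · have := sq_pos_of_ne_zero h; positivity
    · have := sq_pos_of_ne_zero h; positivity
  have h5 : σ * (deriv T.y s ^ 2 + deriv T.z s ^ 2) = 0 := by
    linear_combination (-deriv T.y s) * h3 - deriv T.z s * h4
  have h6 : ν * (deriv T.y s ^ 2 + deriv T.z s ^ 2) = 0 := by
    linear_combination (deriv T.z s) * h3 - deriv T.y s * h4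
  rw [(mul_eq_zero.1 h5).resolve_right hpos.ne', (mul_eq_zero.1 h6).resolve_right hpos.ne']
  rfl

/-- For small `δ`, the strip of width `δ M` along the diagram meets itself only near crossings,
where the over strand is not twisted. -/
theorem IsDiagram.eventually_strip_inj (hT : T.IsDiagram) {φ : ℝ → ℝ} (hφ : T.IsEvenTwisting φ)
    (M : ℝ) : ∀ᶠ δ in 𝓝 (0 : ℝ), ∀ q ∈ (Set.Icc (0 : ℝ) 1 ×ˢ Set.Icc (-M) M) ×ˢ
      (Set.Icc (0 : ℝ) 1 ×ˢ Set.Icc (-M) M),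
      T.strip (q.1.1, δ * q.1.2) = T.strip (q.2.1, δ * q.2.2) → q.1.1 = q.2.1 ∨
      (T.h q.2.1 < T.h q.1.1 ∧ Real.cos (φ q.1.1) = 1 ∧ Real.sin (φ q.1.1) = 0) ∨
      (T.h q.1.1 < T.h q.2.1 ∧ Real.cos (φ q.2.1) = 1 ∧ Real.sin (φ q.2.1) = 0) := by
  apply ((isCompact_Icc.prod isCompact_Icc).prod
    (isCompact_Icc.prod isCompact_Icc)).eventually_forall_of_forall_eventually
  rintro ⟨⟨s, w⟩, ⟨s', w'⟩⟩ ⟨⟨hs, -⟩, ⟨hs', -⟩⟩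
  simp only at hs hs'
  have hcs := contDiff_strip (T := T).continuous
  have ht1 : Filter.Tendsto (fun z : ℝ × ((ℝ × ℝ) × (ℝ × ℝ)) => (z.2.1.1, z.1 * z.2.1.2))
      (𝓝 (0, (s, w), (s', w'))) (𝓝 (s, 0)) := by
    have : Continuous (fun z : ℝ × ((ℝ × ℝ) × (ℝ × ℝ)) => (z.2.1.1, z.1 * z.2.1.2)) := by fun_prop
    simpa using this.tendsto (0, (s, w), (s', w'))
  have ht2 : Filter.Tendsto (fun z : ℝ × ((ℝ × ℝ) × (ℝ × ℝ)) => (z.2.2.1, z.1 * z.2.2.2))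
      (𝓝 (0, (s, w), (s', w'))) (𝓝 (s', 0)) := by
    have : Continuous (fun z : ℝ × ((ℝ × ℝ) × (ℝ × ℝ)) => (z.2.2.1, z.1 * z.2.2.2)) := by fun_prop
    simpa using this.tendsto (0, (s, w), (s', w'))
  have hp1 : Filter.Tendsto (fun z : ℝ × ((ℝ × ℝ) × (ℝ × ℝ)) => z.2.1.1)
      (𝓝 (0, (s, w), (s', w'))) (𝓝 s) := (continuous_fst.tendsto _).comp ht1
  have hp2 : Filter.Tendsto (fun z : ℝ × ((ℝ × ℝ) × (ℝ × ℝ)) => z.2.2.1)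
      (𝓝 (0, (s, w), (s', w'))) (𝓝 s') := (continuous_fst.tendsto _).comp ht2
  -- At `δ = 0` there are three kinds of pairs. Near the diagonal the strip is locally injective; at
  -- a crossing the over strand is untwisted nearby and the heights stay ordered; any other pair has
  -- disjoint neighborhoods. Compactness then gives a common `δ`.
  by_cases hss : s = s'
  · subst hss
    have h := eventually_injective_of_fderiv_injective
      ((contDiff_strip (T := T)).contDiffAt.of_le (by simp)) (hT.fderiv_strip_injective hs)
    filter_upwards [(ht1.prodMk_nhds ht2).eventually h] with z hz hzz
    exact Or.inl (Prod.ext_iff.1 (hz hzz)).1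
  · by_cases hP : T.strip (s, 0) = T.strip (s', 0)
    · have hy : T.y s = T.y s' := by simpa [strip] using congrArg Prod.fst hP
      have hz : T.z s = T.z s' := by simpa [strip] using congrArg Prod.snd hP
      have hhc := T.smooth_h.continuous
      rcases lt_trichotomy (T.h s) (T.h s') with hlt | heq | hgt
      · have h1 := hφ.eventually_flat hs' hs hy hz hlt
        have h2 := ((hhc.tendsto s).comp hp1).eventually_lt ((hhc.tendsto s').comp hp2) hlt
        filter_upwards [hp2.eventually h1, h2] with z h3 h4 _
        exact Or.inr (Or.inr ⟨h4, h3⟩)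
      · exact absurd (T.eq_of_coords_eq hs hs' heq hy hz) hss
      · have h1 := hφ.eventually_flat hs hs' hy.symm hz.symm hgt
        have h2 := ((hhc.tendsto s').comp hp2).eventually_lt ((hhc.tendsto s).comp hp1) hgt
        filter_upwards [hp1.eventually h1, h2] with z h3 h4 _
        exact Or.inr (Or.inl ⟨h4, h3⟩)
    · have h1 := ((hcs.tendsto _).comp ht1).prodMk_nhds ((hcs.tendsto _).comp ht2)
      have h2 : {p : (ℝ × ℝ) × (ℝ × ℝ) | p.1 ≠ p.2} ∈ 𝓝 (T.strip (s, 0), T.strip (s', 0)) :=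
        (isOpen_ne_fun continuous_fst continuous_snd).mem_nhds hP
      filter_upwards [h1 h2] with z hz hzz
      exact absurd hzz hz

/-- The expression is the Jacobian determinant of the strip at `(s, δ w)`. At `δ = 0` it is the
squared speed of the diagram, which is positive, and compactness keeps it positive for small `δ`. -/
theorem IsDiagram.eventually_strip_immersion (hT : T.IsDiagram) (M : ℝ) :
    ∀ᶠ δ in 𝓝 (0 : ℝ), ∀ q ∈ Set.Icc (0 : ℝ) 1 ×ˢ Set.Icc (-M) M,
      0 < deriv T.y q.1 ^ 2 + deriv T.z q.1 ^ 2 + δ * q.2 *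
        (deriv (deriv T.y) q.1 * deriv T.z q.1 - deriv (deriv T.z) q.1 * deriv T.y q.1) := by
  apply (isCompact_Icc.prod isCompact_Icc).eventually_forall_of_forall_eventually
  rintro ⟨s, w⟩ ⟨hs, -⟩
  have h3 := T.contDiff_deriv_y.continuous
  have h4 := T.contDiff_deriv_z.continuous
  have h5 : Continuous (deriv (deriv T.y)) := T.contDiff_deriv_y.continuous_deriv (by simp)
  have h6 : Continuous (deriv (deriv T.z)) := T.contDiff_deriv_z.continuous_deriv (by simp)
  apply ContinuousAt.eventually_lt (f := fun _ => (0 : ℝ)) continuousAt_const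
  · apply Continuous.continuousAt
    fun_prop
  · simp only [zero_mul, add_zero]
    rcases hT.immersion s hs with h | h
    · have := sq_pos_of_ne_zero h; positivity
    · have := sq_pos_of_ne_zero h; positivity

end ClosedTangle

/-! ### The isotopy from the spin to a surface with section the twisted double -/

/-- The first coordinate of the rotation by the angle `φ` about the axis `(0, -A, B)`, applied to
`(u, v, 0)`. -/
def tiltX (B φ u v : ℝ) : ℝ := u * Real.cos φ - B * v * Real.sin φ

/-- The second coordinate of the rotation in `tiltX`. -/
def tiltY (A B φ u v : ℝ) : ℝ :=
  v * Real.cos φ + B * u * Real.sin φ + A ^ 2 * v * (1 - Real.cos φ)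

/-- The third coordinate of the rotation in `tiltX`. -/
def tiltZ (A B φ u v : ℝ) : ℝ := A * u * Real.sin φ - A * B * v * (1 - Real.cos φ)

/-- For a unit axis the three coordinates come from a rotation, hence an isometry. Together with
linearity in `(u, v)` this yields injectivity on the circle and bounds the width of the twisted
strip. -/
theorem tilt_norm {A B : ℝ} (h : A ^ 2 + B ^ 2 = 1) (φ u v : ℝ) :
    tiltX B φ u v ^ 2 + tiltY A B φ u v ^ 2 + tiltZ A B φ u v ^ 2 = u ^ 2 + v ^ 2 := by
  have h1 := Real.sin_sq φ
  have h2 : B ^ 2 = 1 - A ^ 2 := by linarith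
  simp only [tiltX, tiltY, tiltZ]
  ring_nf
  have h3 : B ^ 2 = 1 - A ^ 2 := by linarith
  have h4 : Real.sin φ ^ 2 = 1 - Real.cos φ ^ 2 := h1
  simp only [h3, h4]
  ring

theorem tilt_injective {A B : ℝ} (h : A ^ 2 + B ^ 2 = 1) {φ u v u' v' : ℝ}
    (hX : tiltX B φ u v = tiltX B φ u' v') (hY : tiltY A B φ u v = tiltY A B φ u' v')
    (hZ : tiltZ A B φ u v = tiltZ A B φ u' v') : u = u' ∧ v = v' := by
  have h1 := tilt_norm h φ (u - u') (v - v')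
  have hX' : tiltX B φ (u - u') (v - v') = 0 := by
    simp only [tiltX] at hX ⊢; linear_combination hX
  have hY' : tiltY A B φ (u - u') (v - v') = 0 := by
    simp only [tiltY] at hY ⊢; linear_combination hY
  have hZ' : tiltZ A B φ (u - u') (v - v') = 0 := by
    simp only [tiltZ] at hZ ⊢; linear_combination hZ
  rw [hX', hY', hZ'] at h1
  constructor <;> nlinarith [sq_nonneg (u - u'), sq_nonneg (v - v')]

section

variable {f u v : ℝ → ℝ} {f' u' v' x : ℝ} (A B : ℝ)

theorem hasDerivAt_tiltX (hf : HasDerivAt f f' x) (hu : HasDerivAt u u' x)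
    (hv : HasDerivAt v v' x) : HasDerivAt (fun r => tiltX B (f r) (u r) (v r))
      (tiltX B (f x) u' v' + f' * (-u x * Real.sin (f x) - B * v x * Real.cos (f x))) x := by
  refine ((hu.mul hf.cos).sub ((hv.const_mul B).mul hf.sin)).congr_deriv ?_
  simp only [tiltX]
  ring

theorem hasDerivAt_tiltY (hf : HasDerivAt f f' x) (hu : HasDerivAt u u' x)
    (hv : HasDerivAt v v' x) : HasDerivAt (fun r => tiltY A B (f r) (u r) (v r))
      (tiltY A B (f x) u' v' + f' * (-v x * Real.sin (f x) + B * u x * Real.cos (f x) +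
        A ^ 2 * v x * Real.sin (f x))) x := by
  refine (((hv.mul hf.cos).add ((hu.const_mul B).mul hf.sin)).add
    ((hv.const_mul (A ^ 2)).mul (hf.cos.const_sub 1))).congr_deriv ?_
  simp only [tiltY]
  ring

theorem hasDerivAt_tiltZ (hf : HasDerivAt f f' x) (hu : HasDerivAt u u' x)
    (hv : HasDerivAt v v' x) : HasDerivAt (fun r => tiltZ A B (f r) (u r) (v r))
      (tiltZ A B (f x) u' v' + f' * (A * u x * Real.cos (f x) - A * B * v x * Real.sin (f x))) x := by
  refine (((hu.const_mul A).mul hf.sin).sub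
    ((hv.const_mul (A * B)).mul (hf.cos.const_sub 1))).congr_deriv ?_
  simp only [tiltZ]
  ring

/-- The core of the immersion property of the twisting isotopy. -/
theorem tilt_strip_immersion {A B φ y₁ z₁ y₂ z₂ δ u v σ ν u' v' kx ky kz : ℝ}
    (hAB : A ^ 2 + B ^ 2 = 1) (hδ : 0 < δ) (h0 : 0 < y₁ ^ 2 + z₁ ^ 2)
    (hpos : 0 < y₁ ^ 2 + z₁ ^ 2 + δ * tiltZ A B φ u v * (y₂ * z₁ - z₂ * y₁))
    (hX : tiltX B φ u' v' + ν * σ * kx = 0) (hY : tiltY A B φ u' v' + ν * σ * ky = 0)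
    (hy : y₁ * σ - (δ * (tiltZ A B φ u' v' + ν * σ * kz) * z₁ + δ * tiltZ A B φ u v * (z₂ * σ)) = 0)
    (hz : z₁ * σ + (δ * (tiltZ A B φ u' v' + ν * σ * kz) * y₁ + δ * tiltZ A B φ u v * (y₂ * σ)) = 0) :
    σ = 0 ∧ u' = 0 ∧ v' = 0 := by
  -- Projecting to the tangent `(y₁, z₁)` of the diagram cancels the unknown normal velocity and
  -- leaves `σ` times the Jacobian of the strip. Once `σ = 0`, projecting to the normal isolates the
  -- third coordinate of the rotated vector.
  have h1 : σ * (y₁ ^ 2 + z₁ ^ 2 + δ * tiltZ A B φ u v * (y₂ * z₁ - z₂ * y₁)) = 0 := by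
    linear_combination y₁ * hy + z₁ * hz
  have hσ : σ = 0 := (mul_eq_zero.1 h1).resolve_right hpos.ne'
  simp only [hσ, mul_zero, zero_mul, add_zero, zero_sub, zero_add] at hX hY hy hz
  have h2 : tiltZ A B φ u' v' * (δ * (y₁ ^ 2 + z₁ ^ 2)) = 0 := by
    linear_combination -z₁ * hy + y₁ * hz
  have h3 := (mul_eq_zero.1 h2).resolve_right (mul_pos hδ h0).ne'
  have h4 := tilt_norm hAB φ u' v'
  rw [hX, hY, h3] at h4
  refine ⟨hσ, ?_, ?_⟩ <;> nlinarith [sq_nonneg u', sq_nonneg v']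

end

namespace ClosedTangle

/-- For the time `t`, the circle over each point of the tangle is rotated by the angle `φ` about an
axis in the plane spanned by the second coordinate direction and the normal to the diagram. For
`t = 0` the circle rotates in its own plane, for `t = 1` its intersection with the hyperplane
`v = 0` rotates as the twisted double. -/
def twistMap (T : ClosedTangle) (φ : ℝ → ℝ) (δ : ℝ) (p : ℝ × ℝ × ℝ × ℝ) :
    EuclideanSpace ℝ (Fin 4) :=
  let A := Real.sin (Real.pi / 2 * p.1)
  let B := Real.cos (Real.pi / 2 * p.1)
  let s := (1 + p.2.1) / 2
  let u := p.2.2.1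
  let v := p.2.2.2
  !₂[tiltY A B (φ s) u v, tiltX B (φ s) u v,
    T.y s - δ * tiltZ A B (φ s) u v * deriv T.z s,
    T.z s + δ * tiltZ A B (φ s) u v * deriv T.y s]

variable {T : ClosedTangle} {φ : ℝ → ℝ}

theorem contDiff_twistMap (hφ : T.IsEvenTwisting φ) (δ : ℝ) : ContDiff ℝ ∞ (T.twistMap φ δ) := by
  have h0 := hφ.smooth
  have h1 := T.smooth_y
  have h2 := T.smooth_z
  have h3 := T.contDiff_deriv_y
  have h4 := T.contDiff_deriv_z
  rw [contDiff_euclidean]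
  intro i
  fin_cases i <;> simp [twistMap, tiltX, tiltY, tiltZ] <;> fun_prop

theorem exists_height_bound (T : ClosedTangle) :
    ∃ M : ℝ, 0 ≤ M ∧ ∀ s ∈ Set.Icc (0 : ℝ) 1, T.h s ≤ M ^ 2 := by
  obtain ⟨C, hC⟩ := (isCompact_Icc (a := (0 : ℝ)) (b := 1)).exists_bound_of_continuousOn
    T.smooth_h.continuous.continuousOn
  refine ⟨√|C|, Real.sqrt_nonneg _, fun s hs => ?_⟩
  rw [Real.sq_sqrt (abs_nonneg _)]
  exact (le_abs_self _).trans ((hC s hs).trans (le_abs_self _))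

theorem sin_sq_add_cos_sq_time (t : ℝ) :
    Real.sin (Real.pi / 2 * t) ^ 2 + Real.cos (Real.pi / 2 * t) ^ 2 = 1 :=
  Real.sin_sq_add_cos_sq _

/-- The last two coordinates lie in the strip at normal offset `δ tiltZ`, so a double point of the
surface is a double point of the strip. Over one parameter it is excluded by injectivity of the
rotation. Over two parameters it lies near a crossing, where the untwisted over circle is too large
to meet the under circle. -/
theorem IsDiagram.eventually_isRevolutionEmbedding_twistMap (hT : T.IsDiagram)
    (hφ : T.IsEvenTwisting φ) : ∀ᶠ δ in 𝓝[>] (0 : ℝ),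
      IsRevolutionEmbedding T.profile (fun p => stereoLift (T.twistMap φ δ p)) := by
  obtain ⟨M, hM, hMh⟩ := T.exists_height_bound
  filter_upwards [nhdsWithin_le_nhds (hT.eventually_strip_inj hφ M),
    nhdsWithin_le_nhds (hT.eventually_strip_immersion M), self_mem_nhdsWithin] with δ hinj himm hδ
  have hbound : ∀ t, ∀ c ∈ Set.Icc (-1 : ℝ) 1, ∀ u v : ℝ, u ^ 2 + v ^ 2 = T.profile (t, c) →
      tiltZ (Real.sin (Real.pi / 2 * t)) (Real.cos (Real.pi / 2 * t)) (φ ((1 + c) / 2)) u v ∈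
        Set.Icc (-M) M := by
    intro t c hc u v h
    have h1 := tilt_norm (sin_sq_add_cos_sq_time t) (φ ((1 + c) / 2)) u v
    have h2 := hMh _ (half_mem hc)
    apply Set.mem_Icc.2 ∘ abs_le.1
    apply abs_le_of_sq_le_sq _ hM
    simp only [profile] at h
    nlinarith [sq_nonneg (tiltX (Real.cos (Real.pi / 2 * t)) (φ ((1 + c) / 2)) u v),
      sq_nonneg (tiltY (Real.sin (Real.pi / 2 * t)) (Real.cos (Real.pi / 2 * t))
        (φ ((1 + c) / 2)) u v)]
  apply isRevolutionEmbedding_stereoLift (contDiff_twistMap hφ δ)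
  · intro t _ c hc u v h c' hc' u' v' h' he
    have hY := congrArg (fun x => x 0) he
    have hX := congrArg (fun x => x 1) he
    have hy := congrArg (fun x => x 2) he
    have hz := congrArg (fun x => x 3) he
    simp [twistMap] at hX hY hy hz
    have hn := tilt_norm (sin_sq_add_cos_sq_time t) (φ ((1 + c) / 2)) u v
    have hn' := tilt_norm (sin_sq_add_cos_sq_time t) (φ ((1 + c') / 2)) u' v'
    have hZ := hbound t c hc u v h
    have hZ' := hbound t c' hc' u' v' h'
    simp only [profile] at h h'
    set A := Real.sin (Real.pi / 2 * t)
    set B := Real.cos (Real.pi / 2 * t)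
    have hs := hinj ((_, _), (_, _)) ⟨⟨half_mem hc, hZ⟩, ⟨half_mem hc', hZ'⟩⟩ (Prod.ext hy hz)
    simp only at hs
    rcases hs with hs | ⟨hs, hcos, hsin⟩ | ⟨hs, hcos, hsin⟩
    · have hcc : c = c' := by linarith
      subst hcc
      have hpos := himm (_, _) ⟨half_mem hc, (⟨by linarith, hM⟩ : (0 : ℝ) ∈ Set.Icc (-M) M)⟩
      simp only [mul_zero, zero_mul, add_zero] at hpos
      have h5 : (tiltZ A B (φ ((1 + c) / 2)) u v - tiltZ A B (φ ((1 + c) / 2)) u' v') *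
          (δ * (deriv T.y ((1 + c) / 2) ^ 2 + deriv T.z ((1 + c) / 2) ^ 2)) = 0 := by
        linear_combination (-deriv T.z ((1 + c) / 2)) * hy + (deriv T.y ((1 + c) / 2)) * hz
      have h6 := (mul_eq_zero.1 h5).resolve_right (mul_pos hδ hpos).ne'
      exact ⟨rfl, tilt_injective (sin_sq_add_cos_sq_time t) hX hY (by linarith)⟩
    -- The strand at `c` is over and untwisted, so its point has `X² + Y² = h` there. The other
    -- point satisfies `X² + Y² ≤ h` at its own, strictly smaller height. The next case is
    -- symmetric.
    · exfalso
      have h1 : tiltZ A B (φ ((1 + c) / 2)) u v = 0 := by simp [tiltZ, hcos, hsin]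
      rw [h1, hX, hY, h] at hn
      nlinarith [sq_nonneg (tiltZ A B (φ ((1 + c') / 2)) u' v')]
    · exfalso
      have h1 : tiltZ A B (φ ((1 + c') / 2)) u' v' = 0 := by simp [tiltZ, hcos, hsin]
      rw [h1, ← hX, ← hY, h'] at hn'
      nlinarith [sq_nonneg (tiltZ A B (φ ((1 + c) / 2)) u v)]
  · intro t _ c hc u v h c' u' v' _ hd
    have hZ := hbound t c hc u v h
    rw [hasDerivAt_euclidean_coord] at hd
    have hdY := hd 0
    have hdX := hd 1
    have hdy := hd 2
    have hdz := hd 3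
    simp [twistMap] at hdX hdY hdy hdz
    set A := Real.sin (Real.pi / 2 * t) with hA
    set B := Real.cos (Real.pi / 2 * t) with hB
    have hAB : A ^ 2 + B ^ 2 = 1 := sin_sq_add_cos_sq_time t
    set s := (1 + c) / 2 with hs
    have hline : ∀ f : ℝ → ℝ, Differentiable ℝ f →
        HasDerivAt (fun r : ℝ => f ((1 + (c + r * c')) / 2)) (deriv f s * (c' / 2)) 0 := by
      intro f hf
      have h1 := hasDerivAt_comp_line hf s (c' / 2)
      refine h1.congr_of_eventuallyEq (Filter.Eventually.of_forall fun r => ?_)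
      simp only [hs]
      congr 1
      ring
    have hφ1 := hline φ (hφ.smooth.differentiable (by simp))
    have hy1 := hline T.y T.differentiable_y
    have hz1 := hline T.z T.differentiable_z
    have hy2 := hline (deriv T.y) (T.contDiff_deriv_y.differentiable (by simp))
    have hz2 := hline (deriv T.z) (T.contDiff_deriv_z.differentiable (by simp))
    have hu := hasDerivAt_line u u'
    have hv := hasDerivAt_line v v'
    have hdX' := hasDerivAt_tiltX B hφ1 hu hv
    have hdY' := hasDerivAt_tiltY A B hφ1 hu hv
    have hdZ := (hasDerivAt_tiltZ A B hφ1 hu hv).const_mul δ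
    have e1 := (hy1.sub (hdZ.mul hz2)).unique hdy
    have e2 := (hz1.add (hdZ.mul hy2)).unique hdz
    have e3 := hdX'.unique hdX
    have e4 := hdY'.unique hdY
    simp only [zero_mul, add_zero, ← hs] at e1 e2 e3 e4
    have hpos := himm (s, tiltZ A B (φ s) u v) ⟨half_mem hc, hZ⟩
    have hpos0 := himm (s, 0) ⟨half_mem hc, (⟨by linarith, hM⟩ : (0 : ℝ) ∈ Set.Icc (-M) M)⟩
    simp only [mul_zero, zero_mul, add_zero] at hpos0
    obtain ⟨h1, h2, h3⟩ := tilt_strip_immersion hAB hδ hpos0 hpos e3 e4 e1 e2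
    exact ⟨by linarith, h2, h3⟩

end ClosedTangle

/-! ### The equatorial slice at the end of the twisting isotopy -/

namespace ClosedTangle

variable {T : ClosedTangle} {φ : ℝ → ℝ}

/-- At time 0 each circle is rotated in its own plane and hence preserved as a set; the inverse
rotation supplies the parameters for the reverse inclusion. -/
theorem revolutionImage_twistMap_zero (δ : ℝ) :
    revolutionImage T.profile (fun p => stereoLift (T.twistMap φ δ p)) 0 = T.spin := by
  ext p
  constructor
  · rintro ⟨c, hc, u, v, h, rfl⟩
    refine ⟨(1 + c) / 2, half_mem hc, v * Real.cos (φ ((1 + c) / 2)) + u * Real.sin (φ ((1 + c) / 2)),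
      u * Real.cos (φ ((1 + c) / 2)) - v * Real.sin (φ ((1 + c) / 2)), ?_, ?_⟩
    · simp only [profile] at h
      rw [← h]
      linear_combination (u ^ 2 + v ^ 2) * Real.sin_sq_add_cos_sq (φ ((1 + c) / 2))
    · rw [dirSphere_stereoLift]
      simp [twistMap, tiltX, tiltY, tiltZ]
  · rintro ⟨s, hs, u, v, h, rfl⟩
    have hsc : (1 + (2 * s - 1)) / 2 = s := by ring
    refine ⟨2 * s - 1, ⟨by linarith [hs.1], by linarith [hs.2]⟩,
      v * Real.cos (φ s) + u * Real.sin (φ s), u * Real.cos (φ s) - v * Real.sin (φ s), ?_, ?_⟩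
    · simp only [profile, hsc]
      rw [← h]
      linear_combination (u ^ 2 + v ^ 2) * Real.sin_sq_add_cos_sq (φ s)
    · rw [dirSphere_stereoLift]
      have h1 := Real.sin_sq_add_cos_sq (φ s)
      simp only [twistMap, tiltX, tiltY, tiltZ, hsc]
      have e1 : u = (u * Real.cos (φ s) - v * Real.sin (φ s)) * Real.cos (φ s) +
          (v * Real.cos (φ s) + u * Real.sin (φ s)) * Real.sin (φ s) := by
        linear_combination (-u) * h1
      have e2 : v = (v * Real.cos (φ s) + u * Real.sin (φ s)) * Real.cos (φ s) -
          (u * Real.cos (φ s) - v * Real.sin (φ s)) * Real.sin (φ s) := by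
        linear_combination (-v) * h1
      simp [← e1, ← e2]

theorem twistMap_one (δ c u v : ℝ) : T.twistMap φ δ (1, c, u, v) =
    !₂[v, u * Real.cos (φ ((1 + c) / 2)),
      T.y ((1 + c) / 2) - δ * (u * Real.sin (φ ((1 + c) / 2))) * deriv T.z ((1 + c) / 2),
      T.z ((1 + c) / 2) + δ * (u * Real.sin (φ ((1 + c) / 2))) * deriv T.y ((1 + c) / 2)] := by
  simp [twistMap, tiltX, tiltY, tiltZ]
  ring

theorem invStereo_cons_zero (a b c : ℝ) (p : Sph 3) :
    (∀ i : Fin 4, (invStereo !₂[0, a, b, c]).1 i.succ = p.1 i) ↔ p = invStereo !₂[a, b, c] := by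
  have h1 : ‖(!₂[0, a, b, c] : EuclideanSpace ℝ (Fin 4))‖ ^ 2 =
      ‖(!₂[a, b, c] : EuclideanSpace ℝ (Fin 3))‖ ^ 2 := by
    rw [norm_sq_vec3, norm_sq_vec4]; ring
  have h2 : ∀ i : Fin 4, (invStereo !₂[0, a, b, c]).1 i.succ = (invStereo !₂[a, b, c]).1 i := by
    intro i
    simp only [invStereo, h1]
    fin_cases i <;> rfl
  constructor
  · intro h
    apply Subtype.ext
    ext i
    rw [← h, h2]
  · rintro rfl
    exact h2

/-- For an even twisting with small parameter, the twisted double is the transverse intersection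
of a surface isotopic to the spin with the equatorial 3-sphere. -/
theorem IsDiagram.eventually_isSlice (hT : T.IsDiagram) (hφ : T.IsEvenTwisting φ) :
    ∀ᶠ δ in 𝓝[>] (0 : ℝ), ∃ f : Sph 2 → Sph 4, IsSmoothSphereEmbedding f ∧
      SmoothlyIsotopic 2 T.spin (Set.range f) ∧
      (∀ x, (f x).1 0 = 0 → mfderiv (𝓡 2) 𝓘(ℝ, ℝ) (fun x' => (f x').1 0) x ≠ 0) ∧
      {p : Sph 3 | ∃ x, (f x).1 0 = 0 ∧ ∀ i : Fin 4, (f x).1 i.succ = p.1 i} =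
        T.twistedDouble φ δ := by
  filter_upwards [hT.eventually_isRevolutionEmbedding_twistMap hφ] with δ hδ
  obtain ⟨g, hg, hℓ, hpos⟩ := T.isProfile.exists_factor
  obtain ⟨h1, h2⟩ := hδ.isotopy hg hℓ hpos
  have hn : ∀ x : Sph 2, ‖x.1‖ = 1 := fun x => mem_sphere_zero_iff_norm.1 x.2
  -- At time 1 the rotation fixes the coordinate `v`. The coordinate cut out by the equator is
  -- therefore a positive function times `x 1`, which gives both its zero set and its regularity
  -- there.
  have hcoord : ∀ x : Sph 2, (dirSphere (revolutionMap g
      (fun p => stereoLift (T.twistMap φ δ p)) (1, x.1))).1 0 =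
      2 * (√(g (1, x.1 2)) / (‖T.twistMap φ δ (1, x.1 2, √(g (1, x.1 2)) * x.1 0,
        √(g (1, x.1 2)) * x.1 1)‖ ^ 2 + 1)) * x.1 1 := by
    intro x
    rw [revolutionMap, dirSphere_coe (stereoLift_ne_zero _), PiLp.smul_apply]
    have h3 : (stereoLift (T.twistMap φ δ (1, x.1 2, √(g (1, x.1 2)) * x.1 0,
        √(g (1, x.1 2)) * x.1 1))) 0 = 2 * (√(g (1, x.1 2)) * x.1 1) := by
      rw [show (0 : Fin 5) = (0 : Fin 4).castSucc from rfl, stereoLift_castSucc, twistMap_one]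
      simp
    rw [norm_stereoLift, smul_eq_mul]
    simp only [h3]
    ring
  refine ⟨_, h1 1 (by simp), ?_, ?_, ?_⟩
  · have h3 := range_revolutionMap (Ψ := fun p => stereoLift (T.twistMap φ δ p)) hℓ hpos 0
    rw [revolutionImage_twistMap_zero] at h3
    rwa [h3] at h2
  · intro x hx
    have hs : 0 < √(g (1, x.1 2)) := Real.sqrt_pos.2 (hpos 1 _ (mem_Icc_of_norm_eq_one (hn x)))
    set q : EuclideanSpace ℝ (Fin 3) → ℝ := fun w => 2 * (√(g (1, w 2)) /
      (‖T.twistMap φ δ (1, w 2, √(g (1, w 2)) * w 0, √(g (1, w 2)) * w 1)‖ ^ 2 + 1)) with hq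
    have hqpos : 0 < q x.1 := by simp only [hq]; positivity
    have hx1 : x.1 1 = 0 := by
      rw [hcoord] at hx
      exact (mul_eq_zero.1 hx).resolve_left hqpos.ne'
    have hqs : DifferentiableAt ℝ q x.1 := by
      have h3 : ContDiffAt ℝ ∞ (fun w : EuclideanSpace ℝ (Fin 3) => √(g (1, w 2))) x.1 :=
        (contDiffAt_sqrt_factor hg hpos 1 (hn x)).comp x.1
          (contDiffAt_const.prodMk contDiffAt_id)
      have h4 : ContDiffAt ℝ ∞ (fun w : EuclideanSpace ℝ (Fin 3) =>
          ‖T.twistMap φ δ (1, w 2, √(g (1, w 2)) * w 0, √(g (1, w 2)) * w 1)‖ ^ 2 + 1) x.1 := by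
        refine ((contDiff_norm_sq ℝ).contDiffAt.comp x.1
          ((contDiff_twistMap hφ δ).contDiffAt.comp x.1 ?_)).add contDiffAt_const
        apply ContDiffAt.prodMk (by fun_prop)
        apply ContDiffAt.prodMk (by fun_prop)
        exact (h3.mul (by fun_prop)).prodMk (h3.mul (by fun_prop))
      exact (contDiffAt_const.mul (h3.div h4 (by positivity))).differentiableAt (by simp)
    have hfun : (fun x' : Sph 2 => (dirSphere (revolutionMap g
      (fun p => stereoLift (T.twistMap φ δ p)) (1, x'.1))).1 0) =
        fun x' : Sph 2 => (fun w => q w * w 1) x'.1 := funext hcoord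
    have hd : HasFDerivAt (fun w => q w * w 1) (q x.1 • (EuclideanSpace.proj 1 :
        EuclideanSpace ℝ (Fin 3) →L[ℝ] ℝ) + x.1 1 • fderiv ℝ q x.1) x.1 :=
      hqs.hasFDerivAt.mul (EuclideanSpace.proj 1 : EuclideanSpace ℝ (Fin 3) →L[ℝ] ℝ).hasFDerivAt
    -- Where `x 1 = 0` the basis vector `e₁` is tangent to the sphere, and the derivative of `q * x
    -- 1` along it is `q > 0`.
    obtain ⟨v, hv⟩ := (mfderiv_coe_sph_range x (EuclideanSpace.single 1 1)).2 (by
      simp [EuclideanSpace.inner_single_right, hx1])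
    intro h0
    have h3 := congrArg (fun L => L v) h0
    have h4 := (congrArg (fun k => mfderiv (𝓡 2) 𝓘(ℝ, ℝ) k x v) hfun).symm.trans h3
    have h5 := (mfderiv_comp_coe_sph x hd.differentiableAt v).symm.trans h4
    rw [hv, hd.fderiv, hx1] at h5
    simp at h5
    exact hqpos.ne' h5
  · ext p
    constructor
    · rintro ⟨x, hx, hp⟩
      have hc := mem_Icc_of_norm_eq_one (hn x)
      have hs : 0 < √(g (1, x.1 2)) := Real.sqrt_pos.2 (hpos 1 _ hc)
      have hx1 : x.1 1 = 0 := by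
        rw [hcoord] at hx
        exact (mul_eq_zero.1 hx).resolve_left (by positivity)
      have hsq := sq_add_sq_revolution hℓ hpos 1 (hn x)
      simp only [revolutionMap, dirSphere_stereoLift, twistMap_one, hx1, mul_zero,
        invStereo_cons_zero] at hp
      refine ⟨(1 + x.1 2) / 2, half_mem hc, √(g (1, x.1 2)) * x.1 0, ?_, hp⟩
      simpa [hx1, profile] using hsq
    · rintro ⟨s, hs, u, hu, hp⟩
      have hsc : (1 + (2 * s - 1)) / 2 = s := by ring
      have hmem : invStereo (T.twistMap φ δ (1, 2 * s - 1, u, 0)) ∈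
          revolutionImage T.profile (fun p => stereoLift (T.twistMap φ δ p)) 1 :=
        ⟨2 * s - 1, ⟨by linarith [hs.1], by linarith [hs.2]⟩, u, 0, by simp [profile, hu],
          (dirSphere_stereoLift _).symm⟩
      rw [← range_revolutionMap hℓ hpos] at hmem
      obtain ⟨x, hx⟩ := hmem
      refine ⟨x, ?_, ?_⟩
      · simp only at hx ⊢
        rw [hx, twistMap_one]
        simp only [invStereo]
        rw [show (0 : Fin 5) = (0 : Fin 4).castSucc from rfl]
        simp
      · simp only at hx ⊢
        rw [hx, twistMap_one, invStereo_cons_zero, hsc]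
        exact hp

end ClosedTangle

/-! ### Spinning the part of a closed curve outside a round ball -/

/-- Quaternionic multiplication `p ↦ conj c * p` on `ℝ^4`. -/
def conjMul (c p : EuclideanSpace ℝ (Fin 4)) : EuclideanSpace ℝ (Fin 4) :=
  !₂[c 0 * p 0 + c 1 * p 1 + c 2 * p 2 + c 3 * p 3,
    c 0 * p 1 - c 1 * p 0 - c 2 * p 3 + c 3 * p 2,
    c 0 * p 2 + c 1 * p 3 - c 2 * p 0 - c 3 * p 1,
    c 0 * p 3 - c 1 * p 2 + c 2 * p 1 - c 3 * p 0]

theorem norm_sq_four (p : EuclideanSpace ℝ (Fin 4)) :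
    ‖p‖ ^ 2 = p 0 ^ 2 + p 1 ^ 2 + p 2 ^ 2 + p 3 ^ 2 := by
  rw [EuclideanSpace.norm_sq_eq, Fin.sum_univ_four]
  simp

/-- Euler's four-square identity. For unit `c`, multiplication by the conjugate of `c` is an
isometry taking `c` to the first basis vector and depending smoothly on `c`; this lets the balls
move in families without choosing frames. -/
theorem norm_conjMul_sq (c p : EuclideanSpace ℝ (Fin 4)) :
    ‖conjMul c p‖ ^ 2 = ‖c‖ ^ 2 * ‖p‖ ^ 2 := by
  rw [conjMul, norm_sq_vec4, norm_sq_four, norm_sq_four]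
  ring

theorem conjMul_zero (c p : EuclideanSpace ℝ (Fin 4)) : conjMul c p 0 = inner ℝ c p := by
  rw [PiLp.inner_apply, Fin.sum_univ_four]
  simp [conjMul]
  ring

theorem conjMul_sub (c p q : EuclideanSpace ℝ (Fin 4)) :
    conjMul c (p - q) = conjMul c p - conjMul c q := by
  ext i
  fin_cases i <;> simp [conjMul] <;> ring

theorem conjMul_eq_zero {c p : EuclideanSpace ℝ (Fin 4)} (hc : ‖c‖ = 1) (h : conjMul c p = 0) :
    p = 0 := by
  have h1 := norm_conjMul_sq c p
  rw [h, hc] at h1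
  rw [norm_zero, one_pow, one_mul, zero_pow two_ne_zero] at h1
  exact norm_eq_zero.1 (pow_eq_zero_iff two_ne_zero |>.1 h1.symm)

theorem hasDerivAt_conjMul (c : EuclideanSpace ℝ (Fin 4)) {f : ℝ → EuclideanSpace ℝ (Fin 4)}
    {f' : EuclideanSpace ℝ (Fin 4)} {x : ℝ} (hf : HasDerivAt f f' x) :
    HasDerivAt (fun r => conjMul c (f r)) (conjMul c f') x := by
  rw [hasDerivAt_euclidean_coord] at hf ⊢
  intro i
  fin_cases i
  · exact ((((hf 0).const_mul (c 0)).add ((hf 1).const_mul (c 1))).add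
      ((hf 2).const_mul (c 2))).add ((hf 3).const_mul (c 3))
  · exact ((((hf 1).const_mul (c 0)).sub ((hf 0).const_mul (c 1))).sub
      ((hf 3).const_mul (c 2))).add ((hf 2).const_mul (c 3))
  · exact ((((hf 2).const_mul (c 0)).add ((hf 3).const_mul (c 1))).sub
      ((hf 0).const_mul (c 2))).sub ((hf 1).const_mul (c 3))
  · exact ((((hf 3).const_mul (c 0)).sub ((hf 2).const_mul (c 1))).add
      ((hf 1).const_mul (c 2))).sub ((hf 0).const_mul (c 3))

theorem ContDiff.conjMul {E : Type*} [NormedAddCommGroup E] [NormedSpace ℝ E]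
    {c p : E → EuclideanSpace ℝ (Fin 4)} (hc : ContDiff ℝ ∞ c) (hp : ContDiff ℝ ∞ p) :
    ContDiff ℝ ∞ fun x => conjMul (c x) (p x) := by
  rw [contDiff_euclidean] at hc hp ⊢
  have h0 := hc 0
  have h1 := hc 1
  have h2 := hc 2
  have h3 := hc 3
  have k0 := hp 0
  have k1 := hp 1
  have k2 := hp 2
  have k3 := hp 3
  intro i
  fin_cases i <;> simp [_root_.conjMul] <;> fun_prop

/-- The spin of the part outside the round ball `{p | ρ + ⟪c, p⟫ ≤ 0}` of a curve `C` in `S^3`.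
The complement of the ball is mapped to a Euclidean ball by an isometry that moves `c` to the first
basis vector, followed by a stereographic projection; the spin of a curve in the Euclidean unit
ball is its preimage under the orthogonal projection of `S^4`. -/
def ballSpin (C : Set (Sph 3)) (c : EuclideanSpace ℝ (Fin 4)) (ρ : ℝ) : Set (Sph 4) :=
  {P | ∃ p ∈ C, 0 ≤ ρ + inner ℝ c p.1 ∧ ∃ u v : ℝ,
    u ^ 2 + v ^ 2 = 2 * (ρ + inner ℝ c p.1) * (1 + inner ℝ c p.1) ∧
    P = dirSphere !₂[u, v, conjMul c p.1 1, conjMul c p.1 2, conjMul c p.1 3]}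

/-- The hypotheses compare the squared lengths of the spin part and of the remaining part of two
proportional vectors. The ratio of these lengths is `2 (ρ + a) / (1 - a)`, strictly increasing in
`a` when `ρ > -1`. The proof is cross-multiplied because `1 - a` may vanish. -/
theorem ballSpin_inj_aux {ρ a b r : ℝ} (hρ : -1 < ρ) (hr : 0 < r) (ha : 0 < 1 + a)
    (hb : 0 < 1 + b)
    (h1 : 2 * (ρ + a) * (1 + a) = r ^ 2 * (2 * (ρ + b) * (1 + b)))
    (h2 : 1 - a ^ 2 = r ^ 2 * (1 - b ^ 2)) : a = b ∧ r = 1 := by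
  have h3 : (1 + a) * ((1 + b) * ((a - b) * (1 + ρ))) = 0 := by
    have : r ^ 2 * ((1 + a) * ((1 + b) * ((a - b) * (1 + ρ)))) = 0 := by
      linear_combination (1 / 2) * (1 - a ^ 2) * h1 - (ρ + a) * (1 + a) * h2
    exact (mul_eq_zero.1 this).resolve_left (by positivity)
  have h4 := (mul_eq_zero.1 h3).resolve_left ha.ne'
  have h5 := (mul_eq_zero.1 h4).resolve_left hb.ne'
  have h6 : a - b = 0 := (mul_eq_zero.1 h5).resolve_right (by linarith)
  have hab : a = b := by linarith
  subst hab
  refine ⟨rfl, ?_⟩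
  have h7 : (r ^ 2 - 1) * ((1 + a) * (1 + ρ)) = 0 := by
    linear_combination -(1 / 2) * h1 - h2
  have h8 : r ^ 2 - 1 = 0 := (mul_eq_zero.1 h7).resolve_right (by nlinarith)
  nlinarith

/-- The infinitesimal form of `ballSpin_inj_aux`: the two equations differentiate the two squared
lengths along a direction that is radial with factor `μ`. -/
theorem ballSpin_imm_aux {ρ a a' μ : ℝ} (hρ : -1 < ρ) (ha : 0 < 1 + a) (hρa : 0 ≤ ρ + a)
    (h1 : 2 * μ * (ρ + a) * (1 + a) = a' * (1 + 2 * a + ρ))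
    (h2 : μ * (1 - a ^ 2) = -(a * a')) : μ = 0 ∧ a' = 0 := by
  have h3 : μ * ((1 + a) ^ 2 * (1 + ρ)) = 0 := by
    linear_combination (1 + 2 * a + ρ) * h2 + a * h1
  have h4 : 0 < 1 + ρ := by linarith
  have hμ : μ = 0 := (mul_eq_zero.1 h3).resolve_right (by positivity)
  subst hμ
  refine ⟨rfl, ?_⟩
  have h5 : a' * (1 + 2 * a + ρ) = 0 := by linarith
  exact (mul_eq_zero.1 h5).resolve_right (by linarith)

/-- A smooth family of tangles, parametrized by `[-1, 1]`, in the complements of round balls. -/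
structure IsBallTangle (γ : ℝ × ℝ → EuclideanSpace ℝ (Fin 4)) (c : ℝ → EuclideanSpace ℝ (Fin 4))
    (ρ : ℝ → ℝ) : Prop where
  smooth : ContDiff ℝ ∞ γ
  norm_eq : ∀ p, ‖γ p‖ = 1
  smooth_center : ContDiff ℝ ∞ c
  norm_center : ∀ t, ‖c t‖ = 1
  smooth_radius : ContDiff ℝ ∞ ρ
  neg_one_lt : ∀ t, -1 < ρ t
  lt_one : ∀ t, ρ t < 1
  isProfile : IsProfile fun p => ρ p.1 + inner ℝ (c p.1) (γ p)
  inj : ∀ t ∈ Set.Icc (0 : ℝ) 1, ∀ x ∈ Set.Icc (-1 : ℝ) 1, ∀ y ∈ Set.Icc (-1 : ℝ) 1,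
    γ (t, x) = γ (t, y) → x = y
  imm : ∀ t ∈ Set.Icc (0 : ℝ) 1, ∀ x ∈ Set.Icc (-1 : ℝ) 1, deriv (fun x => γ (t, x)) x ≠ 0

namespace IsProfile

theorem nonneg {ℓ : ℝ × ℝ → ℝ} (h : IsProfile ℓ) (t : ℝ) {x : ℝ} (hx : x ∈ Set.Icc (-1 : ℝ) 1) :
    0 ≤ ℓ (t, x) := by
  rcases eq_or_lt_of_le hx.1 with h1 | h1
  · rw [← h1, h.left]
  · rcases eq_or_lt_of_le hx.2 with h2 | h2
    · rw [h2, h.right]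
    · exact (h.pos t x ⟨h1, h2⟩).le

end IsProfile

namespace IsBallTangle

variable {γ : ℝ × ℝ → EuclideanSpace ℝ (Fin 4)} {c : ℝ → EuclideanSpace ℝ (Fin 4)} {ρ : ℝ → ℝ}

theorem one_add_inner_pos (h : IsBallTangle γ c ρ) (t : ℝ) {x : ℝ} (hx : x ∈ Set.Icc (-1 : ℝ) 1) :
    0 < 1 + inner ℝ (c t) (γ (t, x)) := by
  have h1 := h.isProfile.nonneg t hx
  have h2 := h.lt_one t
  simp only at h1
  linarith

theorem hasDerivAt_inner (h : IsBallTangle γ c ρ) (t x : ℝ) :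
    HasDerivAt (fun x => inner ℝ (c t) (γ (t, x)))
      (inner ℝ (c t) (deriv (fun x => γ (t, x)) x)) x := by
  have h1 : HasDerivAt (fun x => γ (t, x)) (deriv (fun x => γ (t, x)) x) x :=
    ((h.smooth.comp (contDiff_const.prodMk contDiff_id)).differentiable (by simp) x).hasDerivAt
  simpa using (hasDerivAt_const x (c t)).inner ℝ h1

theorem isProfile_spin (h : IsBallTangle γ c ρ) : IsProfile fun p =>
    2 * (ρ p.1 + inner ℝ (c p.1) (γ p)) * (1 + inner ℝ (c p.1) (γ p)) := by
  have hi : ContDiff ℝ ∞ fun p : ℝ × ℝ => inner ℝ (c p.1) (γ p) :=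
    (h.smooth_center.comp contDiff_fst).inner ℝ h.smooth
  have hd : ∀ t x, ρ t + inner ℝ (c t) (γ (t, x)) = 0 →
      deriv (fun x => ρ t + inner ℝ (c t) (γ (t, x))) x ≠ 0 →
      deriv (fun x => 2 * (ρ t + inner ℝ (c t) (γ (t, x))) * (1 + inner ℝ (c t) (γ (t, x)))) x
        ≠ 0 := by
    intro t x h0 h1
    have h2 := h.hasDerivAt_inner t x
    rw [(h2.const_add (ρ t)).deriv] at h1
    rw [(((h2.const_add (ρ t)).const_mul 2).fun_mul (h2.const_add 1)).deriv, h0]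
    have h3 : 1 + inner ℝ (c t) (γ (t, x)) ≠ 0 := by linarith [h.lt_one t]
    simpa using ⟨h1, h3⟩
  refine ⟨?_, ?_, ?_, ?_, ?_, ?_⟩
  · exact (contDiff_const.mul ((h.smooth_radius.comp contDiff_fst).add hi)).mul
      (contDiff_const.add hi)
  · intro t
    have := h.isProfile.right t
    simp only at this ⊢
    rw [this]; ring
  · intro t
    have := h.isProfile.left t
    simp only at this ⊢
    rw [this]; ring
  · intro t x hx
    have h1 := h.isProfile.pos t x hx
    have h2 := h.one_add_inner_pos t (Set.Ioo_subset_Icc_self hx)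
    simp only at h1 ⊢
    positivity
  · exact fun t => hd t 1 (h.isProfile.right t) (h.isProfile.deriv_right t)
  · exact fun t => hd t (-1) (h.isProfile.left t) (h.isProfile.deriv_left t)

theorem norm_sq_conjMul (h : IsBallTangle γ c ρ) (t x : ℝ) :
    inner ℝ (c t) (γ (t, x)) ^ 2 + conjMul (c t) (γ (t, x)) 1 ^ 2 +
      conjMul (c t) (γ (t, x)) 2 ^ 2 + conjMul (c t) (γ (t, x)) 3 ^ 2 = 1 := by
  have h1 := norm_conjMul_sq (c t) (γ (t, x))
  rw [h.norm_eq, h.norm_center, norm_sq_four, conjMul_zero] at h1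
  linarith

theorem isRevolutionEmbedding (h : IsBallTangle γ c ρ) : IsRevolutionEmbedding (fun p =>
      2 * (ρ p.1 + inner ℝ (c p.1) (γ p)) * (1 + inner ℝ (c p.1) (γ p)))
    (fun p => !₂[p.2.2.1, p.2.2.2, conjMul (c p.1) (γ (p.1, p.2.1)) 1,
      conjMul (c p.1) (γ (p.1, p.2.1)) 2, conjMul (c p.1) (γ (p.1, p.2.1)) 3]) := by
  refine ⟨?_, ?_, ?_, ?_⟩
  · have h1 : ContDiff ℝ ∞ fun p : ℝ × ℝ × ℝ × ℝ => conjMul (c p.1) (γ (p.1, p.2.1)) :=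
      ContDiff.conjMul (h.smooth_center.comp contDiff_fst) (h.smooth.comp (by fun_prop))
    rw [contDiff_euclidean] at h1 ⊢
    have e1 := h1 1
    have e2 := h1 2
    have e3 := h1 3
    intro i
    fin_cases i <;> simp <;> fun_prop
  · intro t x hx u v he h0
    have hu := congrArg (fun x => x 0) h0
    have hv := congrArg (fun x => x 1) h0
    have h1 := congrArg (fun x => x 2) h0
    have h2 := congrArg (fun x => x 3) h0
    have h3 := congrArg (fun x => x 4) h0
    simp at hu hv h1 h2 h3
    have h4 := h.norm_sq_conjMul t x
    have h5 := h.one_add_inner_pos t hx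
    rw [h1, h2, h3] at h4
    simp only [hu, hv] at he
    have h6 : ρ t + inner ℝ (c t) (γ (t, x)) = 0 := by
      have : (ρ t + inner ℝ (c t) (γ (t, x))) * (2 * (1 + inner ℝ (c t) (γ (t, x)))) = 0 := by
        linarith
      exact (mul_eq_zero.1 this).resolve_right (by positivity)
    nlinarith [h.neg_one_lt t, h.lt_one t]
  · intro t ht x hx u v he y hy u' v' he' r hr h0
    have hu := congrArg (fun x => x 0) h0
    have hv := congrArg (fun x => x 1) h0
    have h1 := congrArg (fun x => x 2) h0
    have h2 := congrArg (fun x => x 3) h0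
    have h3 := congrArg (fun x => x 4) h0
    simp at hu hv h1 h2 h3
    simp only at he he'
    have n1 := h.norm_sq_conjMul t x
    have n2 := h.norm_sq_conjMul t y
    have p1 := h.one_add_inner_pos t hx
    have p2 := h.one_add_inner_pos t hy
    rw [hu, hv] at he
    rw [h1, h2, h3] at n1
    obtain ⟨e1, e2⟩ := ballSpin_inj_aux (h.neg_one_lt t) hr p1 p2
      (by rw [← he, ← he']; ring) (by linear_combination r ^ 2 * n2 - n1)
    subst e2
    simp only [one_mul] at hu hv h1 h2 h3
    have e3 : conjMul (c t) (γ (t, x) - γ (t, y)) = 0 := by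
      rw [conjMul_sub, sub_eq_zero]
      ext i
      fin_cases i
      · simpa [conjMul_zero] using e1
      · exact h1
      · exact h2
      · exact h3
    exact ⟨h.inj t ht x hx y hy (sub_eq_zero.1 (conjMul_eq_zero (h.norm_center t) e3)), hu, hv⟩
  · intro t ht x hx u v he x' u' v' μ hc hd
    have hγ : HasDerivAt (fun x => γ (t, x)) (deriv (fun x => γ (t, x)) x) x :=
      ((h.smooth.comp (contDiff_const.prodMk contDiff_id)).differentiable (by simp) x).hasDerivAt
    set γ' := deriv (fun x => γ (t, x)) x with hγ'
    have hγl : HasDerivAt (fun r : ℝ => γ (t, x + r * x')) (x' • γ') 0 := by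
      refine HasDerivAt.scomp (h := fun r : ℝ => x + r * x') (g₁ := fun x => γ (t, x)) (0 : ℝ) ?_
        (hasDerivAt_line x x')
      simpa using hγ
    have hq := hasDerivAt_conjMul (c t) hγl
    have hn := norm_sq_four (conjMul (c t) (γ (t, x)))
    rw [hasDerivAt_euclidean_coord] at hd
    have hqc := hasDerivAt_euclidean_coord.1 hq
    have d0 := (hasDerivAt_line u u').unique (by simpa using hd 0)
    have d1 := (hasDerivAt_line v v').unique (by simpa using hd 1)
    have d2 := (hqc 1).unique (by simpa using hd 2)
    have d3 := (hqc 2).unique (by simpa using hd 3)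
    have d4 := (hqc 3).unique (by simpa using hd 4)
    have hsq : HasDerivAt (fun r : ℝ => conjMul (c t) (γ (t, x + r * x')) 0 ^ 2 +
        conjMul (c t) (γ (t, x + r * x')) 1 ^ 2 + conjMul (c t) (γ (t, x + r * x')) 2 ^ 2 +
        conjMul (c t) (γ (t, x + r * x')) 3 ^ 2) _ 0 :=
      ((((hqc 0).fun_pow 2).add ((hqc 1).fun_pow 2)).add ((hqc 2).fun_pow 2)).add
        ((hqc 3).fun_pow 2)
    have hconst : (fun r : ℝ => conjMul (c t) (γ (t, x + r * x')) 0 ^ 2 +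
        conjMul (c t) (γ (t, x + r * x')) 1 ^ 2 + conjMul (c t) (γ (t, x + r * x')) 2 ^ 2 +
        conjMul (c t) (γ (t, x + r * x')) 3 ^ 2) = fun _ => 1 := by
      ext1 r
      rw [conjMul_zero]
      exact h.norm_sq_conjMul t _
    rw [hconst] at hsq
    have hz := hsq.unique (hasDerivAt_const (0 : ℝ) (1 : ℝ))
    simp only [d2, d3, d4, zero_mul, add_zero, conjMul_zero] at hz
    have n1 := h.norm_sq_conjMul t x
    have p1 := h.one_add_inner_pos t hx
    have p2 := h.isProfile.nonneg t hx
    simp only at p2 he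
    have hin := h.hasDerivAt_inner t x
    have hder := (((hin.const_add (ρ t)).const_mul 2).mul (hin.const_add 1)).deriv
    have hc' : 2 * (u * u' + v * v') = _ := hc.trans (congrArg (· * x') hder)
    rw [d0, d1] at hc'
    have ha' : inner ℝ (c t) (x' • γ') = x' * inner ℝ (c t) γ' := inner_smul_right _ _ _
    obtain ⟨e1, e2⟩ := ballSpin_imm_aux (a' := inner ℝ (c t) (x' • γ')) (μ := μ)
      (h.neg_one_lt t) p1 p2
      (by
        rw [ha']
        have : 2 * (u * (μ * u) + v * (μ * v)) = 2 * μ * (u ^ 2 + v ^ 2) := by ring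
        rw [this, he] at hc'
        linear_combination (1 / 2) * hc')
      (by
        norm_num at hz
        linear_combination (1 / 2) * hz - μ * n1)
    have e3 : x' • γ' = 0 := by
      apply conjMul_eq_zero (h.norm_center t)
      rw [e1] at d2 d3 d4
      simp only [zero_mul] at d2 d3 d4
      ext i
      fin_cases i
      · simpa [conjMul_zero] using e2
      · exact d2
      · exact d3
      · exact d4
    rw [e1, zero_mul] at d0 d1
    exact ⟨(smul_eq_zero.1 e3).resolve_right (h.imm t ht x hx), d0, d1⟩

theorem revolutionImage_eq (h : IsBallTangle γ c ρ) (t : ℝ) {C : Set (Sph 3)}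
    (hC : ∀ p : Sph 3, (p ∈ C ∧ 0 ≤ ρ t + inner ℝ (c t) p.1) ↔
      ∃ x ∈ Set.Icc (-1 : ℝ) 1, γ (t, x) = p.1) :
    revolutionImage (fun p => 2 * (ρ p.1 + inner ℝ (c p.1) (γ p)) * (1 + inner ℝ (c p.1) (γ p)))
      (fun p => !₂[p.2.2.1, p.2.2.2, conjMul (c p.1) (γ (p.1, p.2.1)) 1,
        conjMul (c p.1) (γ (p.1, p.2.1)) 2, conjMul (c p.1) (γ (p.1, p.2.1)) 3]) t =
      ballSpin C (c t) (ρ t) := by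
  ext P
  constructor
  · rintro ⟨x, hx, u, v, he, rfl⟩
    obtain ⟨h1, h2⟩ := (hC ⟨γ (t, x), mem_sphere_zero_iff_norm.2 (h.norm_eq _)⟩).2 ⟨x, hx, rfl⟩
    exact ⟨_, h1, h2, u, v, he, rfl⟩
  · rintro ⟨p, hp, h0, u, v, he, rfl⟩
    obtain ⟨x, hx, hγ⟩ := (hC p).1 ⟨hp, h0⟩
    rw [← hγ] at he ⊢
    exact ⟨x, hx, u, v, he, rfl⟩

/-- The spins of a smooth family of tangles are isotopic. -/
theorem smoothlyIsotopic (h : IsBallTangle γ c ρ) {C C' : Set (Sph 3)}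
    (hC : ∀ p : Sph 3, (p ∈ C ∧ 0 ≤ ρ 0 + inner ℝ (c 0) p.1) ↔
      ∃ x ∈ Set.Icc (-1 : ℝ) 1, γ (0, x) = p.1)
    (hC' : ∀ p : Sph 3, (p ∈ C' ∧ 0 ≤ ρ 1 + inner ℝ (c 1) p.1) ↔
      ∃ x ∈ Set.Icc (-1 : ℝ) 1, γ (1, x) = p.1) :
    SmoothlyIsotopic 2 (ballSpin C (c 0) (ρ 0)) (ballSpin C' (c 1) (ρ 1)) := by
  have h1 := h.isRevolutionEmbedding.smoothlyIsotopic h.isProfile_spin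
  rwa [h.revolutionImage_eq 0 hC, h.revolutionImage_eq 1 hC'] at h1

end IsBallTangle

/-! ### Families of closed curves and round balls -/

theorem contDiff_deriv_snd {L : ℝ × ℝ → ℝ} (hL : ContDiff ℝ ∞ L) :
    ContDiff ℝ ∞ fun p : ℝ × ℝ => deriv (fun s => L (p.1, s)) p.2 := by
  have h : (fun p : ℝ × ℝ => deriv (fun s => L (p.1, s)) p.2) = fun p => fderiv ℝ L p (0, 1) := by
    ext1 p
    have h1 : HasDerivAt (fun s : ℝ => (p.1, s)) ((0 : ℝ), (1 : ℝ)) p.2 :=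
      (hasDerivAt_const _ _).prodMk (hasDerivAt_id _)
    exact ((hL.differentiable (by simp) p).hasFDerivAt.comp_hasDerivAt p.2 h1).deriv
  rw [h]
  exact (hL.fderiv_right (m := ∞) (by simp)).clm_apply contDiff_const

/-- A family of zeros of `L_t`, unique among those at which `L_t` increases, is smooth. -/
theorem contDiffOn_zero_of_deriv_pos {L : ℝ × ℝ → ℝ} (hL : ContDiff ℝ ∞ L) {S U : Set ℝ}
    (hU : IsOpen U) {a : ℝ → ℝ} (haU : ∀ t ∈ S, a t ∈ U) (ha : ∀ t ∈ S, L (t, a t) = 0)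
    (hd : ∀ t ∈ S, 0 < deriv (fun s => L (t, s)) (a t))
    (huniq : ∀ t ∈ S, ∀ s ∈ U, L (t, s) = 0 → 0 < deriv (fun s => L (t, s)) s → s = a t) :
    ContDiffOn ℝ ∞ a S := by
  intro t₀ ht₀
  -- Implicit function theorem by inverting `(t, s) ↦ (t, L (t, s))`. The resulting smooth branch of
  -- zeros stays in `U` with positive slope, so uniqueness identifies it with the possibly arbitrary
  -- choice `a`.
  set F : ℝ × ℝ → ℝ × ℝ := fun p => (p.1, L p) with hF
  have hFs : ContDiff ℝ ∞ F := contDiff_fst.prodMk hL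
  set p₀ : ℝ × ℝ := (t₀, a t₀) with hp₀
  have hFd : HasFDerivAt F ((ContinuousLinearMap.fst ℝ ℝ ℝ).prod (fderiv ℝ L p₀)) p₀ :=
    hasFDerivAt_fst.prodMk (hL.differentiable (by simp) p₀).hasFDerivAt
  have hpart : fderiv ℝ L p₀ (0, 1) = deriv (fun s => L (t₀, s)) (a t₀) := by
    have h1 : HasDerivAt (fun s : ℝ => (t₀, s)) ((0 : ℝ), (1 : ℝ)) (a t₀) :=
      (hasDerivAt_const _ _).prodMk (hasDerivAt_id _)
    exact ((hL.differentiable (by simp) p₀).hasFDerivAt.comp_hasDerivAt (a t₀) h1).deriv.symm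
  have hinj : Function.Injective ((ContinuousLinearMap.fst ℝ ℝ ℝ).prod (fderiv ℝ L p₀)) := by
    rw [injective_iff_map_eq_zero]
    rintro ⟨τ, σ⟩ h
    have h1 : τ = 0 := congrArg Prod.fst h
    have h2 : fderiv ℝ L p₀ (τ, σ) = 0 := congrArg Prod.snd h
    have h3 : ((0 : ℝ), σ) = σ • ((0 : ℝ), (1 : ℝ)) := by simp
    rw [h1, h3, map_smul, hpart, smul_eq_mul] at h2
    rw [h1, (mul_eq_zero.1 h2).resolve_right (hd t₀ ht₀).ne']
    rfl
  let e : (ℝ × ℝ) ≃L[ℝ] (ℝ × ℝ) := (LinearEquiv.ofInjectiveEndo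
    ((ContinuousLinearMap.fst ℝ ℝ ℝ).prod (fderiv ℝ L p₀)).toLinearMap
      hinj).toContinuousLinearEquiv
  have he : HasFDerivAt F (e : (ℝ × ℝ) →L[ℝ] (ℝ × ℝ)) p₀ := by
    refine hFd.congr_fderiv ?_
    apply ContinuousLinearMap.ext
    intro v
    rfl
  have hFa := hFs.contDiffAt (x := p₀)
  have hG : ContDiffAt ℝ ∞ (hFa.localInverse he (by simp)) (F p₀) := hFa.to_localInverse he (by simp)
  have hGp : hFa.localInverse he (by simp) (F p₀) = p₀ := hFa.localInverse_apply_image he (by simp)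
  have hright := (hFa.hasStrictFDerivAt' he (by simp)).eventually_right_inverse
  set G := hFa.localInverse he (by simp) with hGdef
  have hFp : F p₀ = (t₀, 0) := by simp only [hF, hp₀, ha t₀ ht₀]
  rw [hFp] at hG hGp hright
  have hι : ContDiffAt ℝ ∞ (fun t : ℝ => (t, (0 : ℝ))) t₀ := by fun_prop
  have hGι : ContDiffAt ℝ ∞ (fun t : ℝ => (G (t, 0)).2) t₀ :=
    contDiffAt_snd.comp t₀ (hG.comp t₀ hι)
  have hcont : Filter.Tendsto (fun t : ℝ => G (t, 0)) (𝓝 t₀) (𝓝 p₀) := by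
    have h1 := (hG.comp t₀ hι).continuousAt.tendsto
    simp only [Function.comp_def, hGp] at h1
    exact h1
  have e1 : ∀ᶠ t in 𝓝 t₀, F (G (t, 0)) = (t, 0) := hι.continuousAt.eventually hright
  have e2 : ∀ᶠ t in 𝓝 t₀, (G (t, 0)).2 ∈ U :=
    ((continuous_snd.tendsto p₀).comp hcont).eventually (hU.mem_nhds (haU t₀ ht₀))
  have e3 : ∀ᶠ t in 𝓝 t₀, 0 < deriv (fun s => L ((G (t, 0)).1, s)) (G (t, 0)).2 :=
    ((contDiff_deriv_snd hL).continuous.tendsto p₀ |>.comp hcont).eventually_const_lt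
      (hd t₀ ht₀)
  refine hGι.contDiffWithinAt.congr_of_eventuallyEq_of_mem ?_ ht₀
  filter_upwards [nhdsWithin_le_nhds e1, nhdsWithin_le_nhds e2, nhdsWithin_le_nhds e3,
    self_mem_nhdsWithin] with t h1 h2 h3 h4
  have h5 : (G (t, 0)).1 = t := congrArg Prod.fst h1
  have h6 : L (G (t, 0)) = 0 := congrArg Prod.snd h1
  rw [h5] at h3
  refine (huniq t h4 _ h2 ?_ h3).symm
  have h7 : (t, (G (t, 0)).2) = G (t, 0) := Prod.ext h5.symm rfl
  rw [h7, h6]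

/-- Isotopies are smooth in all real times, whereas the boundary parameters are controlled only for
times in `[0, 1]`. Replacing `t` by its smooth step keeps the time in that interval and preserves
both ends. -/
theorem ContDiffOn.comp_smoothTransition {E : Type*} [NormedAddCommGroup E] [NormedSpace ℝ E]
    {f : ℝ → E} (hf : ContDiffOn ℝ ∞ f (Set.Icc 0 1)) :
    ContDiff ℝ ∞ fun t => f (Real.smoothTransition t) :=
  contDiffOn_univ.1 (hf.comp Real.smoothTransition.contDiff.contDiffOn
    fun t _ => smoothTransition_mem_Icc t)

/-- A smooth family of closed curves `Γ_t` in `S^3` of period `P` and of round balls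
`{p | ρ_t + ⟪c_t, p⟫ ≤ 0}` such that, for `t ∈ [0, 1]`, the curve leaves the ball at the parameter
`a t` and enters it at `b t`. -/
structure IsBallFamily (P : ℝ) (Γ : ℝ × ℝ → EuclideanSpace ℝ (Fin 4))
    (c : ℝ → EuclideanSpace ℝ (Fin 4)) (ρ a b : ℝ → ℝ) : Prop where
  smooth : ContDiff ℝ ∞ Γ
  norm_eq : ∀ p, ‖Γ p‖ = 1
  smooth_center : ContDiff ℝ ∞ c
  smooth_radius : ContDiff ℝ ∞ ρ
  center_ne_zero : ∀ t ∈ Set.Icc (0 : ℝ) 1, c t ≠ 0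
  radius_lt : ∀ t ∈ Set.Icc (0 : ℝ) 1, |ρ t| < ‖c t‖
  inj : ∀ t ∈ Set.Icc (0 : ℝ) 1, ∀ s ∈ Set.Ioo (0 : ℝ) P, ∀ s' ∈ Set.Ioo (0 : ℝ) P,
    Γ (t, s) = Γ (t, s') → s = s'
  imm : ∀ t ∈ Set.Icc (0 : ℝ) 1, ∀ s, deriv (fun s => Γ (t, s)) s ≠ 0
  pos_left : ∀ t ∈ Set.Icc (0 : ℝ) 1, 0 < a t
  lt : ∀ t ∈ Set.Icc (0 : ℝ) 1, a t < b t
  lt_right : ∀ t ∈ Set.Icc (0 : ℝ) 1, b t < P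
  zero_left : ∀ t ∈ Set.Icc (0 : ℝ) 1, ρ t + inner ℝ (c t) (Γ (t, a t)) = 0
  zero_right : ∀ t ∈ Set.Icc (0 : ℝ) 1, ρ t + inner ℝ (c t) (Γ (t, b t)) = 0
  deriv_left : ∀ t ∈ Set.Icc (0 : ℝ) 1,
    0 < deriv (fun s => ρ t + inner ℝ (c t) (Γ (t, s))) (a t)
  deriv_right : ∀ t ∈ Set.Icc (0 : ℝ) 1,
    deriv (fun s => ρ t + inner ℝ (c t) (Γ (t, s))) (b t) < 0
  pos : ∀ t ∈ Set.Icc (0 : ℝ) 1, ∀ s ∈ Set.Ioo (a t) (b t), 0 < ρ t + inner ℝ (c t) (Γ (t, s))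
  neg : ∀ t ∈ Set.Icc (0 : ℝ) 1, ∀ s ∈ Set.Icc (0 : ℝ) P, s ∉ Set.Icc (a t) (b t) →
    ρ t + inner ℝ (c t) (Γ (t, s)) < 0

namespace IsBallFamily

variable {P : ℝ} {Γ : ℝ × ℝ → EuclideanSpace ℝ (Fin 4)} {c : ℝ → EuclideanSpace ℝ (Fin 4)}
  {ρ a b : ℝ → ℝ}

theorem contDiff_height (h : IsBallFamily P Γ c ρ a b) :
    ContDiff ℝ ∞ fun p : ℝ × ℝ => ρ p.1 + inner ℝ (c p.1) (Γ p) :=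
  (h.smooth_radius.comp contDiff_fst).add ((h.smooth_center.comp contDiff_fst).inner ℝ h.smooth)

theorem zeros (h : IsBallFamily P Γ c ρ a b) {t : ℝ} (ht : t ∈ Set.Icc (0 : ℝ) 1) {s : ℝ}
    (hs : s ∈ Set.Ioo 0 P) (h0 : ρ t + inner ℝ (c t) (Γ (t, s)) = 0) : s = a t ∨ s = b t := by
  by_contra hne
  rw [not_or] at hne
  by_cases hI : s ∈ Set.Icc (a t) (b t)
  · have := h.pos t ht s ⟨lt_of_le_of_ne hI.1 (Ne.symm hne.1), lt_of_le_of_ne hI.2 hne.2⟩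
    linarith
  · have := h.neg t ht s (Set.Ioo_subset_Icc_self hs) hI
    linarith

theorem contDiffOn_left (h : IsBallFamily P Γ c ρ a b) : ContDiffOn ℝ ∞ a (Set.Icc 0 1) := by
  refine contDiffOn_zero_of_deriv_pos h.contDiff_height (isOpen_Ioo (a := 0) (b := P))
    (fun t ht => ⟨h.pos_left t ht, (h.lt t ht).trans (h.lt_right t ht)⟩) h.zero_left h.deriv_left ?_
  intro t ht s hs h0 hd
  rcases h.zeros ht hs h0 with h1 | h1
  · exact h1
  · rw [h1] at hd
    exact absurd (h.deriv_right t ht) (not_lt.2 hd.le)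

theorem contDiffOn_right (h : IsBallFamily P Γ c ρ a b) : ContDiffOn ℝ ∞ b (Set.Icc 0 1) := by
  refine contDiffOn_zero_of_deriv_pos h.contDiff_height.neg (isOpen_Ioo (a := 0) (b := P))
    (fun t ht => ⟨(h.pos_left t ht).trans (h.lt t ht), h.lt_right t ht⟩) ?_ ?_ ?_
  · intro t ht
    rw [h.zero_right t ht, neg_zero]
  · intro t ht
    rw [deriv.fun_neg]
    linarith [h.deriv_right t ht]
  · intro t ht s hs h0 hd
    rw [deriv.fun_neg] at hd
    rcases h.zeros ht hs (by linarith) with h1 | h1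
    · rw [h1] at hd
      exact absurd (h.deriv_left t ht) (by linarith)
    · exact h1

/-- The parameter in `[a, b]` that corresponds to `x ∈ [-1, 1]`. -/
def param (a b x : ℝ) : ℝ := ((1 - x) * a + (1 + x) * b) / 2

theorem hasDerivAt_param (a b x : ℝ) : HasDerivAt (param a b) ((b - a) / 2) x := by
  have := ((((hasDerivAt_id x).const_sub 1).mul_const a).add
    (((hasDerivAt_id x).const_add 1).mul_const b)).div_const 2
  refine this.congr_deriv ?_
  ring

/-- Dividing center and radius parameter by `‖c‖` leaves each ball unchanged and makes the center a
unit vector. The part of the curve outside the ball is rescaled to `[-1, 1]`; the strict crossing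
slopes at `a` and `b` become the simple zeros required of a profile. -/
theorem isBallTangle (h : IsBallFamily P Γ c ρ a b) :
    IsBallTangle
      (fun p => Γ (Real.smoothTransition p.1, param (a (Real.smoothTransition p.1))
        (b (Real.smoothTransition p.1)) p.2))
      (fun t => ‖c (Real.smoothTransition t)‖⁻¹ • c (Real.smoothTransition t))
      (fun t => ‖c (Real.smoothTransition t)‖⁻¹ * ρ (Real.smoothTransition t)) := by
  have hχ : ContDiff ℝ ∞ Real.smoothTransition := Real.smoothTransition.contDiff
  have hmem := smoothTransition_mem_Icc
  have hN : ∀ t, 0 < ‖c (Real.smoothTransition t)‖ := fun t =>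
    norm_pos_iff.2 (h.center_ne_zero _ (hmem t))
  have hcs : ContDiff ℝ ∞ fun t => c (Real.smoothTransition t) := h.smooth_center.comp hχ
  have hNs : ContDiff ℝ ∞ fun t => ‖c (Real.smoothTransition t)‖⁻¹ :=
    (hcs.norm ℝ fun t => h.center_ne_zero _ (hmem t)).inv fun t => (hN t).ne'
  have hρs : ContDiff ℝ ∞ fun t => ρ (Real.smoothTransition t) := h.smooth_radius.comp hχ
  have ha := h.contDiffOn_left.comp_smoothTransition
  have hb := h.contDiffOn_right.comp_smoothTransition
  have hχ1 : ContDiff ℝ ∞ fun p : ℝ × ℝ => Real.smoothTransition p.1 := hχ.comp contDiff_fst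
  have ha1 : ContDiff ℝ ∞ fun p : ℝ × ℝ => a (Real.smoothTransition p.1) := ha.comp contDiff_fst
  have hb1 : ContDiff ℝ ∞ fun p : ℝ × ℝ => b (Real.smoothTransition p.1) := hb.comp contDiff_fst
  have hΓs : ContDiff ℝ ∞ fun p : ℝ × ℝ => Γ (Real.smoothTransition p.1,
      param (a (Real.smoothTransition p.1)) (b (Real.smoothTransition p.1)) p.2) := by
    apply h.smooth.comp
    apply hχ1.prodMk
    exact (((contDiff_const.sub contDiff_snd).mul ha1).add
      ((contDiff_const.add contDiff_snd).mul hb1)).div_const 2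
  have habs : ∀ t, |‖c (Real.smoothTransition t)‖⁻¹ * ρ (Real.smoothTransition t)| < 1 := by
    intro t
    rw [abs_mul, abs_of_pos (inv_pos.2 (hN t)), inv_mul_lt_one₀ (hN t)]
    exact h.radius_lt _ (hmem t)
  have hval : ∀ t x, ‖c (Real.smoothTransition t)‖⁻¹ * ρ (Real.smoothTransition t) +
      inner ℝ (‖c (Real.smoothTransition t)‖⁻¹ • c (Real.smoothTransition t)) x =
      ‖c (Real.smoothTransition t)‖⁻¹ *
        (ρ (Real.smoothTransition t) + inner ℝ (c (Real.smoothTransition t)) x) := by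
    intro t x
    rw [real_inner_smul_left]
    ring
  have hder : ∀ t x, deriv (fun x => ρ t + inner ℝ (c t) (Γ (t, param (a t) (b t) x))) x =
      deriv (fun s => ρ t + inner ℝ (c t) (Γ (t, s))) (param (a t) (b t) x) * ((b t - a t) / 2) := by
    intro t x
    have h1 : DifferentiableAt ℝ (fun s => ρ t + inner ℝ (c t) (Γ (t, s)))
        (param (a t) (b t) x) :=
      (h.contDiff_height.comp (contDiff_const.prodMk contDiff_id)).differentiable (by simp) _
    exact (h1.hasDerivAt.comp x (hasDerivAt_param (a t) (b t) x)).deriv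
  have hp1 : ∀ a b : ℝ, param a b 1 = b := fun a b => by unfold param; ring
  have hp2 : ∀ a b : ℝ, param a b (-1) = a := fun a b => by unfold param; ring
  have hsub : ∀ t ∈ Set.Icc (0 : ℝ) 1, ∀ x ∈ Set.Icc (-1 : ℝ) 1,
      param (a t) (b t) x ∈ Set.Ioo 0 P := by
    intro t ht x hx
    have := h.pos_left t ht
    have := h.lt t ht
    have := h.lt_right t ht
    unfold param
    constructor <;> nlinarith [hx.1, hx.2]
  refine ⟨hΓs, fun p => h.norm_eq _, hNs.smul hcs, ?_, hNs.mul hρs, fun t => (abs_lt.1 (habs t)).1,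
    fun t => (abs_lt.1 (habs t)).2, ?_, ?_, ?_⟩
  · intro t
    rw [norm_smul, norm_inv, norm_norm, inv_mul_cancel₀ (hN t).ne']
  · have heq : (fun p : ℝ × ℝ =>
        ‖c (Real.smoothTransition p.1)‖⁻¹ * ρ (Real.smoothTransition p.1) +
        inner ℝ (‖c (Real.smoothTransition p.1)‖⁻¹ • c (Real.smoothTransition p.1))
        (Γ (Real.smoothTransition p.1, param (a (Real.smoothTransition p.1))
        (b (Real.smoothTransition p.1)) p.2))) = fun p =>
        ‖c (Real.smoothTransition p.1)‖⁻¹ * (ρ (Real.smoothTransition p.1) +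
        inner ℝ (c (Real.smoothTransition p.1))
        (Γ (Real.smoothTransition p.1, param (a (Real.smoothTransition p.1))
        (b (Real.smoothTransition p.1)) p.2))) := funext fun p => hval _ _
    rw [heq]
    refine ⟨?_, ?_, ?_, ?_, ?_, ?_⟩
    · exact (hNs.comp contDiff_fst).mul ((hρs.comp contDiff_fst).add
        ((hcs.comp contDiff_fst).inner ℝ hΓs))
    · intro t
      simp only [hp1, h.zero_right _ (hmem t), mul_zero]
    · intro t
      simp only [hp2, h.zero_left _ (hmem t), mul_zero]
    · intro t x hx
      apply mul_pos (inv_pos.2 (hN t))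
      apply h.pos _ (hmem t)
      have := h.lt _ (hmem t)
      unfold param
      constructor <;> nlinarith [hx.1, hx.2]
    · intro t
      simp only
      rw [deriv_const_mul_field, hder, hp1]
      have h1 := h.deriv_right _ (hmem t)
      have h2 := h.lt _ (hmem t)
      exact mul_ne_zero (inv_pos.2 (hN t)).ne' (mul_ne_zero h1.ne (by linarith))
    · intro t
      simp only
      rw [deriv_const_mul_field, hder, hp2]
      have h1 := h.deriv_left _ (hmem t)
      have h2 := h.lt _ (hmem t)
      exact mul_ne_zero (inv_pos.2 (hN t)).ne' (mul_ne_zero h1.ne' (by linarith))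
  · intro t _ x hx y hy he
    have h1 := h.inj _ (hmem t) _ (hsub _ (hmem t) x hx) _ (hsub _ (hmem t) y hy) he
    have h2 := h.lt _ (hmem t)
    unfold param at h1
    have h3 : (x - y) * (b (Real.smoothTransition t) - a (Real.smoothTransition t)) = 0 := by
      linarith
    linarith [(mul_eq_zero.1 h3).resolve_right (by linarith)]
  · intro t _ x hx
    have h1 : DifferentiableAt ℝ (fun s => Γ (Real.smoothTransition t, s))
        (param (a (Real.smoothTransition t)) (b (Real.smoothTransition t)) x) :=
      (h.smooth.comp (contDiff_const.prodMk contDiff_id)).differentiable (by simp) _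
    have h2 := (h1.hasDerivAt.scomp x (hasDerivAt_param _ _ x)).deriv
    have h3 := h.lt _ (hmem t)
    have h4 : (b (Real.smoothTransition t) - a (Real.smoothTransition t)) / 2 ≠ 0 := by linarith
    exact fun h0 => smul_ne_zero h4 (h.imm _ (hmem t) _) (h2.symm.trans h0)

/-- The spins of the closed curves of the family are isotopic. -/
theorem smoothlyIsotopic (h : IsBallFamily P Γ c ρ a b) {C C' : Set (Sph 3)}
    (hC : ∀ p : Sph 3, p ∈ C ↔ ∃ s ∈ Set.Icc (0 : ℝ) P, Γ (0, s) = p.1)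
    (hC' : ∀ p : Sph 3, p ∈ C' ↔ ∃ s ∈ Set.Icc (0 : ℝ) P, Γ (1, s) = p.1)
    (h0 : ‖c 0‖ = 1) (h1 : ‖c 1‖ = 1) :
    SmoothlyIsotopic 2 (ballSpin C (c 0) (ρ 0)) (ballSpin C' (c 1) (ρ 1)) := by
  have key : ∀ t ∈ Set.Icc (0 : ℝ) 1, ∀ C : Set (Sph 3),
      (∀ p : Sph 3, p ∈ C ↔ ∃ s ∈ Set.Icc (0 : ℝ) P, Γ (t, s) = p.1) → ∀ p : Sph 3,
      (p ∈ C ∧ 0 ≤ ρ t + inner ℝ (c t) p.1) ↔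
      ∃ x ∈ Set.Icc (-1 : ℝ) 1, Γ (t, param (a t) (b t) x) = p.1 := by
    intro t ht C hC p
    have hlt := h.lt t ht
    have hl := h.pos_left t ht
    have hr := h.lt_right t ht
    rw [hC]
    constructor
    · rintro ⟨⟨s, hs, hp⟩, hpos⟩
      rw [← hp] at hpos
      have hI : s ∈ Set.Icc (a t) (b t) := by
        by_contra hI
        linarith [h.neg t ht s hs hI]
      have hba : 0 < b t - a t := by linarith
      refine ⟨(2 * s - a t - b t) / (b t - a t), ⟨?_, ?_⟩, ?_⟩
      · rw [le_div_iff₀ hba]; linarith [hI.1]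
      · rw [div_le_iff₀ hba]; linarith [hI.2]
      · rw [← hp]
        congr 2
        unfold param
        field_simp
        ring
    · rintro ⟨x, hx, hp⟩
      have hI : param (a t) (b t) x ∈ Set.Icc (a t) (b t) := by
        unfold param
        constructor <;> nlinarith [hx.1, hx.2]
      refine ⟨⟨_, ⟨by linarith [hI.1], by linarith [hI.2]⟩, hp⟩, ?_⟩
      rw [← hp]
      rcases eq_or_lt_of_le hI.1 with h2 | h2
      · rw [← h2, h.zero_left t ht]
      · rcases eq_or_lt_of_le hI.2 with h3 | h3
        · rw [h3, h.zero_right t ht]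
        · exact (h.pos t ht _ ⟨h2, h3⟩).le
  have hχ0 : Real.smoothTransition 0 = 0 := Real.smoothTransition.zero_of_nonpos le_rfl
  have hχ1 : Real.smoothTransition 1 = 1 := Real.smoothTransition.one_of_one_le le_rfl
  have hmain := h.isBallTangle.smoothlyIsotopic (C := C) (C' := C')
  simp only [hχ0, hχ1, h0, h1, inv_one, one_smul, one_mul] at hmain
  exact hmain (key 0 (by simp) C hC) (key 1 (by simp) C' hC')

end IsBallFamily

/-! ### The spin of a tangle in the ball model -/

theorem invStereo_vec3 (a b c : ℝ) : (invStereo !₂[a, b, c]).1 =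
    !₂[2 * a / (a ^ 2 + b ^ 2 + c ^ 2 + 1), 2 * b / (a ^ 2 + b ^ 2 + c ^ 2 + 1),
      2 * c / (a ^ 2 + b ^ 2 + c ^ 2 + 1),
      (a ^ 2 + b ^ 2 + c ^ 2 - 1) / (a ^ 2 + b ^ 2 + c ^ 2 + 1)] := by
  rw [← norm_sq_vec3]
  ext i
  fin_cases i <;> rfl

namespace ClosedTangle

variable (T : ClosedTangle)

/-- The closure of the tangle as a parametrized curve in `ℝ^4`. -/
def curve (s : ℝ) : EuclideanSpace ℝ (Fin 4) := (invStereo !₂[T.h s, T.y s, T.z s]).1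

/-- The denominator in the coordinates of `T.curve`. -/
def den (s : ℝ) : ℝ := T.h s ^ 2 + T.y s ^ 2 + T.z s ^ 2 + 1

theorem den_pos (s : ℝ) : 0 < T.den s := by unfold den; positivity

theorem curve_eq (s : ℝ) : T.curve s = !₂[2 * T.h s / T.den s, 2 * T.y s / T.den s,
    2 * T.z s / T.den s, (T.h s ^ 2 + T.y s ^ 2 + T.z s ^ 2 - 1) / T.den s] :=
  invStereo_vec3 _ _ _

theorem curve_apply (s : ℝ) : T.curve s 0 = 2 * T.h s / T.den s ∧
    T.curve s 1 = 2 * T.y s / T.den s ∧ T.curve s 2 = 2 * T.z s / T.den s ∧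
    T.curve s 3 = (T.h s ^ 2 + T.y s ^ 2 + T.z s ^ 2 - 1) / T.den s := by
  rw [T.curve_eq]
  exact ⟨rfl, rfl, rfl, rfl⟩

theorem mem_closure_iff (p : Sph 3) : p ∈ T.closure ↔ ∃ s, T.curve s = p.1 :=
  ⟨fun ⟨s, hs⟩ => ⟨s, by rw [hs]; rfl⟩, fun ⟨s, hs⟩ => ⟨s, Subtype.ext hs.symm⟩⟩

theorem exists_mem_Ico (s : ℝ) :
    ∃ s' ∈ Set.Ico (0 : ℝ) 2, T.h s = T.h s' ∧ T.y s = T.y s' ∧ T.z s = T.z s' := by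
  have hp : Function.Periodic (fun s => (T.h s, T.y s, T.z s)) 2 := fun s => by
    simp only [T.periodic_h s, T.periodic_y s, T.periodic_z s]
  obtain ⟨s', hs', h⟩ := hp.exists_mem_Ico₀ (by norm_num) s
  simp only [Prod.mk.injEq] at h
  exact ⟨s', hs', h⟩

theorem exists_mem_Icc_of_h_nonneg {s : ℝ} (h : 0 ≤ T.h s) :
    ∃ s' ∈ Set.Icc (0 : ℝ) 1, T.h s = T.h s' ∧ T.y s = T.y s' ∧ T.z s = T.z s' := by
  obtain ⟨s', hs', h1, h2, h3⟩ := T.exists_mem_Ico s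
  refine ⟨s', ⟨hs'.1, ?_⟩, h1, h2, h3⟩
  by_contra hlt
  have := T.arc_neg s' ⟨not_le.1 hlt, hs'.2⟩
  linarith

/-- The isotopy from the half-space model to the ball model of the spin. -/
def modelMap (p : ℝ × ℝ × ℝ × ℝ) : EuclideanSpace ℝ (Fin 4) :=
  let χ := Real.smoothTransition p.1
  let s := (1 + p.2.1) / 2
  let u := p.2.2.1
  let v := p.2.2.2
  let d := 1 + χ * (u ^ 2 + v ^ 2)
  let k := √(1 + χ * ((T.y s / d) ^ 2 + (T.z s / d) ^ 2))
  !₂[u * k, v * k, T.y s / d, T.z s / d]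

theorem one_add_smoothTransition_mul_pos (t a b : ℝ) :
    0 < 1 + Real.smoothTransition t * (a ^ 2 + b ^ 2) := by
  have := Real.smoothTransition.nonneg t
  positivity

theorem contDiff_modelMap : ContDiff ℝ ∞ T.modelMap := by
  have hχ : ContDiff ℝ ∞ fun p : ℝ × ℝ × ℝ × ℝ => Real.smoothTransition p.1 :=
    Real.smoothTransition.contDiff.comp contDiff_fst
  have hd : ContDiff ℝ ∞ fun p : ℝ × ℝ × ℝ × ℝ =>
      1 + Real.smoothTransition p.1 * (p.2.2.1 ^ 2 + p.2.2.2 ^ 2) :=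
    contDiff_const.add (hχ.mul (by fun_prop))
  have hd0 : ∀ p : ℝ × ℝ × ℝ × ℝ,
      1 + Real.smoothTransition p.1 * (p.2.2.1 ^ 2 + p.2.2.2 ^ 2) ≠ 0 :=
    fun p => (one_add_smoothTransition_mul_pos _ _ _).ne'
  have hy : ContDiff ℝ ∞ fun p : ℝ × ℝ × ℝ × ℝ => T.y ((1 + p.2.1) / 2) /
      (1 + Real.smoothTransition p.1 * (p.2.2.1 ^ 2 + p.2.2.2 ^ 2)) :=
    (T.smooth_y.comp (by fun_prop)).div hd hd0
  have hz : ContDiff ℝ ∞ fun p : ℝ × ℝ × ℝ × ℝ => T.z ((1 + p.2.1) / 2) /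
      (1 + Real.smoothTransition p.1 * (p.2.2.1 ^ 2 + p.2.2.2 ^ 2)) :=
    (T.smooth_z.comp (by fun_prop)).div hd hd0
  have hk := (contDiff_const (c := (1 : ℝ)).add (hχ.mul ((hy.pow 2).add (hz.pow 2)))).sqrt
    fun p => (one_add_smoothTransition_mul_pos _ _ _).ne'
  have hu : ContDiff ℝ ∞ fun p : ℝ × ℝ × ℝ × ℝ => p.2.2.1 := by fun_prop
  have hv : ContDiff ℝ ∞ fun p : ℝ × ℝ × ℝ × ℝ => p.2.2.2 := by fun_prop
  rw [contDiff_euclidean]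
  intro i
  fin_cases i
  · exact hu.mul hk
  · exact hv.mul hk
  · exact hy
  · exact hz

/-- The last two coordinates determine the factor `k`, hence `u` and `v`, hence `d` and the height
`u² + v²`, hence all three coordinates of the tangle point. The immersion property follows by the
same chain for derivatives. -/
theorem isRevolutionEmbedding_modelMap :
    IsRevolutionEmbedding T.profile (fun p => stereoLift (T.modelMap p)) := by
  apply isRevolutionEmbedding_stereoLift T.contDiff_modelMap
  · intro t _ c hc u v h c' hc' u' v' h' he
    have e0 := congrArg (fun x => x 0) he
    have e1 := congrArg (fun x => x 1) he
    have e2 := congrArg (fun x => x 2) he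
    have e3 := congrArg (fun x => x 3) he
    simp [modelMap] at e0 e1 e2 e3
    rw [e2, e3] at e0 e1
    have hk := Real.sqrt_pos.2 (one_add_smoothTransition_mul_pos t
      (T.y ((1 + c') / 2) / (1 + Real.smoothTransition t * (u' ^ 2 + v' ^ 2)))
      (T.z ((1 + c') / 2) / (1 + Real.smoothTransition t * (u' ^ 2 + v' ^ 2))))
    have hu := mul_right_cancel₀ hk.ne' e0
    have hv := mul_right_cancel₀ hk.ne' e1
    subst hu hv
    have hd := (one_add_smoothTransition_mul_pos t u v).ne'
    rw [div_left_inj' hd] at e2 e3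
    have := T.eq_of_coords_eq (half_mem hc) (half_mem hc') (h.symm.trans h') e2 e3
    exact ⟨by linarith, rfl, rfl⟩
  · intro t _ c hc u v h c' u' v' hℓ hd
    rw [hasDerivAt_euclidean_coord] at hd
    set χ := Real.smoothTransition t with hχ
    have hline : ∀ f : ℝ → ℝ, Differentiable ℝ f → HasDerivAt
        (fun r : ℝ => f ((1 + (c + r * c')) / 2)) (deriv f ((1 + c) / 2) * (c' / 2)) 0 := by
      intro f hf
      have h1 := hasDerivAt_comp_line hf ((1 + c) / 2) (c' / 2)
      refine h1.congr_of_eventuallyEq (Filter.Eventually.of_forall fun r => ?_)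
      simp only
      congr 1
      ring
    have hu := hasDerivAt_line u u'
    have hv := hasDerivAt_line v v'
    have hY1 : HasDerivAt (fun r : ℝ => T.y ((1 + (c + r * c')) / 2) /
        (1 + χ * ((u + r * u') ^ 2 + (v + r * v') ^ 2))) 0 0 := hd 2
    have hY2 : HasDerivAt (fun r : ℝ => T.z ((1 + (c + r * c')) / 2) /
        (1 + χ * ((u + r * u') ^ 2 + (v + r * v') ^ 2))) 0 0 := hd 3
    have hdpos : ∀ r : ℝ, 1 + χ * ((u + r * u') ^ 2 + (v + r * v') ^ 2) ≠ 0 := fun r =>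
      (one_add_smoothTransition_mul_pos _ _ _).ne'
    set Y1 : ℝ → ℝ := fun r => T.y ((1 + (c + r * c')) / 2) /
        (1 + χ * ((u + r * u') ^ 2 + (v + r * v') ^ 2)) with hY1def
    set Y2 : ℝ → ℝ := fun r => T.z ((1 + (c + r * c')) / 2) /
        (1 + χ * ((u + r * u') ^ 2 + (v + r * v') ^ 2)) with hY2def
    have hkpos : ∀ r, 0 < 1 + χ * (Y1 r ^ 2 + Y2 r ^ 2) := fun r =>
      one_add_smoothTransition_mul_pos _ _ _
    have hk : HasDerivAt (fun r => √(1 + χ * (Y1 r ^ 2 + Y2 r ^ 2))) 0 0 := by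
      have h1 : HasDerivAt (fun r => 1 + χ * (Y1 r ^ 2 + Y2 r ^ 2)) 0 0 := by
        refine ((((hY1.fun_pow 2).add (hY2.fun_pow 2)).const_mul χ).const_add 1).congr_deriv ?_
        simp
      refine (h1.sqrt (hkpos 0).ne').congr_deriv ?_
      simp
    have hk0 := (Real.sqrt_pos.2 (hkpos 0)).ne'
    have hu0 : u' = 0 := by
      have h1 := (hu.mul hk).unique (hd 0)
      simp only [mul_zero, add_zero] at h1
      exact (mul_eq_zero.1 h1).resolve_right hk0
    have hv0 : v' = 0 := by
      have h1 := (hv.mul hk).unique (hd 1)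
      simp only [mul_zero, add_zero] at h1
      exact (mul_eq_zero.1 h1).resolve_right hk0
    have hD : HasDerivAt (fun r : ℝ => 1 + χ * ((u + r * u') ^ 2 + (v + r * v') ^ 2)) 0 0 := by
      refine ((((hu.fun_pow 2).add (hv.fun_pow 2)).const_mul χ).const_add 1).congr_deriv ?_
      simp [hu0, hv0]
    have hy0 : deriv T.y ((1 + c) / 2) * (c' / 2) = 0 := by
      refine (hline T.y T.differentiable_y).unique (((hY1.mul hD).congr_deriv (by simp)
        ).congr_of_eventuallyEq (Filter.Eventually.of_forall fun r => ?_))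
      exact (div_mul_cancel₀ _ (hdpos r)).symm
    have hz0 : deriv T.z ((1 + c) / 2) * (c' / 2) = 0 := by
      refine (hline T.z T.differentiable_z).unique (((hY2.mul hD).congr_deriv (by simp)
        ).congr_of_eventuallyEq (Filter.Eventually.of_forall fun r => ?_))
      exact (div_mul_cancel₀ _ (hdpos r)).symm
    have hh0 : deriv T.h ((1 + c) / 2) * (c' / 2) = 0 := by
      rw [deriv_profile, hu0, hv0] at hℓ
      linarith
    refine ⟨?_, hu0, hv0⟩
    by_contra hc0
    have hc2 : c' / 2 ≠ 0 := by positivity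
    rcases T.immersion ((1 + c) / 2) with h1 | h1 | h1
    · exact mul_ne_zero h1 hc2 hh0
    · exact mul_ne_zero h1 hc2 hy0
    · exact mul_ne_zero h1 hc2 hz0

theorem revolutionImage_modelMap_zero :
    revolutionImage T.profile (fun p => stereoLift (T.modelMap p)) 0 = T.spin := by
  have hχ0 : Real.smoothTransition 0 = 0 := Real.smoothTransition.zero_of_nonpos le_rfl
  have hmap : ∀ c u v, T.modelMap (0, c, u, v) = !₂[u, v, T.y ((1 + c) / 2), T.z ((1 + c) / 2)] := by
    intro c u v
    simp [modelMap, hχ0]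
  ext p
  constructor
  · rintro ⟨c, hc, u, v, h, rfl⟩
    exact ⟨(1 + c) / 2, half_mem hc, u, v, h, by rw [dirSphere_stereoLift, hmap]⟩
  · rintro ⟨s, hs, u, v, h, rfl⟩
    have hsc : (1 + (2 * s - 1)) / 2 = s := by ring
    exact ⟨2 * s - 1, ⟨by linarith [hs.1], by linarith [hs.2]⟩, u, v, by rw [profile, hsc, h],
      by rw [dirSphere_stereoLift, hmap, hsc]⟩

/-- The scaling factor between the two descriptions of the spin in the ball model. -/
def modelScale (s : ℝ) : ℝ :=
  2 * √(1 + ((T.y s / (1 + T.h s)) ^ 2 + (T.z s / (1 + T.h s)) ^ 2)) * (1 + T.h s) / T.den s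

theorem modelScale_pos {s : ℝ} (h : 0 ≤ T.h s) : 0 < T.modelScale s := by
  have h1 := T.den_pos s
  have h2 : 0 < √(1 + ((T.y s / (1 + T.h s)) ^ 2 + (T.z s / (1 + T.h s)) ^ 2)) :=
    Real.sqrt_pos.2 (by positivity)
  unfold modelScale
  positivity

/-- It rests on `(1 + h)² + y² + z² = den + 2 h`, and it matches the squared radius prescribed in
`ballSpin` at the first coordinate `2 h / den` of the curve. -/
theorem modelScale_sq {s : ℝ} (h : 0 ≤ T.h s) : T.modelScale s ^ 2 * T.h s =
    2 * (2 * T.h s / T.den s) * (1 + 2 * T.h s / T.den s) := by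
  have h1 := (T.den_pos s).ne'
  have h2 : 1 + T.h s ≠ 0 := by positivity
  unfold modelScale
  rw [div_pow, mul_pow, mul_pow, Real.sq_sqrt (by positivity)]
  field_simp
  unfold den
  ring

theorem dirSphere_modelMap_one {s u v : ℝ} (h : u ^ 2 + v ^ 2 = T.h s) :
    dirSphere (stereoLift (T.modelMap (1, 2 * s - 1, u, v))) =
      dirSphere !₂[T.modelScale s * u, T.modelScale s * v, 2 * T.y s / T.den s,
        2 * T.z s / T.den s, (T.h s ^ 2 + T.y s ^ 2 + T.z s ^ 2 - 1) / T.den s] := by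
  have hχ1 : Real.smoothTransition 1 = 1 := Real.smoothTransition.one_of_one_le le_rfl
  have hh : 0 ≤ T.h s := by rw [← h]; positivity
  have h1 := T.den_pos s
  have h2 : 0 < 1 + T.h s := by positivity
  have hsc : (1 + (2 * s - 1)) / 2 = s := by ring
  -- This factor turns the coordinates `2 y / (1 + h)` and `2 z / (1 + h)` of the lift into the
  -- coordinates `2 y / den` and `2 z / den` of the curve in `S^3`.
  rw [← dirSphere_smul (stereoLift_ne_zero _) (r := (1 + T.h s) / T.den s) (by positivity)]
  congr 1
  have hmap : T.modelMap (1, 2 * s - 1, u, v) =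
      !₂[u * √(1 + ((T.y s / (1 + T.h s)) ^ 2 + (T.z s / (1 + T.h s)) ^ 2)),
        v * √(1 + ((T.y s / (1 + T.h s)) ^ 2 + (T.z s / (1 + T.h s)) ^ 2)),
        T.y s / (1 + T.h s), T.z s / (1 + T.h s)] := by
    simp only [modelMap, hχ1, hsc, one_mul, h]
  rw [hmap, stereoLift_vec4, mul_pow, mul_pow, ← add_mul, h, Real.sq_sqrt (by positivity)]
  have h1' := h1.ne'
  have h2' := h2.ne'
  ext i
  fin_cases i
  · simp [modelScale]; ring
  · simp [modelScale]; ring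
  · simp; field_simp
  · simp; field_simp
  · simp
    field_simp
    ring

theorem inner_single_zero (p : EuclideanSpace ℝ (Fin 4)) :
    inner ℝ (EuclideanSpace.single 0 1) p = p 0 := by
  simp [EuclideanSpace.inner_single_left]

theorem conjMul_single_zero (p : EuclideanSpace ℝ (Fin 4)) :
    conjMul (EuclideanSpace.single 0 1) p = p := by
  ext i
  fin_cases i <;> simp [conjMul]

theorem revolutionImage_modelMap_one :
    revolutionImage T.profile (fun p => stereoLift (T.modelMap p)) 1 =
      ballSpin T.closure (EuclideanSpace.single 0 1) 0 := by
  ext P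
  simp only [ballSpin, inner_single_zero, conjMul_single_zero, zero_add, Set.mem_ofPred_eq,
    revolutionImage]
  constructor
  · rintro ⟨c, hc, u, v, h, rfl⟩
    set s := (1 + c) / 2 with hs
    have hcs : c = 2 * s - 1 := by rw [hs]; ring
    have hh : 0 ≤ T.h s := T.h_nonneg (half_mem hc)
    have hd := T.den_pos s
    have h' : u ^ 2 + v ^ 2 = T.h s := h
    obtain ⟨e0, e1, e2, e3⟩ := T.curve_apply s
    refine ⟨⟨T.curve s, (invStereo _).2⟩, (T.mem_closure_iff _).2 ⟨s, rfl⟩, ?_,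
      T.modelScale s * u, T.modelScale s * v, ?_, ?_⟩
    · change 0 ≤ T.curve s 0
      rw [e0]
      positivity
    · change _ = 2 * T.curve s 0 * (1 + T.curve s 0)
      rw [e0, mul_pow, mul_pow, ← mul_add, h', T.modelScale_sq hh]
    · change _ = dirSphere !₂[_, _, T.curve s 1, T.curve s 2, T.curve s 3]
      rw [hcs, T.dirSphere_modelMap_one h', e1, e2, e3]
  · rintro ⟨p, hp, h0, u, v, h, rfl⟩
    obtain ⟨s₀, hs₀⟩ := (T.mem_closure_iff p).1 hp
    have hh₀ : 0 ≤ T.h s₀ := by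
      rw [← hs₀, T.curve_eq] at h0
      simp at h0
      have := T.den_pos s₀
      by_contra hneg
      have : 2 * T.h s₀ / T.den s₀ < 0 := div_neg_of_neg_of_pos (by linarith) this
      linarith
    obtain ⟨s, hs, e1, e2, e3⟩ := T.exists_mem_Icc_of_h_nonneg hh₀
    have hps : T.curve s = p.1 := by
      rw [← hs₀]
      simp only [curve, e1, e2, e3]
    have hh := T.h_nonneg hs
    have hm := T.modelScale_pos hh
    rw [← hps, T.curve_eq] at h ⊢
    simp at h ⊢
    have h' : (u / T.modelScale s) ^ 2 + (v / T.modelScale s) ^ 2 = T.h s := by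
      rw [div_pow, div_pow, ← add_div, h, ← T.modelScale_sq hh]
      field_simp
    have hsc : (1 + (2 * s - 1)) / 2 = s := by ring
    refine ⟨2 * s - 1, ⟨by linarith [hs.1], by linarith [hs.2]⟩, u / T.modelScale s, v / T.modelScale s,
      ?_, ?_⟩
    · rw [profile, hsc, h']
    · rw [T.dirSphere_modelMap_one h', mul_div_cancel₀ _ hm.ne', mul_div_cancel₀ _ hm.ne']

theorem spin_isotopic_ballSpin :
    SmoothlyIsotopic 2 T.spin (ballSpin T.closure (EuclideanSpace.single 0 1) 0) := by
  have h := T.isRevolutionEmbedding_modelMap.smoothlyIsotopic T.isProfile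
  rwa [revolutionImage_modelMap_zero, revolutionImage_modelMap_one] at h

end ClosedTangle

namespace ClosedTangle

variable (T : ClosedTangle)

/-! ### The trivial arc of a closed tangle -/

theorem contDiff_den : ContDiff ℝ ∞ T.den :=
  (((T.smooth_h.pow 2).add (T.smooth_y.pow 2)).add (T.smooth_z.pow 2)).add contDiff_const

theorem contDiff_curve : ContDiff ℝ ∞ T.curve := by
  have hd := T.contDiff_den
  have h0 := fun s => (T.den_pos s).ne'
  have hh := T.smooth_h
  have hy := T.smooth_y
  have hz := T.smooth_z
  rw [show T.curve = _ from funext T.curve_eq, contDiff_euclidean]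
  intro i
  fin_cases i
  · exact (contDiff_const.mul hh).div hd h0
  · exact (contDiff_const.mul hy).div hd h0
  · exact (contDiff_const.mul hz).div hd h0
  · exact ((((hh.pow 2).add (hy.pow 2)).add (hz.pow 2)).sub contDiff_const).div hd h0

theorem norm_curve (s : ℝ) : ‖T.curve s‖ = 1 := mem_sphere_zero_iff_norm.1 (invStereo _).2

theorem curve_periodic : Function.Periodic T.curve 2 := fun s => by
  simp only [curve, T.periodic_h s, T.periodic_y s, T.periodic_z s]

theorem eq_add_int_of_curve_eq {s s' : ℝ} (h : T.curve s = T.curve s') :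
    ∃ n : ℤ, s = s' + n * 2 := by
  have hp : (0 : ℝ) < 2 := two_pos
  have hmod : ∀ s, T.curve (toIcoMod hp 0 s) = T.curve s := fun s =>
    (T.curve_periodic.sub_zsmul_eq _ : T.curve (s - toIcoDiv hp 0 s • 2) = T.curve s)
  have hmem : ∀ s, toIcoMod hp 0 s ∈ Set.Ico (0 : ℝ) 2 := fun s => by
    simpa using toIcoMod_mem_Ico hp 0 s
  have h1 : T.curve (toIcoMod hp 0 s) = T.curve (toIcoMod hp 0 s') := by rw [hmod, hmod, h]
  have h2 := invStereo_injective (Subtype.ext h1)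
  have h3 := T.injective _ (hmem s) _ (hmem s') (congrArg (fun v => v 0) h2)
    (congrArg (fun v => v 1) h2) (congrArg (fun v => v 2) h2)
  refine ⟨toIcoDiv hp 0 s - toIcoDiv hp 0 s', ?_⟩
  have e1 := toIcoMod_add_toIcoDiv_zsmul hp 0 s
  have e2 := toIcoMod_add_toIcoDiv_zsmul hp 0 s'
  rw [zsmul_eq_mul] at e1 e2
  push_cast
  linarith

theorem eq_of_curve_eq {s s' : ℝ} (h : T.curve s = T.curve s') (hs : |s - s'| < 2) : s = s' := by
  obtain ⟨n, hn⟩ := T.eq_add_int_of_curve_eq h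
  have h1 : s - s' = n * 2 := by linarith
  rw [h1, abs_mul, abs_two] at hs
  have h2 : |(n : ℝ)| < 1 := by linarith
  have h3 : n = 0 := Int.abs_lt_one_iff.1 (by exact_mod_cast h2)
  rw [h3] at hn
  simpa using hn

/-- If the curve stood still, its stereographic lift `den • curve` would move radially, which
`hasDerivAt_zero_of_stereoLift` excludes for an immersed curve in `ℝ^3`. -/
theorem deriv_curve_ne_zero (s : ℝ) : deriv T.curve s ≠ 0 := by
  intro h0
  have h1 : HasDerivAt T.curve 0 s := by
    rw [← h0]
    exact (T.contDiff_curve.differentiable (by simp) s).hasDerivAt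
  have h2 := (T.contDiff_den.differentiable (by simp) s).hasDerivAt
  have hlift : ∀ s, stereoLift (!₂[T.h s, T.y s, T.z s] : EuclideanSpace ℝ (Fin 3)) =
      T.den s • T.curve s := fun s => by
    rw [stereoLift_eq_smul, norm_sq_vec3]
    rfl
  have h3 : HasDerivAt (fun r => stereoLift (!₂[T.h r, T.y r, T.z r] : EuclideanSpace ℝ (Fin 3)))
      ((deriv T.den s / T.den s) • stereoLift !₂[T.h s, T.y s, T.z s]) s := by
    simp only [hlift]
    refine (h2.fun_smul h1).congr_deriv ?_
    rw [smul_zero, zero_add, smul_smul, div_mul_cancel₀ _ (T.den_pos s).ne']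
  have h4 := hasDerivAt_zero_of_stereoLift h3
  rw [hasDerivAt_euclidean_coord] at h4
  rcases T.immersion s with h | h | h
  · exact h (HasDerivAt.deriv (h4 0))
  · exact h (HasDerivAt.deriv (h4 1))
  · exact h (HasDerivAt.deriv (h4 2))

theorem h_nonpos {s : ℝ} (hs : s ∈ Set.Icc (1 : ℝ) 2) : T.h s ≤ 0 := by
  rcases hs.1.eq_or_lt with h | h
  · rw [← h, T.h_one]
  rcases hs.2.eq_or_lt with h' | h'
  · rw [h', T.h_two]
  · exact (T.arc_neg s ⟨h, h'⟩).le

theorem den_of_arc {s : ℝ} (hs : s ∈ Set.Icc (1 : ℝ) 2) : T.den s = 2 - 2 * T.h s := by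
  obtain ⟨h1, h2⟩ := T.arc_circle s hs
  rw [den, h1]
  linarith

/-- The circle was chosen so that inverse stereographic projection sends it into the hyperplane `x₀
+ x₃ = 0`. Thus the height with respect to each of the shrinking balls is affine in `x₀` along the
arc. -/
theorem curve_of_arc {s : ℝ} (hs : s ∈ Set.Icc (1 : ℝ) 2) :
    T.curve s 0 = T.h s / (1 - T.h s) ∧ T.curve s 3 = -T.curve s 0 := by
  obtain ⟨h0, -, -, h3⟩ := T.curve_apply s
  have hd := T.den_of_arc hs
  have hh := T.h_nonpos hs
  have h1 : 1 - T.h s ≠ 0 := by linarith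
  have h2 : 2 - 2 * T.h s ≠ 0 := by linarith
  have h4 : T.h s ^ 2 + T.y s ^ 2 + T.z s ^ 2 = 1 - 2 * T.h s := by
    unfold den at hd
    linarith
  rw [h3, h0, hd, h4]
  constructor
  · field_simp
  · field_simp
    ring

theorem hasDerivAt_curve_of_arc {s : ℝ} (hs : s ∈ Set.Icc (1 : ℝ) 2) :
    HasDerivAt (fun s => T.curve s 0) (4 * deriv T.h s / T.den s ^ 2) s ∧
    HasDerivAt (fun s => T.curve s 3) (-(4 * deriv T.h s / T.den s ^ 2)) s := by
  obtain ⟨hz', hy'⟩ := T.deriv_arc hs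
  have hd0 := (T.den_pos s).ne'
  have hh := (T.differentiable_h s).hasDerivAt
  have hD1 : HasDerivAt (fun s => T.h s ^ 2 + T.y s ^ 2 + T.z s ^ 2) (-2 * deriv T.h s) s := by
    refine (((hh.fun_pow 2).add ((T.differentiable_y s).hasDerivAt.fun_pow 2)).add
      ((T.differentiable_z s).hasDerivAt.fun_pow 2)).congr_deriv ?_
    rw [hz']
    simp
    linarith
  have hD : HasDerivAt T.den (-2 * deriv T.h s) s := hD1.add_const 1
  have hd := T.den_of_arc hs
  constructor
  · refine (((hh.const_mul 2).div hD hd0).congr_deriv ?_).congr_of_eventuallyEq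
      (Filter.Eventually.of_forall fun r => (T.curve_apply r).1)
    rw [hd]
    ring
  · refine (((hD1.sub_const 1).div hD hd0).congr_deriv ?_).congr_of_eventuallyEq
      (Filter.Eventually.of_forall fun r => (T.curve_apply r).2.2.2)
    have h1 : T.h s ^ 2 + T.y s ^ 2 + T.z s ^ 2 = T.den s - 1 := by
      unfold den
      ring
    rw [h1, hd]
    ring

/-- The two ends are distinct points of the circle at height 0, so their `y` values are opposite and
`y` vanishes in between. Negativity of `h` selects the lower point of the circle, and injectivity of
the curve makes the parameter unique. It is the only possible critical point of `h` on the arc. -/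
theorem exists_arc_mid : ∃ m ∈ Set.Ioo (1 : ℝ) 2, T.y m = 0 ∧ T.h m = -1 - √2 ∧
    ∀ s ∈ Set.Icc (1 : ℝ) 2, T.y s = 0 → s = m := by
  have h1 := (T.arc_circle 1 (by norm_num)).2
  have h2 := (T.arc_circle 2 (by norm_num)).2
  rw [T.h_one] at h1
  rw [T.h_two] at h2
  have hy1 := T.y_ne_zero_of_h (s := 1) (by norm_num) T.h_one
  have hy2 := T.y_ne_zero_of_h (s := 2) (by norm_num) T.h_two
  have hne : T.y 1 ≠ T.y 2 := by
    intro h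
    have hp := T.periodic_y 0
    rw [zero_add] at hp
    have hz := T.periodic_z 0
    rw [zero_add, (T.arc_circle 2 (by norm_num)).1] at hz
    have := T.injective 1 (by norm_num) 0 (by norm_num) (by rw [T.h_one, T.h_zero]) (h.trans hp)
      ((T.arc_circle 1 (by norm_num)).1.trans hz)
    norm_num at this
  have hsum : T.y 1 + T.y 2 = 0 := by
    have : (T.y 1 - T.y 2) * (T.y 1 + T.y 2) = 0 := by linarith
    exact (mul_eq_zero.1 this).resolve_left (sub_ne_zero.2 hne)
  have h0 : (0 : ℝ) ∈ Set.uIcc (T.y 1) (T.y 2) := by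
    rw [Set.mem_uIcc]
    rcases le_total 0 (T.y 1) with h | h
    · exact Or.inr ⟨by linarith, h⟩
    · exact Or.inl ⟨h, by linarith⟩
  obtain ⟨m, hm, hym⟩ := intermediate_value_uIcc T.smooth_y.continuous.continuousOn h0
  rw [Set.uIcc_of_le one_le_two] at hm
  have hIoo : ∀ s ∈ Set.Icc (1 : ℝ) 2, T.y s = 0 → s ∈ Set.Ioo (1 : ℝ) 2 := by
    intro s hs hys
    refine ⟨lt_of_le_of_ne hs.1 ?_, lt_of_le_of_ne hs.2 ?_⟩
    · rintro rfl
      exact hy1 hys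
    · rintro rfl
      exact hy2 hys
  have hh : ∀ s ∈ Set.Icc (1 : ℝ) 2, T.y s = 0 → T.h s = -1 - √2 := by
    intro s hs hys
    have hneg := T.arc_neg s (hIoo s hs hys)
    have h3 := (T.arc_circle s hs).2
    have h4 : (T.h s + 1 - √2) * (T.h s + 1 + √2) = 0 := by
      have := Real.sq_sqrt (show (0 : ℝ) ≤ 2 by norm_num)
      rw [hys] at h3
      linarith
    rcases mul_eq_zero.1 h4 with h | h
    · have := Real.one_lt_sqrt_two
      linarith
    · linarith
  refine ⟨m, hIoo m hm hym, hym, hh m hm hym, fun s hs hys => ?_⟩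
  have h3 := hIoo s hs hys
  have h4 := hIoo m hm hym
  have h5 : (2 : ℝ) = 0 + 2 := by norm_num
  refine T.injective s ⟨by linarith [h3.1], h3.2⟩ m ⟨by linarith [h4.1], h4.2⟩
    (by rw [hh s hs hys, hh m hm hym]) (by rw [hys, hym])
    (by rw [(T.arc_circle s hs).1, (T.arc_circle m hm).1])

theorem deriv_sign_of_ne_zero {f : ℝ → ℝ} (hf : ContDiff ℝ ∞ f) {S : Set ℝ} (hS : S.OrdConnected)
    (h0 : ∀ s ∈ S, deriv f s ≠ 0) {c : ℝ} (hc : c ∈ S) (hneg : deriv f c < 0) :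
    ∀ s ∈ S, deriv f s < 0 := by
  intro s hs
  by_contra hge
  have hcont := (contDiff_infty_iff_deriv.1 hf).2.continuous
  have h1 : (0 : ℝ) ∈ Set.uIcc (deriv f c) (deriv f s) :=
    Set.mem_uIcc.2 (Or.inl ⟨hneg.le, not_lt.1 hge⟩)
  obtain ⟨x, hx, hx0⟩ := intermediate_value_uIcc hcont.continuousOn h1
  exact h0 x (hS.uIcc_subset hc hs hx) hx0

/-- The first coordinate of the closed curve decreases and then increases along the arc. -/
theorem exists_arc_min : ∃ m ∈ Set.Ioo (1 : ℝ) 2,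
    T.curve m = !₂[-(√2 / 2), 0, 0, √2 / 2] ∧
    (∀ s ∈ Set.Ico 1 m, deriv T.h s < 0) ∧ (∀ s ∈ Set.Ioc m 2, 0 < deriv T.h s) := by
  obtain ⟨m, hm, hym, hhm, huniq⟩ := T.exists_arc_mid
  have h2 := Real.sq_sqrt (show (0 : ℝ) ≤ 2 by norm_num)
  have hpos : 0 < √2 := by positivity
  have hIcc := Set.Ioo_subset_Icc_self hm
  have hne : ∀ s ∈ Set.Icc (1 : ℝ) 2, s ≠ m → deriv T.h s ≠ 0 := fun s hs hsm =>
    T.deriv_h_ne_zero_of_arc hs fun hy => hsm (huniq s hs hy)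
  refine ⟨m, hm, ?_, ?_, ?_⟩
  · obtain ⟨e0, e1, e2, e3⟩ := T.curve_apply m
    obtain ⟨c0, c3⟩ := T.curve_of_arc hIcc
    have hval : T.curve m 0 = -(√2 / 2) := by
      rw [c0, hhm, div_eq_iff (by linarith)]
      linarith
    ext i
    fin_cases i
    · exact hval
    · exact e1.trans (by simp [hym])
    · exact e2.trans (by simp [(T.arc_circle m hIcc).1])
    · exact c3.trans (by rw [hval]; simp)
  -- The derivative has no zero on this half of the arc, so its sign is constant; the mean value
  -- theorem supplies one point where the sign is known.
  · obtain ⟨c, hc, hc'⟩ := exists_deriv_eq_slope T.h hm.1 T.smooth_h.continuous.continuousOn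
      T.differentiable_h.differentiableOn
    refine deriv_sign_of_ne_zero T.smooth_h Set.ordConnected_Ico (fun s hs =>
      hne s ⟨hs.1, hs.2.le.trans hm.2.le⟩ hs.2.ne) (Set.Ioo_subset_Ico_self hc) ?_
    rw [hc', T.h_one, hhm]
    exact div_neg_of_neg_of_pos (by linarith) (by linarith [hm.1])
  · obtain ⟨c, hc, hc'⟩ := exists_deriv_eq_slope T.h hm.2 T.smooth_h.continuous.continuousOn
      T.differentiable_h.differentiableOn
    have hderiv : ∀ s, deriv (fun s => -T.h s) s = -deriv T.h s := fun s => deriv.fun_neg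
    have := deriv_sign_of_ne_zero T.smooth_h.neg (S := Set.Ioc m 2) Set.ordConnected_Ioc
      (fun s hs => by
        change deriv (fun s => -T.h s) s ≠ 0
        rw [hderiv]
        exact neg_ne_zero.2 (hne s ⟨hm.1.le.trans hs.1.le, hs.2⟩ hs.1.ne'))
      (Set.Ioo_subset_Ioc_self hc) (by
        change deriv (fun s => -T.h s) c < 0
        rw [hderiv, hc', T.h_two, hhm]
        exact neg_lt_zero.2 (div_pos (by linarith) (by linarith [hm.2])))
    intro s hs
    have h3 := this s hs
    change deriv (fun s => -T.h s) s < 0 at h3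
    rw [hderiv] at h3
    linarith

end ClosedTangle

/-! ### Shrinking the complementary ball to a point of the trivial arc -/

/-- The center of the trivial arc of a closed tangle. -/
def arcPoint : EuclideanSpace ℝ (Fin 4) := !₂[-(√2 / 2), 0, 0, √2 / 2]

/-- The centers of the complements of the shrinking balls. -/
def shrinkCenter (t : ℝ) : EuclideanSpace ℝ (Fin 4) :=
  (1 - t) • EuclideanSpace.single 0 1 - t • arcPoint

theorem inner_shrinkCenter (t : ℝ) (p : EuclideanSpace ℝ (Fin 4)) :
    inner ℝ (shrinkCenter t) p = (1 - t) * p 0 + t * (√2 / 2 * (p 0 - p 3)) := by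
  rw [shrinkCenter, inner_sub_left, real_inner_smul_left, real_inner_smul_left]
  simp [arcPoint, PiLp.inner_apply, Fin.sum_univ_four]
  ring

theorem norm_sq_shrinkCenter (t : ℝ) :
    ‖shrinkCenter t‖ ^ 2 = (1 - t) ^ 2 + √2 * (t * (1 - t)) + t ^ 2 := by
  have h2 := Real.sq_sqrt (show (0 : ℝ) ≤ 2 by norm_num)
  rw [norm_sq_four]
  simp [shrinkCenter, arcPoint]
  linear_combination t ^ 2 / 2 * h2

theorem norm_shrinkCenter_zero : ‖shrinkCenter 0‖ = 1 := by
  rw [← sq_eq_sq₀ (norm_nonneg _) zero_le_one, norm_sq_shrinkCenter]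
  norm_num

theorem norm_shrinkCenter_one : ‖shrinkCenter 1‖ = 1 := by
  rw [← sq_eq_sq₀ (norm_nonneg _) zero_le_one, norm_sq_shrinkCenter]
  norm_num

theorem norm_arcPoint : ‖arcPoint‖ = 1 := by
  have := norm_shrinkCenter_one
  simpa [shrinkCenter] using this

namespace ClosedTangle

variable (T : ClosedTangle)

/-- The left side is the inner product of the curve with `arcPoint`. The compact tangle misses this
point of the arc, so the inner product stays below 1 by a uniform gap; smaller balls about
`arcPoint` avoid the tangle. -/
theorem exists_tangle_far : ∃ κ₀ > 0, ∀ s ∈ Set.Icc (0 : ℝ) 1,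
    -(√2 / 2 * (T.curve s 0 - T.curve s 3)) ≤ 1 - κ₀ := by
  obtain ⟨m, hm, hcm, -⟩ := T.exists_arc_min
  have hinner : ∀ p : EuclideanSpace ℝ (Fin 4),
      inner ℝ arcPoint p = -(√2 / 2 * (p 0 - p 3)) := fun p => by
    have := inner_shrinkCenter 1 p
    simp only [shrinkCenter, sub_self, zero_smul, zero_sub, one_smul, inner_neg_left, zero_mul,
      zero_add, one_mul] at this
    linarith
  have hlt : ∀ s ∈ Set.Icc (0 : ℝ) 1, inner ℝ arcPoint (T.curve s) < 1 := by
    intro s hs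
    rw [inner_lt_one_iff_real_of_norm_eq_one norm_arcPoint (T.norm_curve s)]
    intro h
    have h1 := T.eq_of_curve_eq (hcm.trans h)
      (by rw [abs_lt]; constructor <;> linarith [hm.1, hm.2, hs.1, hs.2])
    linarith [hm.1, hs.2]
  have hcont : Continuous fun s => inner ℝ arcPoint (T.curve s) :=
    continuous_const.inner T.contDiff_curve.continuous
  obtain ⟨s₀, hs₀, hmax⟩ := isCompact_Icc.exists_isMaxOn (Set.nonempty_Icc.2 zero_le_one)
    hcont.continuousOn
  refine ⟨1 - inner ℝ arcPoint (T.curve s₀), sub_pos.2 (hlt s₀ hs₀), fun s hs => ?_⟩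
  rw [← hinner]
  have := hmax hs
  simp only [Set.mem_ofPred_eq] at this
  linarith

/-- The signed distance from the boundary of the shrinking ball along the closed curve. -/
def shrinkHeight (κ t s : ℝ) : ℝ := t * (1 - κ) + inner ℝ (shrinkCenter t) (T.curve s)

variable {κ t : ℝ}

theorem shrinkHeight_periodic : Function.Periodic (T.shrinkHeight κ t) 2 := fun s => by
  simp only [shrinkHeight, T.curve_periodic s]

theorem shrinkHeight_of_arc {s : ℝ} (hs : s ∈ Set.Icc (1 : ℝ) 2) :
    T.shrinkHeight κ t s = t * (1 - κ) + (1 - t + √2 * t) * T.curve s 0 := by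
  rw [shrinkHeight, inner_shrinkCenter, (T.curve_of_arc hs).2]
  ring

theorem shrink_factor_pos (ht : t ∈ Set.Icc (0 : ℝ) 1) : 0 < 1 - t + √2 * t := by
  nlinarith [Real.one_lt_sqrt_two, ht.1]

theorem hasDerivAt_shrinkHeight_of_arc {s : ℝ} (hs : s ∈ Set.Icc (1 : ℝ) 2) :
    HasDerivAt (T.shrinkHeight κ t)
      ((1 - t + √2 * t) * (4 * deriv T.h s / T.den s ^ 2)) s := by
  obtain ⟨h0, h3⟩ := T.hasDerivAt_curve_of_arc hs
  refine (((h0.const_mul (1 - t)).add (((h0.sub h3).const_mul (√2 / 2)).const_mul t)).const_add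
    (t * (1 - κ))).congr_deriv (by ring) |>.congr_of_eventuallyEq
    (Filter.Eventually.of_forall fun r => ?_)
  rw [shrinkHeight, inner_shrinkCenter]
  rfl

theorem shrinkHeight_one_nonneg (hκ : κ < 1) (ht : t ∈ Set.Icc (0 : ℝ) 1) :
    0 ≤ T.shrinkHeight κ t 1 ∧ 0 ≤ T.shrinkHeight κ t 2 := by
  have h : 0 ≤ t * (1 - κ) := mul_nonneg ht.1 (by linarith)
  constructor
  · rw [T.shrinkHeight_of_arc (by norm_num), (T.curve_of_arc (by norm_num)).1, T.h_one]
    simpa using h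
  · rw [T.shrinkHeight_of_arc (by norm_num), (T.curve_of_arc (by norm_num)).1, T.h_two]
    simpa using h

/-- The height is a convex combination of the height above the initial ball, positive on the open
tangle, and that above the final ball, positive by the gap `κ₀ - κ`. -/
theorem shrinkHeight_tangle_pos {κ₀ : ℝ} (hκ₀ : ∀ s ∈ Set.Icc (0 : ℝ) 1,
    -(√2 / 2 * (T.curve s 0 - T.curve s 3)) ≤ 1 - κ₀) (hκ : κ < κ₀)
    (ht : t ∈ Set.Icc (0 : ℝ) 1) {s : ℝ} (hs : s ∈ Set.Ioo (0 : ℝ) 1) :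
    0 < T.shrinkHeight κ t s := by
  have h1 := hκ₀ s (Set.Ioo_subset_Icc_self hs)
  have h2 : 0 < T.curve s 0 := by
    rw [(T.curve_apply s).1]
    exact div_pos (by linarith [T.tangle_pos s hs]) (T.den_pos s)
  rw [shrinkHeight, inner_shrinkCenter]
  have h3 : 0 ≤ (1 - t) * T.curve s 0 := mul_nonneg (by linarith [ht.2]) h2.le
  have h4 : t * (κ₀ - κ) ≤ t * (1 - κ) + t * (√2 / 2 * (T.curve s 0 - T.curve s 3)) := by
    rw [← mul_add]
    exact mul_le_mul_of_nonneg_left (by linarith) ht.1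
  have h5 : 0 ≤ t * (κ₀ - κ) := mul_nonneg ht.1 (by linarith)
  rcases ht.1.eq_or_lt with h | h
  · have : 0 < (1 - t) * T.curve s 0 := mul_pos (by linarith) h2
    linarith
  · have := mul_pos h (sub_pos.2 hκ)
    linarith

theorem shrinkHeight_mid_neg (hκ : 0 < κ) (ht : t ∈ Set.Icc (0 : ℝ) 1) {m : ℝ}
    (hcm : T.curve m = arcPoint) : T.shrinkHeight κ t m < 0 := by
  have h2 := Real.sq_sqrt (show (0 : ℝ) ≤ 2 by norm_num)
  rw [shrinkHeight, inner_shrinkCenter, hcm]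
  have h0 : arcPoint 0 = -(√2 / 2) := rfl
  have h3 : arcPoint 3 = √2 / 2 := rfl
  rw [h0, h3]
  have hr : 0 < √2 / 2 := by positivity
  have h4 : √2 / 2 * (-(√2 / 2) - √2 / 2) = -1 := by linarith
  rw [h4]
  rcases ht.2.eq_or_lt with h | h
  · rw [h]
    linarith
  · have h5 := mul_pos (sub_pos.2 h) hr
    have h6 := mul_nonneg ht.1 hκ.le
    linarith

/-- The tangle remains outside all balls and the midpoint of the arc inside. On each half of the arc
the height is strictly monotone, so it has exactly one zero there. Starting the period at the
midpoint `m` makes the outside portion a single interval. -/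
theorem exists_isBallFamily : ∃ κ₀ > 0, ∀ κ ∈ Set.Ioo 0 κ₀, ∃ m : ℝ, ∃ a b : ℝ → ℝ,
    IsBallFamily 2 (fun p => T.curve (m + p.2)) shrinkCenter (fun t => t * (1 - κ)) a b := by
  obtain ⟨κ₁, hκ₁, htan⟩ := T.exists_tangle_far
  obtain ⟨m, hm, hcm, hdec, hinc⟩ := T.exists_arc_min
  refine ⟨min κ₁ 1, lt_min hκ₁ one_pos, fun κ hκ => ?_⟩
  have hκlt := hκ.2.trans_le (min_le_left _ _)
  have hκone := hκ.2.trans_le (min_le_right _ _)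
  have hcont : ∀ t, Continuous (T.shrinkHeight κ t) := fun t =>
    continuous_const.add (continuous_const.inner T.contDiff_curve.continuous)
  have hanti : ∀ t ∈ Set.Icc (0 : ℝ) 1, StrictAntiOn (T.shrinkHeight κ t) (Set.Icc 1 m) := by
    intro t ht
    refine strictAntiOn_of_deriv_neg (convex_Icc 1 m) (hcont t).continuousOn fun s hs => ?_
    rw [interior_Icc] at hs
    rw [(T.hasDerivAt_shrinkHeight_of_arc ⟨hs.1.le, hs.2.le.trans hm.2.le⟩).deriv]
    exact mul_neg_of_pos_of_neg (shrink_factor_pos ht) (div_neg_of_neg_of_pos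
      (by linarith [hdec s ⟨hs.1.le, hs.2⟩]) (pow_pos (T.den_pos s) 2))
  have hmono : ∀ t ∈ Set.Icc (0 : ℝ) 1, StrictMonoOn (T.shrinkHeight κ t) (Set.Icc m 2) := by
    intro t ht
    refine strictMonoOn_of_deriv_pos (convex_Icc m 2) (hcont t).continuousOn fun s hs => ?_
    rw [interior_Icc] at hs
    rw [(T.hasDerivAt_shrinkHeight_of_arc ⟨hm.1.le.trans hs.1.le, hs.2.le⟩).deriv]
    exact mul_pos (shrink_factor_pos ht) (div_pos
      (by linarith [hinc s ⟨hs.1, hs.2.le⟩]) (pow_pos (T.den_pos s) 2))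
  -- The interval must include 2: for the initial ball the zero is the end of the arc itself.
  -- Likewise the other zero `β` may be 1.
  have hα : ∀ t ∈ Set.Icc (0 : ℝ) 1, ∃ α ∈ Set.Ioc m 2, T.shrinkHeight κ t α = 0 := by
    intro t ht
    have hneg := T.shrinkHeight_mid_neg hκ.1 ht hcm
    obtain ⟨α, hα, h0⟩ := intermediate_value_Icc hm.2.le (hcont t).continuousOn
      ⟨hneg.le, (T.shrinkHeight_one_nonneg hκone ht).2⟩
    refine ⟨α, ⟨lt_of_le_of_ne hα.1 ?_, hα.2⟩, h0⟩
    rintro rfl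
    exact hneg.ne h0
  have hβ : ∀ t ∈ Set.Icc (0 : ℝ) 1, ∃ β ∈ Set.Ico 1 m, T.shrinkHeight κ t β = 0 := by
    intro t ht
    have hneg := T.shrinkHeight_mid_neg hκ.1 ht hcm
    obtain ⟨β, hβ, h0⟩ := intermediate_value_Icc' hm.1.le (hcont t).continuousOn
      ⟨hneg.le, (T.shrinkHeight_one_nonneg hκone ht).1⟩
    refine ⟨β, ⟨hβ.1, lt_of_le_of_ne hβ.2 ?_⟩, h0⟩
    rintro rfl
    exact hneg.ne h0
  choose! α hαm hα0 using hα
  choose! β hβm hβ0 using hβ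
  have hper : ∀ t s, T.shrinkHeight κ t s = T.shrinkHeight κ t (s - 2) := fun t s =>
    (T.shrinkHeight_periodic.sub_eq s).symm
  refine ⟨m, fun t => α t - m, fun t => β t + 2 - m, ?_⟩
  constructor
  · exact T.contDiff_curve.comp (contDiff_const.add contDiff_snd)
  · exact fun p => T.norm_curve _
  · exact ((contDiff_const.sub contDiff_id).smul contDiff_const).sub
      (contDiff_id.smul contDiff_const)
  · exact contDiff_id.mul contDiff_const
  · intro t ht h0
    have h1 := norm_sq_shrinkCenter t
    rw [h0, norm_zero] at h1
    nlinarith [mul_nonneg (Real.sqrt_nonneg 2) (mul_nonneg ht.1 (sub_nonneg.2 ht.2)), sq_nonneg t,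
      sq_nonneg (1 - t)]
  · intro t ht
    refine abs_lt_of_sq_lt_sq ?_ (norm_nonneg _)
    rw [norm_sq_shrinkCenter, mul_pow]
    have h1 := mul_nonneg (Real.sqrt_nonneg 2) (mul_nonneg ht.1 (sub_nonneg.2 ht.2))
    have h2 : (1 - κ) ^ 2 < 1 := by nlinarith [hκ.1]
    have h3 : t ^ 2 * (1 - κ) ^ 2 ≤ t ^ 2 := mul_le_of_le_one_right (sq_nonneg t) h2.le
    rcases ht.2.eq_or_lt with h | h
    · rw [h]
      linarith
    · have := pow_pos (sub_pos.2 h) 2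
      linarith
  · intro t _ s hs s' hs' h
    have := T.eq_of_curve_eq h (by
      rw [abs_lt]
      constructor <;> linarith [hs.1, hs.2, hs'.1, hs'.2])
    linarith
  · intro t _ s
    rw [deriv_comp_const_add]
    exact T.deriv_curve_ne_zero _
  · intro t ht
    linarith [(hαm t ht).1]
  · intro t ht
    linarith [(hαm t ht).2, (hβm t ht).1]
  · intro t ht
    linarith [(hβm t ht).2]
  · intro t ht
    have := hα0 t ht
    rw [← add_sub_cancel m (α t)] at this
    exact this
  · intro t ht
    have := hβ0 t ht
    rw [← add_sub_cancel_right (β t) 2, ← hper, ← add_sub_cancel m (β t + 2)] at this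
    exact this
  · intro t ht
    change 0 < deriv (fun s => T.shrinkHeight κ t (m + s)) (α t - m)
    have h1 := hαm t ht
    rw [deriv_comp_const_add, add_sub_cancel,
      (T.hasDerivAt_shrinkHeight_of_arc ⟨hm.1.le.trans h1.1.le, h1.2⟩).deriv]
    exact mul_pos (shrink_factor_pos ht) (div_pos (by linarith [hinc _ h1])
      (pow_pos (T.den_pos _) 2))
  · intro t ht
    change deriv (fun s => T.shrinkHeight κ t (m + s)) (β t + 2 - m) < 0
    have h1 := hβm t ht
    rw [deriv_comp_const_add, add_sub_cancel, deriv_periodic T.shrinkHeight_periodic,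
      (T.hasDerivAt_shrinkHeight_of_arc ⟨h1.1, h1.2.le.trans hm.2.le⟩).deriv]
    exact mul_neg_of_pos_of_neg (shrink_factor_pos ht) (div_neg_of_neg_of_pos
      (by linarith [hdec _ h1]) (pow_pos (T.den_pos _) 2))
  · intro t ht s hs
    change 0 < T.shrinkHeight κ t (m + s)
    obtain ⟨h1, h1'⟩ := hαm t ht
    obtain ⟨h2, h2'⟩ := hβm t ht
    have h3 : α t < m + s := by linarith [hs.1]
    have h4 : m + s - 2 < β t := by linarith [hs.2]
    -- Outside the ball the curve runs through the end of the arc, the tangle, and the beginning of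
    -- the arc; the last two are shifted back by one period.
    rcases le_or_gt (m + s) 2 with h | h
    · rw [← hα0 t ht]
      exact hmono t ht ⟨h1.le, h1'⟩ ⟨(h1.trans h3).le, h⟩ h3
    rcases lt_or_ge (m + s - 2) 1 with h' | h'
    · rw [hper]
      exact T.shrinkHeight_tangle_pos htan hκlt ht ⟨by linarith, h'⟩
    · rw [hper, ← hβ0 t ht]
      exact hanti t ht ⟨h', (h4.trans h2').le⟩ ⟨h2, h2'.le⟩ h4
  · intro t ht s hs hns
    change T.shrinkHeight κ t (m + s) < 0
    obtain ⟨h1, h1'⟩ := hαm t ht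
    obtain ⟨h2, h2'⟩ := hβm t ht
    rcases lt_or_ge s (α t - m) with h | h
    · rw [← hα0 t ht]
      exact hmono t ht ⟨by linarith [hs.1], by linarith⟩ ⟨h1.le, h1'⟩ (by linarith)
    · have h3 : β t + 2 - m < s := by
        by_contra h3
        exact hns ⟨h, not_lt.1 h3⟩
      rw [hper, ← hβ0 t ht]
      exact hanti t ht ⟨h2, h2'.le⟩ ⟨by linarith, by linarith [hs.2]⟩ (by linarith)

/-- The curve stays fixed and only the ball shrinks. The final ball depends on `κ` alone and not on
the tangle, so two tangles can be compared at a common `κ`. -/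
theorem eventually_ballSpin_isotopic : ∀ᶠ κ in 𝓝[>] (0 : ℝ),
    SmoothlyIsotopic 2 T.spin (ballSpin T.closure (-arcPoint) (1 - κ)) := by
  obtain ⟨κ₀, hκ₀, h⟩ := T.exists_isBallFamily
  filter_upwards [Ioo_mem_nhdsGT hκ₀] with κ hκ
  obtain ⟨m, a, b, hf⟩ := h κ hκ
  have hC : ∀ p : Sph 3, p ∈ T.closure ↔ ∃ s ∈ Set.Icc (0 : ℝ) 2, T.curve (m + s) = p.1 := by
    intro p
    rw [T.mem_closure_iff]
    constructor
    · rintro ⟨s, hs⟩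
      obtain ⟨s', hs', h⟩ := (T.curve_periodic.const_add m).exists_mem_Ico₀ two_pos (s - m)
      refine ⟨s', Set.Ico_subset_Icc_self hs', ?_⟩
      rw [← hs, ← h, add_sub_cancel]
    · rintro ⟨s, -, hs⟩
      exact ⟨_, hs⟩
  have h1 := hf.smoothlyIsotopic hC hC norm_shrinkCenter_zero norm_shrinkCenter_one
  refine T.spin_isotopic_ballSpin.trans ?_
  simpa [shrinkCenter] using h1

end ClosedTangle

/-! ### Small balls centered on a moving closed curve -/

theorem exists_pos_forall_pos_near {E : ℝ × ℝ → ℝ} (hE : Continuous E)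
    (h0 : ∀ t ∈ Set.Icc (0 : ℝ) 1, 0 < E (t, 0)) :
    ∃ η > 0, ∀ s ∈ Set.Icc (-η) η, ∀ t ∈ Set.Icc (0 : ℝ) 1, 0 < E (t, s) := by
  have h1 : ∀ᶠ s in 𝓝 (0 : ℝ), ∀ t ∈ Set.Icc (0 : ℝ) 1, 0 < E (t, s) := by
    refine isCompact_Icc.eventually_forall_of_forall_eventually fun t ht => ?_
    have hc : Continuous fun z : ℝ × ℝ => E (z.2, z.1) := hE.comp continuous_swap
    exact hc.continuousAt.eventually (lt_mem_nhds (h0 t ht))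
  obtain ⟨η, hη, h⟩ := Metric.eventually_nhds_iff.1 h1
  refine ⟨η / 2, half_pos hη, fun s hs t ht => h ?_ t ht⟩
  rw [Real.dist_eq, sub_zero, abs_lt]
  constructor <;> linarith [hs.1, hs.2]

/-- A family of periodic functions with a nondegenerate minimum `0` at `0` and no further zeros in
the period interval takes small values `κ > 0` at exactly two points of this interval. -/
theorem exists_small_level {D : ℝ × ℝ → ℝ} {P : ℝ} (hD : ContDiff ℝ ∞ D) (hP : 0 < P)
    (hper : ∀ t, Function.Periodic (fun s => D (t, s)) P) (h0 : ∀ t, D (t, 0) = 0)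
    (h1 : ∀ t, deriv (fun s => D (t, s)) 0 = 0)
    (h2 : ∀ t ∈ Set.Icc (0 : ℝ) 1, 0 < deriv (deriv fun s => D (t, s)) 0)
    (hpos : ∀ t ∈ Set.Icc (0 : ℝ) 1, ∀ s ∈ Set.Ioo (0 : ℝ) P, 0 < D (t, s)) :
    ∃ κ₀ > 0, ∀ κ ∈ Set.Ioo 0 κ₀, ∃ a b : ℝ → ℝ, ∀ t ∈ Set.Icc (0 : ℝ) 1,
      (0 < a t ∧ a t < b t ∧ b t < P) ∧ (D (t, a t) = κ ∧ D (t, b t) = κ) ∧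
      (0 < deriv (fun s => D (t, s)) (a t) ∧ deriv (fun s => D (t, s)) (b t) < 0) ∧
      (∀ s ∈ Set.Ioo (a t) (b t), κ < D (t, s)) ∧
      (∀ s ∈ Set.Icc (0 : ℝ) P, s ∉ Set.Icc (a t) (b t) → D (t, s) < κ) := by
  have hD1 := contDiff_deriv_snd hD
  have hD2 := contDiff_deriv_snd hD1
  obtain ⟨η', hη', hη'pos⟩ := exists_pos_forall_pos_near hD2.continuous h2
  obtain ⟨η, hη, hηη', hηP⟩ : ∃ η > 0, η ≤ η' ∧ 2 * η < P :=
    ⟨min η' (P / 4), lt_min hη' (by positivity), min_le_left _ _, by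
      linarith [min_le_right η' (P / 4)]⟩
  have hc : ∀ t, Continuous fun s => D (t, s) := fun t =>
    hD.continuous.comp (continuous_const.prodMk continuous_id)
  have hc1 : ∀ t, Continuous fun s => deriv (fun s => D (t, s)) s := fun t =>
    hD1.continuous.comp (continuous_const.prodMk continuous_id)
  have hmono1 : ∀ t ∈ Set.Icc (0 : ℝ) 1,
      StrictMonoOn (fun s => deriv (fun s => D (t, s)) s) (Set.Icc (-η) η) := by
    intro t ht
    refine strictMonoOn_of_deriv_pos (convex_Icc _ _) (hc1 t).continuousOn fun s hs => ?_
    rw [interior_Icc] at hs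
    exact hη'pos s ⟨by linarith [hs.1], by linarith [hs.2]⟩ t ht
  have hdpos : ∀ t ∈ Set.Icc (0 : ℝ) 1, ∀ s ∈ Set.Ioc 0 η, 0 < deriv (fun s => D (t, s)) s := by
    intro t ht s hs
    rw [← h1 t]
    exact hmono1 t ht ⟨by linarith, hη.le⟩ ⟨by linarith [hs.1], hs.2⟩ hs.1
  have hdneg : ∀ t ∈ Set.Icc (0 : ℝ) 1, ∀ s ∈ Set.Ico (-η) 0,
      deriv (fun s => D (t, s)) s < 0 := by
    intro t ht s hs
    rw [← h1 t]
    exact hmono1 t ht ⟨hs.1, by linarith [hs.2]⟩ ⟨by linarith, hη.le⟩ hs.2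
  have hmono : ∀ t ∈ Set.Icc (0 : ℝ) 1, StrictMonoOn (fun s => D (t, s)) (Set.Icc 0 η) := by
    intro t ht
    refine strictMonoOn_of_deriv_pos (convex_Icc _ _) (hc t).continuousOn fun s hs => ?_
    rw [interior_Icc] at hs
    exact hdpos t ht s (Set.Ioo_subset_Ioc_self hs)
  have hanti : ∀ t ∈ Set.Icc (0 : ℝ) 1, StrictAntiOn (fun s => D (t, s)) (Set.Icc (-η) 0) := by
    intro t ht
    refine strictAntiOn_of_deriv_neg (convex_Icc _ _) (hc t).continuousOn fun s hs => ?_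
    rw [interior_Icc] at hs
    exact hdneg t ht s (Set.Ioo_subset_Ico_self hs)
  -- Positive second derivatives make `D` monotone on each side of 0 within distance `η`. Away from
  -- there `D` has a positive minimum, and levels below it are attained only in the two monotone
  -- pieces.
  obtain ⟨p₀, hp₀, hmin⟩ := (isCompact_Icc.prod isCompact_Icc).exists_isMinOn
    (s := Set.Icc (0 : ℝ) 1 ×ˢ Set.Icc η (P - η))
    ⟨(0, η), ⟨by simp, ⟨le_rfl, by linarith⟩⟩⟩ hD.continuous.continuousOn
  have hfar : ∀ t ∈ Set.Icc (0 : ℝ) 1, ∀ s ∈ Set.Icc η (P - η), D p₀ ≤ D (t, s) :=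
    fun t ht s hs => hmin (Set.mk_mem_prod ht hs)
  refine ⟨D p₀, hpos _ hp₀.1 _ ⟨by linarith [hp₀.2.1], by linarith [hp₀.2.2]⟩, fun κ hκ => ?_⟩
  have hp : ∀ t s, D (t, s) = D (t, s - P) := fun t s => ((hper t).sub_eq s).symm
  have hα : ∀ t ∈ Set.Icc (0 : ℝ) 1, ∃ α ∈ Set.Ioc 0 η, D (t, α) = κ := by
    intro t ht
    have h3 := hfar t ht η ⟨le_rfl, by linarith⟩
    obtain ⟨α, hα, h⟩ := intermediate_value_Icc hη.le (hc t).continuousOn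
      ⟨(h0 t).trans_le hκ.1.le, hκ.2.le.trans h3⟩
    refine ⟨α, ⟨lt_of_le_of_ne hα.1 ?_, hα.2⟩, h⟩
    rintro rfl
    exact hκ.1.ne ((h0 t).symm.trans h)
  have hβ : ∀ t ∈ Set.Icc (0 : ℝ) 1, ∃ β ∈ Set.Ico (-η) 0, D (t, β) = κ := by
    intro t ht
    have h3 := hfar t ht (P - η) ⟨by linarith, le_rfl⟩
    rw [hp t, sub_sub_cancel_left] at h3
    obtain ⟨β, hβ, h⟩ := intermediate_value_Icc' (neg_nonpos.2 hη.le) (hc t).continuousOn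
      ⟨(h0 t).trans_le hκ.1.le, hκ.2.le.trans h3⟩
    refine ⟨β, ⟨hβ.1, lt_of_le_of_ne hβ.2 ?_⟩, h⟩
    rintro rfl
    exact hκ.1.ne ((h0 t).symm.trans h)
  choose! α hαm hα0 using hα
  choose! β hβm hβ0 using hβ
  refine ⟨α, fun t => β t + P, fun t ht => ?_⟩
  obtain ⟨h3, h3'⟩ := hαm t ht
  obtain ⟨h4, h4'⟩ := hβm t ht
  refine ⟨⟨h3, by linarith, by linarith⟩, ⟨hα0 t ht, (hper t _).trans (hβ0 t ht)⟩,
    ⟨hdpos t ht _ ⟨h3, h3'⟩, ?_⟩, fun s hs => ?_, fun s hs hns => ?_⟩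
  · rw [← deriv_comp_add_const, show (fun s => D (t, s + P)) = fun s => D (t, s) from
      funext (hper t)]
    exact hdneg t ht _ ⟨h4, h4'⟩
  · rcases le_or_gt s η with h | h
    · rw [← hα0 t ht]
      exact hmono t ht ⟨h3.le, h3'⟩ ⟨(h3.trans hs.1).le, h⟩ hs.1
    rcases le_or_gt s (P - η) with h' | h'
    · exact hκ.2.trans_le (hfar t ht s ⟨h.le, h'⟩)
    · have h5 : s - P < β t := by linarith [hs.2]
      rw [hp, ← hβ0 t ht]
      exact hanti t ht ⟨by linarith, (h5.trans h4').le⟩ ⟨h4, h4'.le⟩ h5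
  · rcases lt_or_ge s (α t) with h | h
    · rw [← hα0 t ht]
      exact hmono t ht ⟨hs.1, h.le.trans h3'⟩ ⟨h3.le, h3'⟩ h
    · have h5 : β t + P < s := by
        by_contra h5
        exact hns ⟨h, not_lt.1 h5⟩
      rw [hp, ← hβ0 t ht]
      exact hanti t ht ⟨h4, h4'.le⟩ ⟨by linarith, by linarith [hs.2]⟩ (by linarith)

/-- Half the squared distance from the moving center, `D = 1 - ⟪Γ (t, 0), Γ (t, s)⟫`, has a
nondegenerate minimum at `s = 0`, with second derivative the squared speed, and no other zero in a
period. So `exists_small_level` provides balls meeting each curve in one arc around its center. -/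
theorem exists_isBallFamily_of_curve {P : ℝ} {Γ : ℝ × ℝ → EuclideanSpace ℝ (Fin 4)}
    (hΓ : ContDiff ℝ ∞ Γ) (hn : ∀ p, ‖Γ p‖ = 1) (hP : 0 < P)
    (hper : ∀ t, Function.Periodic (fun s => Γ (t, s)) P)
    (hinj : ∀ t ∈ Set.Icc (0 : ℝ) 1, ∀ s ∈ Set.Ico (0 : ℝ) P, ∀ s' ∈ Set.Ico (0 : ℝ) P,
      Γ (t, s) = Γ (t, s') → s = s')
    (himm : ∀ t ∈ Set.Icc (0 : ℝ) 1, ∀ s, deriv (fun s => Γ (t, s)) s ≠ 0) :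
    ∃ κ₀ > 0, ∀ κ ∈ Set.Ioo 0 κ₀, ∃ a b : ℝ → ℝ,
      IsBallFamily P Γ (fun t => -Γ (t, 0)) (fun _ => 1 - κ) a b := by
  have hΓ0 : ContDiff ℝ ∞ fun t : ℝ => Γ (t, 0) := hΓ.comp (by fun_prop)
  have hΓt : ∀ t, ContDiff ℝ ∞ fun s : ℝ => Γ (t, s) := fun t => hΓ.comp (by fun_prop)
  set D : ℝ × ℝ → ℝ := fun p => 1 - inner ℝ (Γ (p.1, 0)) (Γ p) with hDdef
  have hD : ContDiff ℝ ∞ D :=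
    contDiff_const.sub ((hΓ0.comp contDiff_fst).inner ℝ hΓ)
  have hΓd : ∀ t s, HasDerivAt (fun s => Γ (t, s)) (deriv (fun s => Γ (t, s)) s) s := fun t s =>
    ((hΓt t).differentiable (by simp) s).hasDerivAt
  have hDd : ∀ t s, HasDerivAt (fun s => D (t, s))
      (-inner ℝ (Γ (t, 0)) (deriv (fun s => Γ (t, s)) s)) s := by
    intro t s
    refine (((hasDerivAt_const s (Γ (t, 0))).inner ℝ (hΓd t s)).const_sub 1).congr_deriv ?_
    simp
  have hortho : ∀ t s, inner ℝ (Γ (t, s)) (deriv (fun s => Γ (t, s)) s) = (0 : ℝ) := by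
    intro t s
    have h1 := (hΓd t s).norm_sq
    simp only [hn, one_pow] at h1
    have h2 := h1.unique (hasDerivAt_const s (1 : ℝ))
    linarith
  have hDD : ∀ t, deriv (deriv fun s => D (t, s)) 0 = ‖deriv (fun s => Γ (t, s)) 0‖ ^ 2 := by
    intro t
    -- By orthogonality of position and velocity the center may be subtracted in the first slot;
    -- this factor vanishes at `s = 0` and removes the acceleration term from the second derivative.
    have h1 : (deriv fun s => D (t, s)) =
        fun s => inner ℝ (Γ (t, s) - Γ (t, 0)) (deriv (fun s => Γ (t, s)) s) := by
      ext1 s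
      rw [(hDd t s).deriv, inner_sub_left, hortho, zero_sub]
    have h2 : HasDerivAt (deriv fun s => Γ (t, s)) (deriv (deriv fun s => Γ (t, s)) 0) 0 :=
      ((contDiff_infty_iff_deriv.1 (hΓt t)).2.differentiable (by simp) 0).hasDerivAt
    rw [h1, (((hΓd t 0).sub_const (Γ (t, 0))).inner ℝ h2).deriv, sub_self, inner_zero_left,
      zero_add, real_inner_self_eq_norm_sq]
  obtain ⟨κ₀, hκ₀, h⟩ := exists_small_level hD hP
    (fun t s => by simp only [hDdef, hper t s])
    (fun t => by simp [hDdef, hn])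
    (fun t => by rw [(hDd t 0).deriv, hortho, neg_zero])
    (fun t ht => by
      rw [hDD]
      exact pow_pos (norm_pos_iff.2 (himm t ht 0)) 2)
    (fun t ht s hs => by
      refine sub_pos.2 ((inner_lt_one_iff_real_of_norm_eq_one (hn _) (hn _)).2 fun he => ?_)
      exact hs.1.ne (hinj t ht 0 ⟨le_rfl, hP⟩ s ⟨hs.1.le, hs.2⟩ he))
  refine ⟨min κ₀ 1, lt_min hκ₀ one_pos, fun κ hκ => ?_⟩
  have hκ1 := hκ.2.trans_le (min_le_right _ _)
  obtain ⟨a, b, hab⟩ := h κ ⟨hκ.1, hκ.2.trans_le (min_le_left _ _)⟩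
  have hL : ∀ t s, 1 - κ + inner ℝ (-Γ (t, 0)) (Γ (t, s)) = D (t, s) - κ := fun t s => by
    simp only [hDdef, inner_neg_left]
    ring
  have hLd : ∀ t s, deriv (fun s => 1 - κ + inner ℝ (-Γ (t, 0)) (Γ (t, s))) s =
      deriv (fun s => D (t, s)) s := fun t s => by
    simp only [hL]
    exact deriv_sub_const _
  refine ⟨a, b, ?_⟩
  constructor
  · exact hΓ
  · exact hn
  · exact hΓ0.neg
  · exact contDiff_const
  · intro t _
    rw [← norm_ne_zero_iff, norm_neg, hn]
    exact one_ne_zero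
  · intro t _
    rw [norm_neg, hn, abs_lt]
    constructor <;> linarith [hκ.1]
  · exact fun t ht s hs s' hs' =>
      hinj t ht s (Set.Ioo_subset_Ico_self hs) s' (Set.Ioo_subset_Ico_self hs')
  · exact himm
  · exact fun t ht => (hab t ht).1.1
  · exact fun t ht => (hab t ht).1.2.1
  · exact fun t ht => (hab t ht).1.2.2
  · intro t ht
    rw [hL, (hab t ht).2.1.1, sub_self]
  · intro t ht
    rw [hL, (hab t ht).2.1.2, sub_self]
  · intro t ht
    rw [hLd]
    exact (hab t ht).2.2.1.1
  · intro t ht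
    rw [hLd]
    exact (hab t ht).2.2.1.2
  · intro t ht s hs
    rw [hL]
    exact sub_pos.2 ((hab t ht).2.2.2.1 s hs)
  · intro t ht s hs hns
    rw [hL]
    exact sub_neg.2 ((hab t ht).2.2.2.2 s hs hns)

/-! ### The angular parametrization of the circle -/

/-- The point of the unit circle with angle `α`. -/
def circ (α : ℝ) : Sph 1 := dirSphere !₂[Real.cos α, Real.sin α]

theorem circ_coe (α : ℝ) : (circ α).1 = !₂[Real.cos α, Real.sin α] := by
  have h : ‖(!₂[Real.cos α, Real.sin α] : EuclideanSpace ℝ (Fin 2))‖ = 1 := by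
    rw [EuclideanSpace.norm_eq, Real.sqrt_eq_one, Fin.sum_univ_two]
    simp
  rw [circ, dirSphere_coe (norm_ne_zero_iff.1 (by rw [h]; exact one_ne_zero)), h, inv_one, one_smul]

theorem contDiff_cos_sin :
    ContDiff ℝ ∞ fun α : ℝ => (!₂[Real.cos α, Real.sin α] : EuclideanSpace ℝ (Fin 2)) := by
  rw [contDiff_euclidean]
  intro i
  fin_cases i
  · exact Real.contDiff_cos
  · exact Real.contDiff_sin

theorem contMDiff_circ : ContMDiff 𝓘(ℝ, ℝ) (𝓡 1) ∞ circ := by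
  refine contMDiff_dirSphere contDiff_cos_sin.contMDiff fun α h => ?_
  have h0 := congrArg (fun v => v 0) h
  have h1 := congrArg (fun v => v 1) h
  have := Real.sin_sq_add_cos_sq α
  simp at h0 h1
  rw [h0, h1] at this
  norm_num at this

theorem circ_periodic : Function.Periodic circ (2 * Real.pi) := fun α => by
  rw [circ, Real.cos_add_two_pi, Real.sin_add_two_pi, circ]

theorem circ_surjective : Function.Surjective circ := by
  intro p
  have hp : ‖p.1‖ = 1 := mem_sphere_zero_iff_norm.1 p.2
  rw [EuclideanSpace.norm_eq, Real.sqrt_eq_one, Fin.sum_univ_two] at hp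
  simp only [Real.norm_eq_abs, sq_abs] at hp
  set z : ℂ := ⟨p.1 0, p.1 1⟩ with hz
  have hz1 : ‖z‖ = 1 := by
    rw [Complex.norm_eq_sqrt_sq_add_sq, Real.sqrt_eq_one]
    exact hp
  refine ⟨z.arg, Subtype.ext ?_⟩
  rw [circ_coe]
  have h0 := Complex.norm_mul_cos_arg z
  have h1 := Complex.norm_mul_sin_arg z
  rw [hz1, one_mul] at h0 h1
  ext i
  fin_cases i
  · exact h0
  · exact h1

theorem eq_of_circ_eq {α β : ℝ} (h : circ α = circ β) (hlt : |α - β| < 2 * Real.pi) : α = β := by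
  have h' := congrArg Subtype.val h
  rw [circ_coe, circ_coe] at h'
  obtain ⟨k, hk⟩ := Real.Angle.angle_eq_iff_two_pi_dvd_sub.1 (Real.Angle.cos_sin_inj
    (congrArg (fun v => v 0) h') (congrArg (fun v => v 1) h'))
  rw [hk, abs_mul, abs_of_pos Real.two_pi_pos] at hlt
  have h2 : |(k : ℝ)| < 1 := by
    by_contra hge
    have := mul_le_mul_of_nonneg_left (not_lt.1 hge) Real.two_pi_pos.le
    linarith
  have h3 : k = 0 := Int.abs_lt_one_iff.1 (by exact_mod_cast h2)
  rw [h3] at hk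
  simp at hk
  linarith

theorem deriv_comp_circ_ne_zero {n : ℕ} {f : Sph 1 → Sph n} (hf : IsSmoothSphereEmbedding f)
    (α : ℝ) : deriv (fun α => (f (circ α)).1) α ≠ 0 := by
  have hcirc : mfderiv 𝓘(ℝ, ℝ) (𝓡 1) circ α (1 : ℝ) ≠ 0 := by
    intro h0
    have h1 : mfderiv 𝓘(ℝ, ℝ) 𝓘(ℝ, EuclideanSpace ℝ (Fin 2)) (fun α => (circ α).1) α (1 : ℝ) = 0 := by
      have := mfderiv_comp α (mdifferentiableAt_coe_sph (circ α))
        ((contMDiff_circ α).mdifferentiableAt (by simp))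
      change mfderiv 𝓘(ℝ, ℝ) 𝓘(ℝ, EuclideanSpace ℝ (Fin 2)) (Subtype.val ∘ circ) α (1 : ℝ) = 0
      rw [this]
      change mfderiv (𝓡 1) 𝓘(ℝ, EuclideanSpace ℝ (Fin 2)) _ (circ α)
        (mfderiv 𝓘(ℝ, ℝ) (𝓡 1) circ α (1 : ℝ)) = 0
      rw [h0]
      exact map_zero _
    rw [mfderiv_eq_fderiv] at h1
    have h2 : deriv (fun α => (circ α).1) α = 0 := h1
    simp only [circ_coe] at h2
    have h3 := (contDiff_cos_sin.differentiable (by simp) α).hasDerivAt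
    rw [h2, hasDerivAt_euclidean_coord] at h3
    have hs := (h3 0).unique (Real.hasDerivAt_cos α)
    have hc := (h3 1).unique (Real.hasDerivAt_sin α)
    simp at hs hc
    have := Real.sin_sq_add_cos_sq α
    rw [hs, ← hc] at this
    norm_num at this
  intro h0
  have h1 : mfderiv 𝓘(ℝ, ℝ) 𝓘(ℝ, EuclideanSpace ℝ (Fin (n + 1))) (fun α => (f (circ α)).1) α
      (1 : ℝ) = 0 := by
    rw [mfderiv_eq_fderiv]
    exact h0
  have hfc : ContMDiff (𝓡 1) 𝓘(ℝ, EuclideanSpace ℝ (Fin (n + 1))) ∞ fun y => (f y).1 :=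
    contMDiff_coe_sph.comp hf.smooth
  have h2 := mfderiv_comp α ((hfc (circ α)).mdifferentiableAt (by simp))
    ((contMDiff_circ α).mdifferentiableAt (by simp))
  change mfderiv 𝓘(ℝ, ℝ) 𝓘(ℝ, EuclideanSpace ℝ (Fin (n + 1))) ((fun y => (f y).1) ∘ circ) α
    (1 : ℝ) = 0 at h1
  rw [h2] at h1
  change mfderiv (𝓡 1) 𝓘(ℝ, EuclideanSpace ℝ (Fin (n + 1))) (fun y => (f y).1) (circ α)
    (mfderiv 𝓘(ℝ, ℝ) (𝓡 1) circ α (1 : ℝ)) = 0 at h1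
  rw [mfderiv_coe_comp hf.smooth] at h1
  have h3 := mfderiv_coe_sph_injective (f (circ α)) (h1.trans (map_zero _).symm)
  exact hcirc (hf.immersion (circ α) (h3.trans (map_zero _).symm))

/-! ### Isotopy invariance of the spin -/

/-- A small ball rides along with a point of the moving curve. The isotopy need not return `q` to
itself, so the marked point also slides along the circle, from the parameter of `q` at the start to
its parameter at the end. -/
theorem SmoothlyIsotopic.eventually_ballSpin {C C' : Set (Sph 3)} (h : SmoothlyIsotopic 1 C C')
    {q : Sph 3} (hq : q ∈ C) (hq' : q ∈ C') : ∀ᶠ κ in 𝓝[>] (0 : ℝ),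
      SmoothlyIsotopic 2 (ballSpin C (-q.1) (1 - κ)) (ballSpin C' (-q.1) (1 - κ)) := by
  obtain ⟨H, hs, he, h0, h1⟩ := h
  have hθ : ∀ t, q ∈ Set.range (fun x => H (t, x)) → ∃ θ, H (t, circ θ) = q := by
    rintro t ⟨x, hx⟩
    obtain ⟨θ, rfl⟩ := circ_surjective x
    exact ⟨θ, hx⟩
  obtain ⟨θ₀, hθ₀⟩ := hθ 0 (h0 ▸ hq)
  obtain ⟨θ₁, hθ₁⟩ := hθ 1 (h1 ▸ hq')
  -- Angles lift the circle to the line, where the two parameters of `q` can be joined linearly.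
  set θ : ℝ → ℝ := fun t => θ₀ + t * (θ₁ - θ₀) with hθdef
  set Γ : ℝ × ℝ → EuclideanSpace ℝ (Fin 4) := fun p => (H (p.1, circ (θ p.1 + p.2))).1 with hΓ
  have hΓs : ContDiff ℝ ∞ Γ := by
    rw [← contMDiff_iff_contDiff]
    have hc : ContMDiff 𝓘(ℝ, ℝ × ℝ) (𝓡 1) ∞ fun p : ℝ × ℝ => circ (θ p.1 + p.2) :=
      contMDiff_circ.comp (ContDiff.contMDiff (by fun_prop))
    have hf : ContMDiff 𝓘(ℝ, ℝ × ℝ) 𝓘(ℝ, ℝ) ∞ fun p : ℝ × ℝ => p.1 := contDiff_fst.contMDiff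
    exact contMDiff_coe_sph.comp (hs.comp (hf.prodMk hc))
  have hper : ∀ t, Function.Periodic (fun s => Γ (t, s)) (2 * Real.pi) := fun t s => by
    simp only [hΓ, ← add_assoc, circ_periodic _]
  obtain ⟨κ₀, hκ₀, hfam⟩ := exists_isBallFamily_of_curve hΓs
    (fun p => mem_sphere_zero_iff_norm.1 (H _).2) Real.two_pi_pos hper
    (fun t ht s hs s' hs' heq => by
      have h2 := eq_of_circ_eq ((he t ht).embedding.injective (Subtype.ext heq)) (by
        rw [abs_lt]
        constructor <;> linarith [hs.1, hs.2, hs'.1, hs'.2])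
      linarith)
    (fun t ht s => by
      have := deriv_comp_circ_ne_zero (he t ht) (θ t + s)
      rwa [← deriv_comp_const_add] at this)
  have hrange : ∀ t, ∀ C : Set (Sph 3), Set.range (fun x => H (t, x)) = C →
      ∀ p : Sph 3, p ∈ C ↔ ∃ s ∈ Set.Icc (0 : ℝ) (2 * Real.pi), Γ (t, s) = p.1 := by
    rintro t _ rfl p
    constructor
    · rintro ⟨x, rfl⟩
      obtain ⟨α, rfl⟩ := circ_surjective x
      obtain ⟨s, hs, h⟩ := (hper t).exists_mem_Ico₀ Real.two_pi_pos (α - θ t)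
      refine ⟨s, Set.Ico_subset_Icc_self hs, ?_⟩
      rw [← h]
      simp only [hΓ, add_sub_cancel]
    · rintro ⟨s, -, h⟩
      exact ⟨_, Subtype.ext h⟩
  have hΓ0 : Γ (0, 0) = q.1 := by
    simp only [hΓ, hθdef, zero_mul, add_zero, hθ₀]
  have hΓ1 : Γ (1, 0) = q.1 := by
    simp only [hΓ, hθdef, one_mul, add_zero, add_sub_cancel, hθ₁]
  have hnq : ‖-q.1‖ = 1 := (norm_neg _).trans (mem_sphere_zero_iff_norm.1 q.2)
  filter_upwards [Ioo_mem_nhdsGT hκ₀] with κ hκ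
  obtain ⟨a, b, hab⟩ := hfam κ hκ
  have h2 := hab.smoothlyIsotopic (hrange 0 C h0) (hrange 1 C' h1) (by rw [hΓ0, hnq])
    (by rw [hΓ1, hnq])
  simp only [hΓ0, hΓ1] at h2
  exact h2

/-- The trivial arcs of all closed tangles pass through this point, so the small balls at both ends
of an isotopy of closures coincide with those obtained by shrinking. -/
theorem ClosedTangle.arcPoint_mem_closure (T : ClosedTangle) :
    (⟨arcPoint, mem_sphere_zero_iff_norm.2 norm_arcPoint⟩ : Sph 3) ∈ T.closure := by
  obtain ⟨m, -, hm, -⟩ := T.exists_arc_min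
  exact (T.mem_closure_iff _).2 ⟨m, hm⟩

/-- The spin of a tangle depends only on the isotopy class of its closure. -/
theorem ClosedTangle.spin_isotopic {T T' : ClosedTangle}
    (h : SmoothlyIsotopic 1 T.closure T'.closure) : SmoothlyIsotopic 2 T.spin T'.spin := by
  obtain ⟨κ, ⟨h1, h2⟩, h3⟩ := ((T.eventually_ballSpin_isotopic.and
    T'.eventually_ballSpin_isotopic).and
    (h.eventually_ballSpin T.arcPoint_mem_closure T'.arcPoint_mem_closure)).exists
  exact (h1.trans h3).trans h2.symm

end

/-! ### Assembly: the spin of one tangle and the twisted double of another -/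

theorem mainTheorem3 (K J : Set (Sph 3)) (F : Set (Sph 4)) (hK : IsKnot K)
    (hJ : IsEvenSymmetricUnion K J) (hF : IsSpunKnot K F) : IsSlice F J := by
  obtain ⟨T, hTK, hT, φ, hφ, hφJ⟩ := hJ
  obtain ⟨T', hTK', hF⟩ := hF
  -- One `δ` is taken small enough both for the slice construction and for the twisted double to
  -- represent `J`.
  obtain ⟨δ, ⟨f, hf, hspin, hreg, hsec⟩, hδ⟩ :=
    ((hT.eventually_isSlice hφ).and hφJ).exists
  refine ⟨f, hf, (hF.symm.trans (ClosedTangle.spin_isotopic (hTK'.trans hTK.symm))).trans hspin,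
    hreg, ?_⟩
  rw [hsec]
  exact hδ.symm
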